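/- Let $d\in\mathbb{N}$, let $\Omega\subset\mathbb{R}^d$ be a bounded open set (for instance a bounded Lipschitz domain), let $s>d/2$ be real, $T>0$, $\lambda\neq 0$, and let $P:(0,\infty)\to\mathbb{R}$ be real analytic; for a symmetric positive definite matrix $A$, $P(A)$ is defined by the functional calculus (for example $P(\sigma)=\sigma-1$ for Oldroyd-B and $P(\sigma)=\sigma-1+\alpha(\sigma-1)^2$ for Giesekus). For real $r$ let $H^r(\Omega)$ be the space of restrictions to $\Omega$ of elements of $H^r(\mathbb{R}^d)$, with the quotient norm (on a bounded Lipschitz domain this is the usual Sobolev space). Put $$\mathcal{H}=C^1([0,T],H^{s-1}(\Omega))\cap C^0([0,T],H^s(\Omega)),\qquad \mathcal{H}'=C^0([0,T],H^{s-1}(\Omega)),$$ $H=\mathcal{H}^{d\times d}$, $H'=\mathcal{H}'^{\,d\times d}$ and $H_{sym}=\{X\in H: X^T=X\}$. Since $s>d/2$, $H$ is a Banach algebra under pointwise matrix multiplication, and multiplication extends continuously to products of an element of $H$ and an element of $H'$, with values in $H'$. Let $\|\cdot\|_H$ be any submultiplicative norm on $H$ that is equivalent to the natural one. For a velocity field $u\in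 C^0([0,T],H^s(\Omega,\mathbb{R}^d))$ put $(\nabla u)_{ij}=\partial_j u_i$, $\varepsilon(u)=\frac12(\nabla u+\nabla u^T)$ and $\Omega(u)=\frac12(\nabla u-\nabla u^T)$. Let $[X,Y]=XY-YX$, $\{X,Y\}_0=Y$, $\{X,Y\}_n=[X,\{X,Y\}_{n-1}]$, and let $B_n$ be the Bernoulli numbers. Theorem. Let $u\in C^0([0,T],H^s(\Omega,\mathbb{R}^d))$, and let $\Psi\in H_{sym}$ with $\|\Psi\|_H<\pi$ satisfy, as an equation in $H'$, $$\partial_t\Psi+(u\cdot\nabla)\Psi+[\Psi,\Omega(u)]-2\sum_{n=0}^\infty\frac{B_{2n}}{(2n)!}\{\Psi,\varepsilon(u)\}_{2n}=-\frac1\lambda P(e^{\Psi})e^{-\Psi}.$$ Then $\sigma=\exp\Psi$ (the pointwise matrix exponential) belongs to $H_{sym}$ and satisfies, as an equation in $H'$, $$\partial_t\sigma+(u\cdot\nabla)\sigma-(\varepsilon(u)+\Omega(u))\,\sigma-\sigma\,(\varepsilon(u)-\Omega(u))=-\frac1\lambda P(\sigma).$$ -/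

import Mathlib

open Set Filter Topology MeasureTheory TopologicalSpace
open scoped Distributions SchwartzMap LineDeriv ContDiff Matrix

namespace LogConf

noncomputable section

/-- The space `ℝ^d` with its Euclidean norm. -/
abbrev Space (d : ℕ) : Type := EuclideanSpace ℝ (Fin d)

/-! ### Sobolev spaces on an open set -/

/-- A real test function on `Ω`, regarded as a complex-valued Schwartz function on `ℝ^d`. -/
def testToSchwartz {d : ℕ} {Ω : Opens (Space d)} (φ : 𝓓(Ω, ℝ)) : 𝓢(Space d, ℂ) :=
  HasCompactSupport.toSchwartzMap (f := fun x => (φ x : ℂ))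
    (φ.hasCompactSupport.comp_left (g := fun r : ℝ => (r : ℂ)) Complex.ofReal_zero)
    (Complex.ofRealCLM.contDiff.comp φ.contDiff)

/-- The tempered distribution `F` on `ℝ^d` restricts to the real distribution `D` on `Ω`. -/
def RestrictsTo {d : ℕ} {Ω : Opens (Space d)} (F : 𝓢'(Space d, ℂ)) (D : 𝓓'(Ω, ℝ)) : Prop :=
  ∀ φ : 𝓓(Ω, ℝ), F (testToSchwartz φ) = ((D φ : ℝ) : ℂ)

/-- The real distributions on `Ω` that are restrictions of elements of `H^s(ℝ^d)`. -/
def sobolevSubmodule {d : ℕ} (Ω : Opens (Space d)) (s : ℝ) : Submodule ℝ 𝓓'(Ω, ℝ) where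
  carrier := {D | ∃ F : 𝓢'(Space d, ℂ), TemperedDistribution.MemSobolev s 2 F ∧ RestrictsTo F D}
  add_mem' := by
    rintro D₁ D₂ ⟨F₁, h₁, r₁⟩ ⟨F₂, h₂, r₂⟩
    refine ⟨F₁ + F₂, h₁.add h₂, fun φ => ?_⟩
    change F₁ _ + F₂ _ = ((D₁ φ + D₂ φ : ℝ) : ℂ)
    rw [r₁ φ, r₂ φ, Complex.ofReal_add]
  zero_mem' :=
    ⟨0, TemperedDistribution.memSobolev_fun_zero _ _ s 2, fun φ => Complex.ofReal_zero.symm⟩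
  smul_mem' := by
    rintro c D ⟨F, h, r⟩
    refine ⟨(c : ℂ) • F, h.smul _, fun φ => ?_⟩
    change (c : ℂ) • F _ = ((c • D φ : ℝ) : ℂ)
    rw [r φ, smul_eq_mul, smul_eq_mul, Complex.ofReal_mul]

/-- The Sobolev space `H^s(Ω) = H^s(Ω, ℝ)` of real order `s`. -/
def SobolevSpace {d : ℕ} (Ω : Opens (Space d)) (s : ℝ) : Type := sobolevSubmodule Ω s

section SobolevSpace

variable {d : ℕ} {Ω : Opens (Space d)} {s : ℝ}

instance : AddCommGroup (SobolevSpace Ω s) := inferInstanceAs (AddCommGroup (sobolevSubmodule Ω s))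

instance : Module ℝ (SobolevSpace Ω s) := inferInstanceAs (Module ℝ (sobolevSubmodule Ω s))

/-- The distribution underlying an element of `H^s(Ω)`. -/
def SobolevSpace.toDist : SobolevSpace Ω s →ₗ[ℝ] 𝓓'(Ω, ℝ) := (sobolevSubmodule Ω s).subtype

/-- The `H^s(ℝ^d)`-norms of all extensions of `D`: the norm of `F` is the `L^2`-norm of the
function `(1 - Δ)^{s/2} F` (with the normalization of the Fourier transform used by Mathlib). -/
def extensionNorms (s : ℝ) (D : 𝓓'(Ω, ℝ)) : Set ℝ :=
  {r | ∃ (F : 𝓢'(Space d, ℂ)) (f : Lp ℂ 2 (volume : Measure (Space d))),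
    TemperedDistribution.besselPotential (Space d) ℂ s F = f ∧ RestrictsTo F D ∧ r = ‖f‖}

/-- The norm of `H^s(Ω)`: the infimum of the norms of all extensions to `ℝ^d`. -/
instance : Norm (SobolevSpace Ω s) := ⟨fun D => sInf (extensionNorms s D.toDist)⟩

theorem norm_def (D : SobolevSpace Ω s) : ‖D‖ = sInf (extensionNorms s D.toDist) := rfl

theorem toDist_injective : Function.Injective (SobolevSpace.toDist (Ω := Ω) (s := s)) :=
  Subtype.val_injective

theorem extensionNorms_nonempty (D : SobolevSpace Ω s) : (extensionNorms s D.toDist).Nonempty := by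
  obtain ⟨F, ⟨f, hf⟩, r⟩ := D.2
  exact ⟨‖f‖, F, f, hf, r, rfl⟩

theorem extensionNorms_nonneg {D : 𝓓'(Ω, ℝ)} {r : ℝ} (hr : r ∈ extensionNorms s D) : 0 ≤ r := by
  obtain ⟨F, f, _, _, rfl⟩ := hr
  exact norm_nonneg f

theorem extensionNorms_bddBelow (D : 𝓓'(Ω, ℝ)) : BddBelow (extensionNorms s D) :=
  ⟨0, fun _ hr => extensionNorms_nonneg hr⟩

theorem extensionNorms_smul {D : 𝓓'(Ω, ℝ)} (c : ℝ) {r : ℝ} (hr : r ∈ extensionNorms s D) :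
    |c| * r ∈ extensionNorms s (c • D) := by
  obtain ⟨F, f, hf, hF, rfl⟩ := hr
  refine ⟨(c : ℂ) • F, (c : ℂ) • f, ?_, fun φ => ?_, ?_⟩
  · rw [map_smul, hf]
    exact (map_smul (Lp.toTemperedDistributionCLM ℂ volume 2) (c : ℂ) f).symm
  · change (c : ℂ) • F _ = ((c • D φ : ℝ) : ℂ)
    rw [hF φ, smul_eq_mul, smul_eq_mul, Complex.ofReal_mul]
  · rw [norm_smul, Complex.norm_real, Real.norm_eq_abs]

theorem extensionNorms_add {D₁ D₂ : 𝓓'(Ω, ℝ)} {r₁ r₂ : ℝ} (h₁ : r₁ ∈ extensionNorms s D₁)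
    (h₂ : r₂ ∈ extensionNorms s D₂) : ∃ r ∈ extensionNorms s (D₁ + D₂), r ≤ r₁ + r₂ := by
  obtain ⟨F₁, f₁, e₁, R₁, rfl⟩ := h₁
  obtain ⟨F₂, f₂, e₂, R₂, rfl⟩ := h₂
  refine ⟨‖f₁ + f₂‖, ⟨F₁ + F₂, f₁ + f₂, ?_, fun φ => ?_, rfl⟩, norm_add_le _ _⟩
  · rw [map_add, e₁, e₂]
    exact (map_add (Lp.toTemperedDistributionCLM ℂ volume 2) f₁ f₂).symm
  · change F₁ _ + F₂ _ = ((D₁ φ + D₂ φ : ℝ) : ℂ)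
    rw [R₁ φ, R₂ φ, Complex.ofReal_add]

theorem norm_smul_le' (c : ℝ) (D : SobolevSpace Ω s) : ‖c • D‖ ≤ |c| * ‖D‖ := by
  rw [norm_def, norm_def, ← smul_eq_mul, ← Real.sInf_smul_of_nonneg (abs_nonneg c)]
  refine csInf_le_csInf (extensionNorms_bddBelow _) ((extensionNorms_nonempty D).smul_set) ?_
  rintro _ ⟨r, hr, rfl⟩
  exact extensionNorms_smul c hr

theorem eq_zero_of_norm (D : SobolevSpace Ω s) (h : ‖D‖ = 0) : D = 0 := by
  apply toDist_injective
  rw [map_zero]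
  ext φ
  let Ev : 𝓢'(Space d, ℂ) →L[ℂ] ℂ := PointwiseConvergenceCLM.evalCLM _ _ (testToSchwartz φ)
  let L : Lp ℂ 2 (volume : Measure (Space d)) →L[ℂ] ℂ :=
    Ev ∘L TemperedDistribution.besselPotential (Space d) ℂ (-s) ∘L
      Lp.toTemperedDistributionCLM ℂ volume 2
  have key : ∀ r ∈ extensionNorms s D.toDist, ‖D.toDist φ‖ ≤ ‖L‖ * r := by
    rintro _ ⟨F, f, hf, hF, rfl⟩
    have h1 : L f = ((D.toDist φ : ℝ) : ℂ) := by
      rw [← hF φ]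
      have h2 := (TemperedDistribution.besselPotential_neg_apply_eq_iff s
        (f : 𝓢'(Space d, ℂ)) F).2 hf
      change (TemperedDistribution.besselPotential (Space d) ℂ (-s) (f : 𝓢'(Space d, ℂ)))
        (testToSchwartz φ) = _
      rw [h2]
    calc ‖D.toDist φ‖ = ‖L f‖ := by rw [h1, Complex.norm_real]
      _ ≤ ‖L‖ * ‖f‖ := L.le_opNorm f
  have h3 : ‖D.toDist φ‖ ≤ ‖L‖ * ‖D‖ := by
    rw [norm_def, ← smul_eq_mul, ← Real.sInf_smul_of_nonneg (norm_nonneg L)]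
    refine le_csInf ((extensionNorms_nonempty D).smul_set) ?_
    rintro _ ⟨r, hr, rfl⟩
    exact key r hr
  rw [h, mul_zero] at h3
  exact norm_le_zero_iff.1 h3

theorem normCore : NormedSpace.Core ℝ (SobolevSpace Ω s) where
  norm_nonneg D := Real.sInf_nonneg fun _ hr => extensionNorms_nonneg hr
  norm_smul c D := by
    rw [Real.norm_eq_abs]
    refine le_antisymm (norm_smul_le' c D) ?_
    rcases eq_or_ne c 0 with rfl | hc
    · rw [abs_zero, zero_mul]
      exact Real.sInf_nonneg fun _ hr => extensionNorms_nonneg hr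
    · have h := norm_smul_le' c⁻¹ (c • D)
      rw [smul_smul, inv_mul_cancel₀ hc, one_smul, abs_inv] at h
      have hc' : 0 < |c| := abs_pos.2 hc
      calc |c| * ‖D‖ ≤ |c| * (|c|⁻¹ * ‖c • D‖) := by gcongr
        _ = ‖c • D‖ := by rw [← mul_assoc, mul_inv_cancel₀ hc'.ne', one_mul]
  norm_triangle D₁ D₂ := by
    refine le_of_forall_pos_le_add fun ε hε => ?_
    obtain ⟨r₁, h₁, l₁⟩ := exists_lt_of_csInf_lt (extensionNorms_nonempty D₁)
      (show sInf _ < ‖D₁‖ + ε / 2 by rw [norm_def]; linarith)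
    obtain ⟨r₂, h₂, l₂⟩ := exists_lt_of_csInf_lt (extensionNorms_nonempty D₂)
      (show sInf _ < ‖D₂‖ + ε / 2 by rw [norm_def]; linarith)
    obtain ⟨r, h, l⟩ := extensionNorms_add h₁ h₂
    have h' : ‖D₁ + D₂‖ ≤ r := by
      rw [norm_def, map_add]
      exact csInf_le (extensionNorms_bddBelow _) h
    linarith
  norm_eq_zero_iff D := by
    refine ⟨eq_zero_of_norm D, ?_⟩
    rintro rfl
    have h := norm_smul_le' (0 : ℝ) (0 : SobolevSpace Ω s)
    rw [zero_smul, abs_zero, zero_mul] at h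
    exact le_antisymm h (Real.sInf_nonneg fun _ hr => extensionNorms_nonneg hr)

instance : NormedAddCommGroup (SobolevSpace Ω s) := NormedAddCommGroup.ofCore normCore

instance : NormedSpace ℝ (SobolevSpace Ω s) := NormedSpace.ofCore normCore

/-- The inclusion `H^s(Ω) → H^{s-1}(Ω)`. -/
def incl : SobolevSpace Ω s →ₗ[ℝ] SobolevSpace Ω (s - 1) :=
  LinearMap.codRestrict (sobolevSubmodule Ω (s - 1)) SobolevSpace.toDist (by
    rintro ⟨D, F, hF, r⟩
    exact ⟨F, hF.mono (by linarith), r⟩)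

/-- The partial derivative `∂_k : H^s(Ω) → H^{s-1}(Ω)` in the sense of distributions. -/
def pderiv (k : Fin d) : SobolevSpace Ω s →ₗ[ℝ] SobolevSpace Ω (s - 1) :=
  LinearMap.codRestrict (sobolevSubmodule Ω (s - 1))
    ((Distribution.lineDerivCLM (EuclideanSpace.single k (1 : ℝ)) :
      𝓓'(Ω, ℝ) →L[ℝ] 𝓓'(Ω, ℝ)).toLinearMap ∘ₗ SobolevSpace.toDist) (by
    rintro ⟨D, F, hF, r⟩
    refine ⟨∂_{(EuclideanSpace.single k (1 : ℝ) : Space d)} F, hF.lineDerivOp, fun φ => ?_⟩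
    have h1 : -(∂_{(EuclideanSpace.single k (1 : ℝ) : Space d)} (testToSchwartz φ)) =
        testToSchwartz (-(∂_{(EuclideanSpace.single k (1 : ℝ) : Space d)} φ)) := by
      ext x
      have h2 : HasFDerivAt (φ : Space d → ℝ) (fderiv ℝ φ x) x :=
        (φ.contDiff.differentiable (by simp) x).hasFDerivAt
      have h3 := (Complex.ofRealCLM.hasFDerivAt.comp x h2).fderiv
      have h4 : (∂_{(EuclideanSpace.single k (1 : ℝ) : Space d)} φ) x =
          fderiv ℝ φ x (EuclideanSpace.single k (1 : ℝ)) := by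
        rw [← (φ.contDiff.differentiable (by simp) x).lineDeriv_eq_fderiv]
        exact TestFunction.lineDerivCLM_apply_of_le (𝕜 := ℝ) (by simp)
      change -(fderiv ℝ (Complex.ofRealCLM ∘ φ) x (EuclideanSpace.single k (1 : ℝ))) =
        ((-((∂_{(EuclideanSpace.single k (1 : ℝ) : Space d)} φ) x) : ℝ) : ℂ)
      rw [h3, h4, Complex.ofReal_neg]
      rfl
    rw [TemperedDistribution.lineDerivOp_apply_apply, h1, r]
    congr 1
    exact (Distribution.lineDerivOp_apply_apply D φ _).symm)

/-- `F` is a locally integrable function on `Ω` that represents the distribution `D`. -/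
def Represents (D : 𝓓'(Ω, ℝ)) (F : Space d → ℝ) : Prop :=
  LocallyIntegrableOn F (Ω : Set (Space d)) volume ∧ ∀ φ : 𝓓(Ω, ℝ), D φ = ∫ x, F x * φ x

open Classical in
/-- A function on `Ω` representing `f` (unique up to a null set; values off `Ω` are irrelevant). -/
def SobolevSpace.toFun (f : SobolevSpace Ω s) : Space d → ℝ :=
  if h : ∃ F, Represents f.toDist F then h.choose else 0

end SobolevSpace

/-! ### Multiplication of Sobolev functions

The product of a smooth function `G` and a distribution `f` is the distribution `φ ↦ f (G φ)`.
Multiplication by `g ∈ H^s(Ω)` is the extension of this by continuity in `g`. -/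

section Multiplication

variable {d : ℕ} {Ω : Opens (Space d)} {r s : ℝ}

/-- The test function `G φ`. -/
def mulTest (G : 𝓢(Space d, ℝ)) (φ : 𝓓(Ω, ℝ)) : 𝓓(Ω, ℝ) where
  toFun x := G x * φ x
  contDiff' := (G.smooth ⊤).mul φ.contDiff
  hasCompactSupport' := φ.hasCompactSupport.mul_left
  tsupport_subset' := (tsupport_mul_subset_right).trans φ.tsupport_subset

/-- The distribution on `Ω` given by integration against a Schwartz function. -/
def schwartzDist (Ω : Opens (Space d)) (G : 𝓢(Space d, ℝ)) : 𝓓'(Ω, ℝ) where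
  toFun φ := TestFunction.integralAgainstBilinCLM (ContinuousLinearMap.mul ℝ ℝ) volume G φ
  map_add' _ _ := map_add _ _ _
  map_smul' _ _ := map_smul _ _ _
  cont := (TestFunction.integralAgainstBilinCLM (ContinuousLinearMap.mul ℝ ℝ) volume
    (G : Space d → ℝ)).continuous

theorem schwartzDist_apply (G : 𝓢(Space d, ℝ)) (φ : 𝓓(Ω, ℝ)) :
    schwartzDist Ω G φ = ∫ x, φ x * G x :=
  TestFunction.integralAgainstBilinCLM_eq_integral
    (G.continuous.locallyIntegrable.locallyIntegrableOn _)

/-- The restriction to `Ω` of a Schwartz function, as an element of `H^s(Ω)`. -/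
def restrictSchwartz (Ω : Opens (Space d)) (s : ℝ) (G : 𝓢(Space d, ℝ)) : SobolevSpace Ω s :=
  ⟨schwartzDist Ω G, SchwartzMap.toTemperedDistributionCLM (Space d) ℂ volume
      (G.postcompCLM Complex.ofRealCLM), SchwartzMap.memSobolev _, fun φ => by
    refine (SchwartzMap.toTemperedDistributionCLM_apply_apply volume
      (G.postcompCLM Complex.ofRealCLM) (testToSchwartz φ)).trans ?_
    rw [schwartzDist_apply, ← integral_complex_ofReal]
    congr 1
    ext x
    rw [Complex.ofReal_mul]
    rfl⟩

/-- `w` is the product of the distribution `f` and the function `g ∈ H^s(Ω)`: for smooth functions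
`G` converging to `g` in `H^s(Ω)`, the products `G f` converge to `w` as distributions. -/
def IsProduct (f : 𝓓'(Ω, ℝ)) (g : SobolevSpace Ω s) (w : 𝓓'(Ω, ℝ)) : Prop :=
  ∀ φ : 𝓓(Ω, ℝ),
    Tendsto (fun G => f (mulTest G φ)) (comap (restrictSchwartz Ω s) (𝓝 g)) (𝓝 (w φ))

open Classical in
/-- The multiplication `H^r(Ω) × H^s(Ω) → H^r(Ω)`, used for `s > d/2` and `r ∈ {s - 1, s}`. -/
def sobolevMul (f : SobolevSpace Ω r) (g : SobolevSpace Ω s) : SobolevSpace Ω r :=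
  if h : ∃ w : SobolevSpace Ω r, IsProduct f.toDist g w.toDist then h.choose else 0

end Multiplication

/-! ### The space `C^1([0,T], H^{s-1}(Ω)) ∩ C^0([0,T], H^s(Ω))` -/

section Evolution

variable {d : ℕ} {Ω : Opens (Space d)} {s T : ℝ}

/-- `g` is the time derivative of `f`, the difference quotients being taken in `H^{s-1}(Ω)`. -/
def HasTimeDeriv (f : C(Icc (0 : ℝ) T, SobolevSpace Ω s))
    (g : C(Icc (0 : ℝ) T, SobolevSpace Ω (s - 1))) : Prop :=
  ∀ t : Icc (0 : ℝ) T, Tendsto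
    (fun τ : Icc (0 : ℝ) T => ((τ : ℝ) - t)⁻¹ • (incl (f τ) - incl (f t))) (𝓝[≠] t) (𝓝 (g t))

/-- The functions in `C^0([0,T], H^s(Ω))` that are continuously differentiable into
`H^{s-1}(Ω)`. -/
def evolutionSubmodule (Ω : Opens (Space d)) (s T : ℝ) :
    Submodule ℝ C(Icc (0 : ℝ) T, SobolevSpace Ω s) where
  carrier := {f | ∃ g, HasTimeDeriv f g}
  add_mem' := by
    rintro f₁ f₂ ⟨g₁, h₁⟩ ⟨g₂, h₂⟩
    refine ⟨g₁ + g₂, fun t => ((h₁ t).add (h₂ t)).congr fun τ => ?_⟩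
    rw [← smul_add, ContinuousMap.add_apply, ContinuousMap.add_apply, map_add, map_add,
      add_sub_add_comm]
  zero_mem' := ⟨0, fun t => tendsto_const_nhds.congr fun τ => by
    rw [ContinuousMap.zero_apply, ContinuousMap.zero_apply, ContinuousMap.zero_apply, map_zero,
      sub_self, smul_zero]⟩
  smul_mem' := by
    rintro c f ⟨g, h⟩
    refine ⟨c • g, fun t => ((h t).const_smul c).congr fun τ => ?_⟩
    rw [smul_comm, ContinuousMap.smul_apply, ContinuousMap.smul_apply, map_smul, map_smul,
      smul_sub]

/-- The space `C^1([0,T], H^{s-1}(Ω)) ∩ C^0([0,T], H^s(Ω))`. -/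
def EvolutionSpace (Ω : Opens (Space d)) (s T : ℝ) : Type := evolutionSubmodule Ω s T

instance : AddCommGroup (EvolutionSpace Ω s T) :=
  inferInstanceAs (AddCommGroup (evolutionSubmodule Ω s T))

instance : Module ℝ (EvolutionSpace Ω s T) := inferInstanceAs (Module ℝ (evolutionSubmodule Ω s T))

/-- The underlying continuous function `[0,T] → H^s(Ω)`. -/
def EvolutionSpace.toCont (f : EvolutionSpace Ω s T) : C(Icc (0 : ℝ) T, SobolevSpace Ω s) := f.1

/-- The time derivative `∂_t f ∈ C^0([0,T], H^{s-1}(Ω))` (unique for `T > 0`). -/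
def EvolutionSpace.timeDeriv (f : EvolutionSpace Ω s T) :
    C(Icc (0 : ℝ) T, SobolevSpace Ω (s - 1)) := f.2.choose

open Classical in
/-- Multiplication, at every time, in `H^s(Ω)`. -/
instance : Mul (EvolutionSpace Ω s T) := ⟨fun f g =>
  if h : ∃ w : EvolutionSpace Ω s T, ∀ t, w.toCont t = sobolevMul (f.toCont t) (g.toCont t)
  then h.choose else 0⟩

/-- The algebra `H` of `d × d` matrices over `C^1([0,T], H^{s-1}(Ω)) ∩ C^0([0,T], H^s(Ω))`. -/
abbrev TensorField (Ω : Opens (Space d)) (s T : ℝ) : Type :=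
  Matrix (Fin d) (Fin d) (EvolutionSpace Ω s T)

/-- The value at time `t`, a matrix over `H^s(Ω)`. -/
def valueAt (X : TensorField Ω s T) (t : Icc (0 : ℝ) T) :
    Matrix (Fin d) (Fin d) (SobolevSpace Ω s) :=
  X.map fun f => f.toCont t

/-- The value at time `t` as a matrix-valued function of the position. -/
def field (X : TensorField Ω s T) (t : Icc (0 : ℝ) T) (x : Space d) : Matrix (Fin d) (Fin d) ℝ :=
  (valueAt X t).map fun f => f.toFun x

/-- The standard norm on the matrix space, from the suprema over `[0,T]` of the `H^s`-norm of the
entries and of the `H^{s-1}`-norm of their time derivatives. -/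
def stdNorm (X : TensorField Ω s T) : ℝ :=
  ∑ i, ∑ j, (‖(X i j).toCont‖ + ‖(X i j).timeDeriv‖)

/-- `N` is a Banach algebra norm on `H`: a submultiplicative norm inducing the usual topology. -/
structure IsBanachAlgebraNorm (N : Seminorm ℝ (TensorField Ω s T)) : Prop where
  mul_le : ∀ X Y : TensorField Ω s T, N (X * Y) ≤ N X * N Y
  equiv : ∃ c C : ℝ, 0 < c ∧ ∀ X : TensorField Ω s T, c * stdNorm X ≤ N X ∧ N X ≤ C * stdNorm X

end Evolution

/-! ### The two equations -/

section Equations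

variable {d : ℕ} {Ω : Opens (Space d)} {r s T : ℝ}

/-- The matrix product `X Y` with `X` over `H^s(Ω)` and `Y` over `H^r(Ω)`. -/
def leftMul (X : Matrix (Fin d) (Fin d) (SobolevSpace Ω s))
    (Y : Matrix (Fin d) (Fin d) (SobolevSpace Ω r)) : Matrix (Fin d) (Fin d) (SobolevSpace Ω r) :=
  Matrix.of fun i j => ∑ k, sobolevMul (Y k j) (X i k)

/-- The matrix product `Y X` with `X` over `H^s(Ω)` and `Y` over `H^r(Ω)`. -/
def rightMul (Y : Matrix (Fin d) (Fin d) (SobolevSpace Ω r))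
    (X : Matrix (Fin d) (Fin d) (SobolevSpace Ω s)) : Matrix (Fin d) (Fin d) (SobolevSpace Ω r) :=
  Matrix.of fun i j => ∑ k, sobolevMul (Y i k) (X k j)

/-- The commutator `[X, Y] = X Y - Y X`. -/
def comm (X : Matrix (Fin d) (Fin d) (SobolevSpace Ω s))
    (Y : Matrix (Fin d) (Fin d) (SobolevSpace Ω r)) : Matrix (Fin d) (Fin d) (SobolevSpace Ω r) :=
  leftMul X Y - rightMul Y X

/-- The iterated commutator `{X, Y}_n`. -/
def iterComm (X : Matrix (Fin d) (Fin d) (SobolevSpace Ω s))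
    (Y : Matrix (Fin d) (Fin d) (SobolevSpace Ω r)) :
    ℕ → Matrix (Fin d) (Fin d) (SobolevSpace Ω r)
  | 0 => Y
  | n + 1 => comm X (iterComm X Y n)

/-- The velocity gradient `(∇v)_{ij} = ∂_j v_i`. -/
def grad (v : Fin d → SobolevSpace Ω s) : Matrix (Fin d) (Fin d) (SobolevSpace Ω (s - 1)) :=
  Matrix.of fun i j => pderiv j (v i)

/-- The strain tensor `ε(v)`. -/
def strain (v : Fin d → SobolevSpace Ω s) : Matrix (Fin d) (Fin d) (SobolevSpace Ω (s - 1)) :=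
  (1 / 2 : ℝ) • (grad v + (grad v)ᵀ)

/-- The vorticity tensor `Ω(v)`. -/
def vorticity (v : Fin d → SobolevSpace Ω s) : Matrix (Fin d) (Fin d) (SobolevSpace Ω (s - 1)) :=
  (1 / 2 : ℝ) • (grad v - (grad v)ᵀ)

/-- `∂_t X + (v · ∇) X` at time `t`. -/
def materialDeriv (v : Fin d → SobolevSpace Ω s) (X : TensorField Ω s T) (t : Icc (0 : ℝ) T) :
    Matrix (Fin d) (Fin d) (SobolevSpace Ω (s - 1)) :=
  Matrix.of fun i j =>
    (X i j).timeDeriv t + ∑ k, sobolevMul (pderiv k (valueAt X t i j)) (v k)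

/-- `∂_t Ψ + (u · ∇) Ψ + [Ψ, Ω(u)] - 2 ∑_n B_{2n} / (2n)! {Ψ, ε(u)}_{2n}` at time `t`. -/
def logConfLHS (u : C(Icc (0 : ℝ) T, Fin d → SobolevSpace Ω s)) (Ψ : TensorField Ω s T)
    (t : Icc (0 : ℝ) T) : Matrix (Fin d) (Fin d) (SobolevSpace Ω (s - 1)) :=
  materialDeriv (u t) Ψ t + comm (valueAt Ψ t) (vorticity (u t))
    - (2 : ℝ) • ∑' n : ℕ, ((bernoulli (2 * n) : ℝ) / (Nat.factorial (2 * n) : ℝ)) •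
        iterComm (valueAt Ψ t) (strain (u t)) (2 * n)

/-- `Ψ` satisfies `∂_t Ψ + (u · ∇) Ψ + [Ψ, Ω(u)] - 2 ∑_n B_{2n} / (2n)! {Ψ, ε(u)}_{2n}
= - λ⁻¹ P(e^Ψ) e^{-Ψ}` on `[0,T]`, as an equation between matrices over `H^{s-1}(Ω)`. -/
def SolvesLogConf (lam : ℝ) (P : ℝ → ℝ) (u : C(Icc (0 : ℝ) T, Fin d → SobolevSpace Ω s))
    (Ψ : TensorField Ω s T) : Prop :=
  ∀ (t : Icc (0 : ℝ) T) (i j : Fin d), Represents (logConfLHS u Ψ t i j).toDist fun x =>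
    (-(1 / lam) • (cfc P (NormedSpace.exp (field Ψ t x)) * NormedSpace.exp (-(field Ψ t x)))) i j

/-- `∂_t σ + (u · ∇) σ - (ε(u) + Ω(u)) σ - σ (ε(u) - Ω(u))` at time `t`. -/
def constitutiveLHS (u : C(Icc (0 : ℝ) T, Fin d → SobolevSpace Ω s)) (σ : TensorField Ω s T)
    (t : Icc (0 : ℝ) T) : Matrix (Fin d) (Fin d) (SobolevSpace Ω (s - 1)) :=
  materialDeriv (u t) σ t - rightMul (strain (u t) + vorticity (u t)) (valueAt σ t)
    - leftMul (valueAt σ t) (strain (u t) - vorticity (u t))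

/-- `σ` satisfies `∂_t σ + (u · ∇) σ - (ε(u) + Ω(u)) σ - σ (ε(u) - Ω(u)) = - λ⁻¹ P(σ)` on `[0,T]`,
as an equation between matrices over `H^{s-1}(Ω)`. -/
def SolvesConstitutive (lam : ℝ) (P : ℝ → ℝ) (u : C(Icc (0 : ℝ) T, Fin d → SobolevSpace Ω s))
    (σ : TensorField Ω s T) : Prop :=
  ∀ (t : Icc (0 : ℝ) T) (i j : Fin d), Represents (constitutiveLHS u σ t i j).toDist fun x =>
    (-(1 / lam) • cfc P (field σ t x)) i j

/-- `σ = exp Ψ`: at every time and almost every point of `Ω`, the matrix `σ` is the exponential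
of the matrix `Ψ`. -/
def IsExp (Ψ σ : TensorField Ω s T) : Prop :=
  ∀ t : Icc (0 : ℝ) T, ∀ᵐ x ∂(volume.restrict (Ω : Set (Space d))),
    field σ t x = NormedSpace.exp (field Ψ t x)

end Equations

end

end LogConf

/-!
The exponential turns the logarithmic equation into the constitutive equation by an exact operator
identity, once `H^{s-1}(Ω)` is known to be a module over the algebra `H^s(Ω)`.

*Analysis.* An element of `H^r(Ω)` is the same thing as a linear functional on test functions that
is bounded for the `H^{-r}`-norm (`exists_sobolev_of_bound`), so all estimates are made on Schwartz
functions, by duality. Young's inequality on the Fourier side bounds the `H^{-s}`-norm of `φ ψ` by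
the norms of `φ` in `H^{-r}` and of `ψ` in `H^r` when `|r| ≤ s` and `s > d/2`
(`exists_sobNorm_mul_le`). This gives the continuous bilinear multiplication `mulCLM`, which agrees
with `sobolevMul`. The Sobolev inequality (`exists_abs_le_restrictSchwartz`) gives multiplicative
point evaluations `ev` on `H^s(Ω)`, which separate its elements. Identities between products (module
laws, product rules in space and time) follow from the density of Schwartz functions.

*Algebra.* Fix a time, and let `a` and `b` be the left and right multiplication by `Ψ` on matrices
over `H^{s-1}(Ω)`; they commute. Both `∂_t` and `u · ∇` are derivations, hence send `σ = e^Ψ` to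
`F ∂_t Ψ` and `F (u · ∇) Ψ`, where `F = ∫_0^1 e^{(1 - θ) a} e^{θ b} dθ` is the differential of the
exponential (`derivation_expM`, `exists_exp_tensorField`). One has `F (a - b) = e^a - e^b`, and the
Bernoulli series inverts `(e^c - 1) / c`, so that `2 F ∑_n B_{2n} / (2n)! (a - b)^{2n} = e^a + e^b`
(`dexp_bernoulli`). The series converges because `‖Ψ‖_H < π` forces `‖(a - b)^n‖ ≤ C (2 ‖Ψ‖_H)^n`
(`exists_norm_pow_le`, `norm_sub_pow_le`), while `B_{2n} / (2n)!` decays like `(2 π)^{-2n}`. Applying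
`F` to the left hand side `L` of the logarithmic equation therefore produces the left hand side of
the constitutive equation. Finally `L` is a function of `Ψ` by the equation it satisfies, thus
commutes with `Ψ`, and `F L = e^a L = σ L`, which is represented by `-λ⁻¹ P(σ)`.
-/

namespace LogConf

noncomputable section

open FourierTransform

/-! ### Bessel potentials of Schwartz functions -/

section Bessel

variable {d : ℕ}

/-- The weight `⟨ξ⟩^r = (1 + |ξ|^2)^{r/2}`, the symbol of the Bessel potential of order `r`. -/
def weight (r : ℝ) (ξ : Space d) : ℝ := (1 + ‖ξ‖ ^ 2) ^ (r / 2)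

theorem weight_pos (r : ℝ) (ξ : Space d) : 0 < weight r ξ := by
  unfold weight; positivity

theorem weight_mul (r r' : ℝ) (ξ : Space d) : weight r ξ * weight r' ξ = weight (r + r') ξ := by
  unfold weight
  rw [← Real.rpow_add (by positivity)]
  congr 1; ring

theorem weight_zero (ξ : Space d) : weight 0 ξ = 1 := by
  simp [weight]

theorem weight_neg (r : ℝ) (ξ : Space d) : weight r (-ξ) = weight r ξ := by
  simp [weight]

theorem weight_continuous (r : ℝ) : Continuous (weight (d := d) r) := by
  unfold weight
  refine Continuous.rpow_const (by fun_prop) fun x => Or.inl (by positivity)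

theorem weight_temperate (r : ℝ) :
    (fun ξ : Space d => ((weight r ξ : ℝ) : ℂ)).HasTemperateGrowth := by
  unfold weight; fun_prop

/-- The Bessel potential of order `r` on Schwartz functions, the transpose of
`TemperedDistribution.besselPotential`. -/
def bessel (r : ℝ) : 𝓢(Space d, ℂ) →L[ℂ] 𝓢(Space d, ℂ) :=
  fourierCLM ℂ 𝓢(Space d, ℂ) ∘L
    SchwartzMap.smulLeftCLM ℂ (fun ξ : Space d => ((weight r ξ : ℝ) : ℂ)) ∘L
    fourierInvCLM ℂ 𝓢(Space d, ℂ)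

theorem bessel_apply (r : ℝ) (u : 𝓢(Space d, ℂ)) :
    bessel r u = 𝓕 (SchwartzMap.smulLeftCLM ℂ (fun ξ : Space d => ((weight r ξ : ℝ) : ℂ)) (𝓕⁻ u)) :=
  rfl

theorem besselPotential_apply (r : ℝ) (F : 𝓢'(Space d, ℂ)) (u : 𝓢(Space d, ℂ)) :
    TemperedDistribution.besselPotential (Space d) ℂ r F u = F (bessel r u) := rfl

theorem bessel_bessel (r r' : ℝ) (u : 𝓢(Space d, ℂ)) :
    bessel r (bessel r' u) = bessel (r + r') u := by
  rw [bessel_apply, bessel_apply r', FourierTransform.fourierInv_fourier_eq,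
    SchwartzMap.smulLeftCLM_smulLeftCLM_apply (weight_temperate r) (weight_temperate r'),
    bessel_apply]
  congr 3
  ext ξ
  simp only [Pi.mul_apply]
  rw [← Complex.ofReal_mul, weight_mul]

theorem fourierInv_neg (u : 𝓢(Space d, ℂ)) (ξ : Space d) : 𝓕⁻ u (-ξ) = 𝓕 u ξ := by
  rw [SchwartzMap.fourierInv_coe, SchwartzMap.fourier_coe, Real.fourierInv_eq_fourier_neg, neg_neg]

/-- The Bessel potential is symmetric for the bilinear pairing, because its symbol is even. -/
theorem integral_bessel_mul (r : ℝ) (u v : 𝓢(Space d, ℂ)) :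
    ∫ x, bessel r u x * v x = ∫ x, u x * bessel r v x := by
  rw [bessel_apply, bessel_apply, SchwartzMap.integral_fourier_mul_eq,
    ← SchwartzMap.integral_fourier_mul_eq u]
  rw [← integral_neg_eq_self]
  refine integral_congr_ae (Eventually.of_forall fun ξ => ?_)
  beta_reduce
  rw [SchwartzMap.smulLeftCLM_apply_apply (weight_temperate r),
    SchwartzMap.smulLeftCLM_apply_apply (weight_temperate r), weight_neg, fourierInv_neg,
    smul_eq_mul, smul_eq_mul]
  have h : 𝓕 v (-ξ) = 𝓕⁻ v ξ := by rw [← fourierInv_neg, neg_neg]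
  rw [h]; ring

theorem conj_fourier {u : 𝓢(Space d, ℂ)} (ξ : Space d) (v : 𝓢(Space d, ℂ))
    (h : ∀ x, v x = starRingEnd ℂ (u x)) : starRingEnd ℂ (𝓕 u ξ) = 𝓕⁻ v ξ := by
  rw [SchwartzMap.fourier_coe, SchwartzMap.fourierInv_coe, Real.fourier_eq', Real.fourierInv_eq',
    ← integral_conj]
  congr 1
  ext x
  simp only [smul_eq_mul, map_mul, h, ← Complex.exp_conj, Complex.conj_I, Complex.conj_ofReal]
  congr 2
  push_cast
  ring

/-- Pointwise complex conjugation of Schwartz functions. -/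
def conjS (u : 𝓢(Space d, ℂ)) : 𝓢(Space d, ℂ) :=
  SchwartzMap.postcompCLM (𝕜 := ℝ) (Complex.conjCLE : ℂ →L[ℝ] ℂ) u

theorem conjS_apply (u : 𝓢(Space d, ℂ)) (x : Space d) : conjS u x = starRingEnd ℂ (u x) := rfl

theorem conj_bessel (r : ℝ) (u : 𝓢(Space d, ℂ)) : conjS (bessel r u) = bessel r (conjS u) := by
  ext x
  rw [conjS_apply, bessel_apply, conj_fourier x (conjS _) fun _ => rfl, bessel_apply,
    ← fourierInv_neg]
  have key : conjS (SchwartzMap.smulLeftCLM ℂ (fun ξ : Space d => ((weight r ξ : ℝ) : ℂ)) (𝓕⁻ u)) =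
      SchwartzMap.smulLeftCLM ℂ (fun ξ : Space d => ((weight r ξ : ℝ) : ℂ)) (𝓕 (conjS u)) := by
    ext ξ
    rw [conjS_apply, SchwartzMap.smulLeftCLM_apply_apply (weight_temperate r),
      SchwartzMap.smulLeftCLM_apply_apply (weight_temperate r)]
    simp only [smul_eq_mul, map_mul, Complex.conj_ofReal]
    congr 1
    rw [← fourierInv_neg (conjS u) ξ, ← conj_fourier (u := u) (-ξ) (conjS u) fun _ => rfl,
      ← fourierInv_neg u, neg_neg]
  rw [key]
  rw [SchwartzMap.fourierInv_coe, SchwartzMap.fourierInv_coe, Real.fourierInv_eq',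
    Real.fourierInv_eq', ← integral_neg_eq_self]
  congr 1
  ext ξ
  rw [SchwartzMap.smulLeftCLM_apply_apply (weight_temperate r),
      SchwartzMap.smulLeftCLM_apply_apply (weight_temperate r), weight_neg,
      ← fourierInv_neg (conjS u) (-ξ), neg_neg, inner_neg_left, inner_neg_right]

/-- The Bessel potential of a real Schwartz function is real. -/
theorem bessel_im (r : ℝ) (u : 𝓢(Space d, ℂ)) (hu : ∀ x, (u x).im = 0) (x : Space d) :
    (bessel r u x).im = 0 := by
  have h : conjS u = u := by
    ext x
    rw [conjS_apply]
    exact Complex.conj_eq_iff_im.2 (hu x)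
  have h2 := conj_bessel r u
  rw [h] at h2
  have h3 := congrArg (fun v : 𝓢(Space d, ℂ) => v x) h2
  exact Complex.conj_eq_iff_im.1 h3

/-- The `H^r`-norm of a Schwartz function. -/
def sobNorm (r : ℝ) (u : 𝓢(Space d, ℂ)) : ℝ := ‖(bessel r u).toLp 2‖

theorem sobNorm_nonneg (r : ℝ) (u : 𝓢(Space d, ℂ)) : 0 ≤ sobNorm r u := norm_nonneg _

theorem sobNorm_bessel (r r' : ℝ) (u : 𝓢(Space d, ℂ)) :
    sobNorm r (bessel r' u) = sobNorm (r + r') u := by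
  rw [sobNorm, bessel_bessel, sobNorm]

theorem sobNorm_sq (r : ℝ) (u : 𝓢(Space d, ℂ)) :
    ENNReal.ofReal (sobNorm r u) ^ 2 = ∫⁻ ξ, (‖weight r ξ‖ₑ * ‖𝓕⁻ u ξ‖ₑ) ^ 2 := by
  rw [sobNorm, bessel_apply, SchwartzMap.norm_fourier_toL2_eq, SchwartzMap.norm_toLp,
    ENNReal.ofReal_toReal (SchwartzMap.eLpNorm_lt_top _ 2 volume).ne,
    eLpNorm_eq_lintegral_rpow_enorm_toReal (by norm_num) (by norm_num)]
  simp only [ENNReal.toReal_ofNat, ENNReal.rpow_ofNat, one_div]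
  rw [← ENNReal.rpow_natCast, ← ENNReal.rpow_mul]
  norm_num
  congr 1
  ext ξ
  rw [SchwartzMap.smulLeftCLM_apply_apply (weight_temperate r), enorm_smul]
  congr 2
  rw [← ofReal_norm, Complex.norm_real, ofReal_norm]

theorem norm_integral_mul_le_toLp (f : Lp ℂ 2 (volume : Measure (Space d))) (v : 𝓢(Space d, ℂ)) :
    ‖∫ x, v x * f x‖ ≤ ‖v.toLp 2‖ * ‖f‖ := by
  have h : inner ℂ ((conjS v).toLp 2) f = ∫ x, v x * f x := by
    rw [MeasureTheory.L2.inner_def]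
    refine integral_congr_ae ?_
    filter_upwards [(conjS v).coeFn_toLp 2] with x hx
    rw [hx, RCLike.inner_apply, conjS_apply, Complex.conj_conj, mul_comm]
  have h2 : ‖(conjS v).toLp 2‖ = ‖v.toLp 2‖ := by
    rw [SchwartzMap.norm_toLp, SchwartzMap.norm_toLp]
    congr 1
    refine eLpNorm_congr_norm_ae (Eventually.of_forall fun x => ?_)
    rw [conjS_apply, RCLike.norm_conj]
  rw [← h, ← h2]
  exact norm_inner_le_norm _ _

/-- A Schwartz function that is dual to `u`: `H^{-r}` tests the `H^r`-norm. -/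
theorem integral_mul_bessel_self (r : ℝ) (u : 𝓢(Space d, ℂ)) (hu : ∀ x, (u x).im = 0) :
    ∫ x, u x * bessel (2 * r) u x = ((sobNorm r u ^ 2 : ℝ) : ℂ) := by
  have h : ∫ x, u x * bessel (2 * r) u x = ∫ x, bessel r u x * bessel r u x := by
    rw [integral_bessel_mul, bessel_bessel, two_mul]
  have h2 : inner ℂ ((bessel r u).toLp 2) ((bessel r u).toLp 2) =
      ∫ x, bessel r u x * bessel r u x := by
    rw [SchwartzMap.inner_toL2_toL2_eq _ _ volume]
    congr 1
    ext x
    rw [RCLike.inner_apply, Complex.conj_eq_iff_im.2 (bessel_im r u hu x)]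
  rw [h, ← h2, sobNorm, inner_self_eq_norm_sq_to_K]
  simp

end Bessel

/-! ### The product estimate -/

section ProductEstimate

theorem rpow_mul_rpow_le {a b c r s : ℝ} (ha : 0 < a) (hb : 0 < b) (hc : 0 < c) (h : b ≤ a + c)
    (hr : 0 ≤ r) (hrs : r ≤ s) :
    a ^ (-s) * b ^ r * c ^ (-r) ≤ 2 ^ s * (a ^ (-s) + c ^ (-s)) := by
  have h2 : (2 : ℝ) ^ r ≤ 2 ^ s := Real.rpow_le_rpow_of_exponent_le (by norm_num) hrs
  have hpa := Real.rpow_pos_of_pos ha (-s)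
  have hpc := Real.rpow_pos_of_pos hc (-s)
  rcases le_total a c with hac | hac
  · have h1 : b ^ r ≤ 2 ^ s * c ^ r :=
      calc b ^ r ≤ (2 * c) ^ r := Real.rpow_le_rpow hb.le (by linarith) hr
        _ = 2 ^ r * c ^ r := Real.mul_rpow (by norm_num) hc.le
        _ ≤ _ := by gcongr
    have h3 : c ^ r * c ^ (-r) = 1 := by rw [← Real.rpow_add hc]; simp
    calc a ^ (-s) * b ^ r * c ^ (-r) ≤ a ^ (-s) * (2 ^ s * c ^ r) * c ^ (-r) := by gcongr
      _ = 2 ^ s * a ^ (-s) * (c ^ r * c ^ (-r)) := by ring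
      _ ≤ _ := by rw [h3]; nlinarith [Real.rpow_pos_of_pos (show (0 : ℝ) < 2 by norm_num) s]
  · have h1 : b ^ r ≤ 2 ^ s * a ^ r :=
      calc b ^ r ≤ (2 * a) ^ r := Real.rpow_le_rpow hb.le (by linarith) hr
        _ = 2 ^ r * a ^ r := Real.mul_rpow (by norm_num) ha.le
        _ ≤ _ := by gcongr
    have h3 : a ^ (-s) * a ^ r ≤ c ^ (-s) * c ^ r := by
      rw [← Real.rpow_add ha, ← Real.rpow_add hc]
      exact Real.rpow_le_rpow_of_nonpos hc hac (by linarith)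
    have h4 : c ^ r * c ^ (-r) = 1 := by rw [← Real.rpow_add hc]; simp
    calc a ^ (-s) * b ^ r * c ^ (-r) ≤ a ^ (-s) * (2 ^ s * a ^ r) * c ^ (-r) := by gcongr
      _ = 2 ^ s * (a ^ (-s) * a ^ r) * c ^ (-r) := by ring
      _ ≤ 2 ^ s * (c ^ (-s) * c ^ r) * c ^ (-r) := by gcongr
      _ = 2 ^ s * c ^ (-s) * (c ^ r * c ^ (-r)) := by ring
      _ ≤ _ := by rw [h4]; nlinarith [Real.rpow_pos_of_pos (show (0 : ℝ) < 2 by norm_num) s]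

variable {d : ℕ}

theorem weight_eq_rpow (r : ℝ) (ξ : Space d) : weight r ξ = (weight 1 ξ) ^ r := by
  unfold weight
  rw [← Real.rpow_mul (by positivity)]
  congr 1; ring

theorem weight_one_add_le (ξ η : Space d) : weight 1 (ξ + η) ≤ weight 1 ξ + weight 1 η := by
  unfold weight
  rw [← Real.sqrt_eq_rpow, ← Real.sqrt_eq_rpow, ← Real.sqrt_eq_rpow]
  have h1 := norm_add_le ξ η
  have h2 := Real.sq_sqrt (show 0 ≤ 1 + ‖ξ‖ ^ 2 by positivity)
  have h3 := Real.sq_sqrt (show 0 ≤ 1 + ‖η‖ ^ 2 by positivity)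
  have h4 : ‖ξ‖ ≤ √(1 + ‖ξ‖ ^ 2) := Real.le_sqrt_of_sq_le (by linarith)
  have h5 : ‖η‖ ≤ √(1 + ‖η‖ ^ 2) := Real.le_sqrt_of_sq_le (by linarith)
  refine Real.sqrt_le_iff.2 ⟨by positivity, ?_⟩
  have h6 : ‖ξ‖ * ‖η‖ ≤ √(1 + ‖ξ‖ ^ 2) * √(1 + ‖η‖ ^ 2) := by gcongr
  have h7 : ‖ξ + η‖ ^ 2 ≤ (‖ξ‖ + ‖η‖) ^ 2 := by gcongr
  nlinarith

/-- A Peetre-type inequality for the kernel of multiplication on the Fourier side. -/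
theorem weight_kernel_le {r s : ℝ} (hr : |r| ≤ s) (ξ t : Space d) :
    weight (-s) ξ * weight r t * weight (-r) (ξ - t) ≤
      2 ^ s * (weight (-s) ξ + weight (-s) t + weight (-s) (ξ - t)) := by
  have h2 : (0 : ℝ) < 2 ^ s := by positivity
  have hp := weight_pos (-s) t
  have hp' := weight_pos (-s) (ξ - t)
  have hn : weight 1 (-ξ) = weight 1 ξ := weight_neg 1 ξ
  have hn' : weight 1 (-t) = weight 1 t := weight_neg 1 t
  rcases le_total 0 r with h | h
  · have key := rpow_mul_rpow_le (weight_pos 1 ξ) (weight_pos 1 t) (weight_pos 1 (ξ - t)) (by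
      have h3 := weight_one_add_le ξ (-(ξ - t))
      rw [weight_neg] at h3
      simpa using h3) h ((le_abs_self r).trans hr)
    simp only [← weight_eq_rpow] at key
    nlinarith
  · have key := rpow_mul_rpow_le (weight_pos 1 ξ) (weight_pos 1 (ξ - t)) (weight_pos 1 t) (by
      have h3 := weight_one_add_le ξ (-t)
      rw [weight_neg] at h3
      rwa [sub_eq_add_neg]) (neg_nonneg.2 h) ((neg_le_abs r).trans hr)
    simp only [← weight_eq_rpow, neg_neg] at key
    nlinarith

theorem lintegral_weight_sq_lt_top {s : ℝ} (hs : (d : ℝ) / 2 < s) :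
    ∫⁻ ξ : Space d, ‖weight (-s) ξ‖ₑ ^ 2 < ⊤ := by
  have h := (integrable_rpow_neg_one_add_norm_sq (E := Space d) (μ := volume) (r := 2 * s)
    (by rw [finrank_euclideanSpace_fin]; linarith)).lintegral_lt_top
  refine lt_of_le_of_lt (le_of_eq ?_) h
  congr 1
  ext ξ
  rw [← ofReal_norm, Real.norm_of_nonneg (weight_pos _ _).le,
    ← ENNReal.ofReal_pow (weight_pos _ _).le, sq, weight_mul]
  congr 1
  unfold weight
  congr 1
  ring

theorem lintegral_mul_sq_le {α : Type*} [MeasurableSpace α] {μ : Measure α} {f g : α → ENNReal}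
    (hf : AEMeasurable f μ) (hg : AEMeasurable g μ) :
    (∫⁻ x, f x * g x ∂μ) ^ 2 ≤ (∫⁻ x, f x ^ 2 ∂μ) * ∫⁻ x, g x ^ 2 ∂μ := by
  have h := ENNReal.lintegral_mul_le_Lp_mul_Lq μ
    (Real.HolderConjugate.two_two) hf hg
  calc _ ≤ _ := pow_le_pow_left' h 2
    _ = _ := by
      rw [mul_pow]
      simp only [ENNReal.rpow_ofNat, ← ENNReal.rpow_natCast, ← ENNReal.rpow_mul]
      norm_num

/-- Young's inequality for `L¹ * L² → L²`. -/
theorem lintegral_conv_sq_le {c g : Space d → ENNReal} (hc : Measurable c) (hg : Measurable g) :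
    ∫⁻ ξ, (∫⁻ t, c t * g (ξ - t)) ^ 2 ≤ (∫⁻ t, c t) ^ 2 * ∫⁻ t, g t ^ 2 := by
  have h1 : ∀ ξ, (∫⁻ t, c t * g (ξ - t)) ^ 2 ≤ (∫⁻ t, c t) * ∫⁻ t, c t * g (ξ - t) ^ 2 := by
    intro ξ
    have h := lintegral_mul_sq_le (μ := volume) (f := fun t => c t ^ (1 / 2 : ℝ))
      (g := fun t => c t ^ (1 / 2 : ℝ) * g (ξ - t)) (by fun_prop) (by fun_prop)
    have e : ∀ t, (c t ^ (1 / 2 : ℝ)) ^ 2 = c t := fun t => by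
      rw [← ENNReal.rpow_natCast, ← ENNReal.rpow_mul]; norm_num
    simp only [mul_pow, e, ← mul_assoc, ← sq] at h
    exact h
  calc _ ≤ ∫⁻ ξ, (∫⁻ t, c t) * ∫⁻ t, c t * g (ξ - t) ^ 2 := lintegral_mono h1
    _ = (∫⁻ t, c t) * ∫⁻ ξ, ∫⁻ t, c t * g (ξ - t) ^ 2 :=
      lintegral_const_mul _ (Measurable.lintegral_prod_right (by fun_prop))
    _ = (∫⁻ t, c t) * ∫⁻ t, ∫⁻ ξ, c t * g (ξ - t) ^ 2 := by
      rw [lintegral_lintegral_swap (by fun_prop)]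
    _ = (∫⁻ t, c t) * ∫⁻ t, c t * ∫⁻ ξ, g ξ ^ 2 := by
      congr 1
      refine lintegral_congr fun t => ?_
      rw [lintegral_const_mul _ (by fun_prop), lintegral_sub_right_eq_self (fun ξ => g ξ ^ 2) t]
    _ = _ := by
      rw [lintegral_mul_const _ hc]; ring

theorem fourierInv_mul_enorm_le (φ ψ u : 𝓢(Space d, ℂ)) (hu : ∀ x, u x = φ x * ψ x)
    (ξ : Space d) : ‖𝓕⁻ u ξ‖ₑ ≤ ∫⁻ t, ‖𝓕⁻ φ t‖ₑ * ‖𝓕⁻ ψ (ξ - t)‖ₑ := by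
  have h : u = 𝓕 (SchwartzMap.convolution (ContinuousLinearMap.mul ℂ ℂ) (𝓕⁻ φ) (𝓕⁻ ψ)) := by
    rw [SchwartzMap.fourier_convolution, FourierTransform.fourier_fourierInv_eq,
      FourierTransform.fourier_fourierInv_eq]
    ext x
    rw [SchwartzMap.pairing_apply_apply, hu]
    rfl
  rw [h, FourierTransform.fourierInv_fourier_eq, SchwartzMap.convolution_apply,
    MeasureTheory.convolution_def]
  refine (enorm_integral_le_lintegral_enorm _).trans (le_of_eq ?_)
  refine lintegral_congr fun t => ?_
  rw [ContinuousLinearMap.mul_apply', enorm_mul]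

theorem add_add_sq_le (x y z : ENNReal) : (x + y + z) ^ 2 ≤ 3 * (x ^ 2 + y ^ 2 + z ^ 2) := by
  have h3 := ENNReal.inner_le_Lp_mul_Lq (Finset.univ : Finset (Fin 3)) (fun _ => 1) ![x, y, z]
    Real.HolderConjugate.two_two
  simp only [Fin.sum_univ_three, one_mul, Matrix.cons_val_zero, Matrix.cons_val_one,
    Matrix.cons_val] at h3
  calc _ ≤ _ := pow_le_pow_left' h3 2
    _ = _ := by
      rw [mul_pow]
      simp only [ENNReal.rpow_ofNat, ← ENNReal.rpow_natCast, ← ENNReal.rpow_mul]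
      norm_num

theorem lintegral_weighted_conv_sq_le {S A B : Space d → ENNReal} (hS : Measurable S)
    (hA : Measurable A) (hB : Measurable B) :
    ∫⁻ ξ, (∫⁻ t, (S ξ + S t + S (ξ - t)) * (A t * B (ξ - t))) ^ 2 ≤
      9 * (∫⁻ t, S t ^ 2) * ((∫⁻ t, A t ^ 2) * ∫⁻ t, B t ^ 2) := by
  have tX : ∫⁻ ξ, (S ξ * ∫⁻ t, A t * B (ξ - t)) ^ 2 ≤
      (∫⁻ t, S t ^ 2) * ((∫⁻ t, A t ^ 2) * ∫⁻ t, B t ^ 2) := by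
    rw [← lintegral_mul_const _ (by fun_prop)]
    refine lintegral_mono fun ξ => ?_
    rw [mul_pow]
    gcongr
    refine (lintegral_mul_sq_le (by fun_prop) (by fun_prop)).trans ?_
    rw [lintegral_sub_left_eq_self (fun t => B t ^ 2) ξ]
  have tY : ∫⁻ ξ, (∫⁻ t, (S t * A t) * B (ξ - t)) ^ 2 ≤
      (∫⁻ t, S t ^ 2) * ((∫⁻ t, A t ^ 2) * ∫⁻ t, B t ^ 2) := by
    refine (lintegral_conv_sq_le (c := fun t => S t * A t) (by fun_prop) hB).trans ?_
    rw [← mul_assoc]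
    gcongr
    exact lintegral_mul_sq_le hS.aemeasurable hA.aemeasurable
  have tZ : ∫⁻ ξ, (∫⁻ t, A t * (S (ξ - t) * B (ξ - t))) ^ 2 ≤
      (∫⁻ t, S t ^ 2) * ((∫⁻ t, A t ^ 2) * ∫⁻ t, B t ^ 2) := by
    have e : ∀ ξ, ∫⁻ t, A t * (S (ξ - t) * B (ξ - t)) = ∫⁻ t, (S t * B t) * A (ξ - t) := by
      intro ξ
      rw [← lintegral_sub_left_eq_self _ ξ]
      refine lintegral_congr fun t => ?_
      rw [sub_sub_cancel, mul_comm]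
    simp only [e]
    refine (lintegral_conv_sq_le (c := fun t => S t * B t) (by fun_prop) hA).trans ?_
    rw [mul_comm (∫⁻ t, A t ^ 2), ← mul_assoc]
    gcongr
    exact lintegral_mul_sq_le hS.aemeasurable hB.aemeasurable
  have hXm : Measurable fun ξ => (S ξ * ∫⁻ t, A t * B (ξ - t)) ^ 2 :=
    (hS.mul (Measurable.lintegral_prod_right (by fun_prop))).pow_const 2
  have hZm : Measurable fun ξ => (∫⁻ t, A t * (S (ξ - t) * B (ξ - t))) ^ 2 :=
    (Measurable.lintegral_prod_right (by fun_prop)).pow_const 2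
  have split : ∀ ξ, ∫⁻ t, (S ξ + S t + S (ξ - t)) * (A t * B (ξ - t)) =
      S ξ * (∫⁻ t, A t * B (ξ - t)) + (∫⁻ t, (S t * A t) * B (ξ - t)) +
        ∫⁻ t, A t * (S (ξ - t) * B (ξ - t)) := by
    intro ξ
    rw [← lintegral_const_mul _ (by fun_prop), ← lintegral_add_left (by fun_prop),
      ← lintegral_add_left (by fun_prop)]
    refine lintegral_congr fun t => ?_
    ring
  rw [mul_assoc]
  generalize (∫⁻ t, S t ^ 2) * ((∫⁻ t, A t ^ 2) * ∫⁻ t, B t ^ 2) = J at tX tY tZ ⊢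
  simp only [split]
  refine (lintegral_mono fun ξ => add_add_sq_le _ _ _).trans ?_
  rw [lintegral_const_mul' _ _ (by norm_num), lintegral_add_right _ hZm,
    lintegral_add_left hXm]
  calc _ ≤ 3 * (J + J + J) := by gcongr
    _ = _ := by ring

theorem weight_kernel_enorm_le {r s : ℝ} (hr : |r| ≤ s) (ξ t : Space d) (x y : ENNReal) :
    ‖weight (-s) ξ‖ₑ * (x * y) ≤ ENNReal.ofReal (2 ^ s) *
      ((‖weight (-s) ξ‖ₑ + ‖weight (-s) t‖ₑ + ‖weight (-s) (ξ - t)‖ₑ) *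
        ((‖weight (-r) t‖ₑ * x) * (‖weight r (ξ - t)‖ₑ * y))) := by
  have h1 : ‖weight (-s) ξ‖ₑ * ‖weight r t‖ₑ * ‖weight (-r) (ξ - t)‖ₑ ≤
      ENNReal.ofReal (2 ^ s) * (‖weight (-s) ξ‖ₑ + ‖weight (-s) t‖ₑ + ‖weight (-s) (ξ - t)‖ₑ) := by
    have h2 := ENNReal.ofReal_le_ofReal (weight_kernel_le hr ξ t)
    have e : ∀ (q : ℝ) (η : Space d), ENNReal.ofReal (weight q η) = ‖weight q η‖ₑ := fun q η => by
      rw [← ofReal_norm, Real.norm_of_nonneg (weight_pos _ _).le]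
    have p := fun (q : ℝ) (η : Space d) => (weight_pos q η).le
    rw [ENNReal.ofReal_mul (mul_nonneg (p _ _) (p _ _)), ENNReal.ofReal_mul (p _ _),
      ENNReal.ofReal_mul (by positivity), ENNReal.ofReal_add (add_nonneg (p _ _) (p _ _)) (p _ _),
      ENNReal.ofReal_add (p _ _) (p _ _)] at h2
    simpa only [e] using h2
  have e1 : ∀ (q : ℝ) (η : Space d), ‖weight q η‖ₑ * ‖weight (-q) η‖ₑ = 1 := fun q η => by
    rw [← enorm_mul, weight_mul, add_neg_cancel, weight_zero]; simp
  have e2 : ‖weight (-r) t‖ₑ * ‖weight r t‖ₑ = 1 := by rw [mul_comm]; exact e1 r t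
  calc ‖weight (-s) ξ‖ₑ * (x * y)
      = ‖weight (-s) ξ‖ₑ * (((‖weight (-r) t‖ₑ * ‖weight r t‖ₑ) * x) *
          ((‖weight r (ξ - t)‖ₑ * ‖weight (-r) (ξ - t)‖ₑ) * y)) := by
        rw [e1, e2, one_mul, one_mul]
    _ = (‖weight (-s) ξ‖ₑ * ‖weight r t‖ₑ * ‖weight (-r) (ξ - t)‖ₑ) *
          ((‖weight (-r) t‖ₑ * x) * (‖weight r (ξ - t)‖ₑ * y)) := by ring
    _ ≤ _ := by rw [← mul_assoc (ENNReal.ofReal (2 ^ s))]; gcongr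

/-- For `s > d/2` and `|r| ≤ s`, the product of a function in `H^{-r}` and a function in `H^r` is
in `H^{-s}`. On the Fourier side the kernel of the product splits, by `weight_kernel_le`, into three
terms, each of which is bounded by the Cauchy-Schwarz and the Young inequality. -/
theorem exists_sobNorm_mul_le {r s : ℝ} (hr : |r| ≤ s) (hs : (d : ℝ) / 2 < s) :
    ∃ C : ℝ, 0 ≤ C ∧ ∀ φ ψ u : 𝓢(Space d, ℂ), (∀ x, u x = φ x * ψ x) →
      sobNorm (-s) u ≤ C * (sobNorm (-r) φ * sobNorm r ψ) := by
  have hI' := (lintegral_weight_sq_lt_top hs).ne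
  generalize hI : ∫⁻ ξ : Space d, ‖weight (-s) ξ‖ₑ ^ 2 = I at hI'
  obtain ⟨M, hM⟩ : ∃ M : ENNReal, M = (ENNReal.ofReal (2 ^ s) ^ 2 * (9 * I)) ^ (1 / 2 : ℝ) :=
    ⟨_, rfl⟩
  have hM' : M ≠ ⊤ := by
    rw [hM]
    refine ENNReal.rpow_ne_top_of_nonneg (by norm_num) ?_
    exact ENNReal.mul_ne_top (ENNReal.pow_ne_top ENNReal.ofReal_ne_top)
      (ENNReal.mul_ne_top (by norm_num) hI')
  have hMsq : M ^ 2 = ENNReal.ofReal (2 ^ s) ^ 2 * (9 * I) := by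
    rw [hM, ← ENNReal.rpow_natCast, ← ENNReal.rpow_mul]; norm_num
  refine ⟨M.toReal, ENNReal.toReal_nonneg, fun φ ψ u hu => ?_⟩
  have hwm : ∀ r : ℝ, Measurable fun ξ : Space d => ‖weight r ξ‖ₑ := fun r =>
    (weight_continuous r).measurable.enorm
  have hφm : Measurable fun ξ => ‖𝓕⁻ φ ξ‖ₑ := (𝓕⁻ φ).continuous.measurable.enorm
  have hψm : Measurable fun ξ => ‖𝓕⁻ ψ ξ‖ₑ := (𝓕⁻ ψ).continuous.measurable.enorm
  have key := lintegral_weighted_conv_sq_le (hwm (-s)) ((hwm (-r)).mul hφm) ((hwm r).mul hψm)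
  simp only [Pi.mul_apply] at key
  rw [← sobNorm_sq, ← sobNorm_sq, hI] at key
  have bound : ∀ ξ, ‖weight (-s) ξ‖ₑ * ‖𝓕⁻ u ξ‖ₑ ≤ ENNReal.ofReal (2 ^ s) *
      ∫⁻ t, (‖weight (-s) ξ‖ₑ + ‖weight (-s) t‖ₑ + ‖weight (-s) (ξ - t)‖ₑ) *
        ((‖weight (-r) t‖ₑ * ‖𝓕⁻ φ t‖ₑ) * (‖weight r (ξ - t)‖ₑ * ‖𝓕⁻ ψ (ξ - t)‖ₑ)) := by
    intro ξ
    refine (mul_le_mul_right (fourierInv_mul_enorm_le φ ψ u hu ξ) _).trans ?_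
    rw [← lintegral_const_mul' _ _ enorm_ne_top, ← lintegral_const_mul' _ _ ENNReal.ofReal_ne_top]
    exact lintegral_mono fun t => weight_kernel_enorm_le hr ξ t _ _
  have fin : ENNReal.ofReal (sobNorm (-s) u) ^ 2 ≤
      (M * (ENNReal.ofReal (sobNorm (-r) φ) * ENNReal.ofReal (sobNorm r ψ))) ^ 2 := by
    rw [sobNorm_sq, mul_pow, mul_pow, hMsq, mul_assoc]
    refine (lintegral_mono fun ξ => pow_le_pow_left' (bound ξ) 2).trans ?_
    simp only [mul_pow (ENNReal.ofReal (2 ^ s))]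
    rw [lintegral_const_mul' _ _ (ENNReal.pow_ne_top ENNReal.ofReal_ne_top)]
    gcongr
  have fin2 := (ENNReal.pow_le_pow_left_iff two_ne_zero).1 fin
  have e : M * (ENNReal.ofReal (sobNorm (-r) φ) * ENNReal.ofReal (sobNorm r ψ)) =
      ENNReal.ofReal (M.toReal * (sobNorm (-r) φ * sobNorm r ψ)) := by
    rw [ENNReal.ofReal_mul ENNReal.toReal_nonneg, ENNReal.ofReal_toReal hM',
      ENNReal.ofReal_mul (sobNorm_nonneg _ _)]
  rw [e] at fin2
  exact (ENNReal.ofReal_le_ofReal_iff (mul_nonneg ENNReal.toReal_nonneg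
    (mul_nonneg (sobNorm_nonneg _ _) (sobNorm_nonneg _ _)))).1 fin2

end ProductEstimate

/-! ### `H^r(Ω)` as a dual space -/

section Dual

variable {d : ℕ} {Ω : Opens (Space d)} {r s : ℝ}

theorem testToSchwartz_im (φ : 𝓓(Ω, ℝ)) (x : Space d) : (testToSchwartz φ x).im = 0 := rfl

theorem continuous_testToSchwartz_ofSupportedIn (K : Compacts (Space d))
    (hK : (K : Set (Space d)) ⊆ Ω) :
    Continuous ((testToSchwartz (Ω := Ω)) ∘ TestFunction.ofSupportedIn hK) := by
  let L : 𝓓_{K}(Space d, ℝ) →ₗ[ℝ] 𝓢(Space d, ℂ) :=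
    { toFun := fun f => testToSchwartz (TestFunction.ofSupportedIn hK f)
      map_add' := fun f g => by
        ext x; exact Complex.ofReal_add _ _
      map_smul' := fun c f => by
        ext x; exact Complex.ofReal_mul _ _ }
  change Continuous L
  refine WithSeminorms.continuous_of_isBounded (ContDiffMapSupportedIn.withSeminorms ℝ _ _ _ _)
    (schwartz_withSeminorms ℝ _ _) L (Seminorm.IsBounded.of_real ?_)
  rintro ⟨k, n⟩
  obtain ⟨R, hR⟩ := K.isCompact.isBounded.exists_norm_le
  refine ⟨{n}, |R| ^ k, fun f => ?_⟩
  rw [Finset.sup_singleton]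
  change SchwartzMap.seminorm ℝ k n (L f) ≤ |R| ^ k * _
  refine SchwartzMap.seminorm_le_bound ℝ k n _ (mul_nonneg (by positivity) (apply_nonneg _ _)) ?_
  intro x
  have h1 : ‖iteratedFDeriv ℝ n (L f) x‖ = ‖iteratedFDeriv ℝ n f x‖ :=
    LinearIsometry.norm_iteratedFDeriv_comp_left (i := n) (n := ∞) Complex.ofRealLI
      (f.contDiff.contDiffAt) (by exact_mod_cast le_top)
  rw [h1]
  by_cases hx : x ∈ K
  · gcongr
    · exact (hR x hx).trans (le_abs_self R)
    · exact ContDiffMapSupportedIn.norm_iteratedFDeriv_apply_le_seminorm_top ℝ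
  · rw [f.iteratedFDeriv_zero_on_compl hx]
    simp only [Pi.zero_apply, norm_zero, mul_zero]
    exact mul_nonneg (by positivity) (apply_nonneg _ _)

variable (Ω) in
/-- `testToSchwartz` as a continuous linear map. -/
def testCLM : 𝓓(Ω, ℝ) →L[ℝ] 𝓢(Space d, ℂ) :=
  TestFunction.mkCLM ℝ testToSchwartz
    (fun f g => by ext x; exact Complex.ofReal_add _ _)
    (fun c f => by ext x; exact Complex.ofReal_mul _ _)
    continuous_testToSchwartz_ofSupportedIn

/-- The restriction to `Ω` of the real part of a tempered distribution. -/
def restrictRe (Ω : Opens (Space d)) (F : 𝓢'(Space d, ℂ)) : 𝓓'(Ω, ℝ) where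
  toFun φ := (F (testCLM Ω φ)).re
  map_add' φ ψ := by rw [map_add, map_add, Complex.add_re]
  map_smul' c φ := by
    rw [map_smul]
    have h : (c • testCLM Ω φ : 𝓢(Space d, ℂ)) = (c : ℂ) • testCLM Ω φ := by
      ext x; simp
    rw [h, map_smul, smul_eq_mul, Complex.re_ofReal_mul]
    rfl
  cont := Complex.continuous_re.comp (F.continuous.comp (testCLM Ω).continuous)

/-- An element of `H^r(Ω)` is a bounded functional for the `H^{-r}`-norm of test functions. -/
theorem abs_toDist_le (D : SobolevSpace Ω r) (φ : 𝓓(Ω, ℝ)) :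
    |D.toDist φ| ≤ ‖D‖ * sobNorm (-r) (testToSchwartz φ) := by
  rw [norm_def, mul_comm, ← smul_eq_mul, ← Real.sInf_smul_of_nonneg (sobNorm_nonneg _ _)]
  refine le_csInf ((extensionNorms_nonempty D).smul_set) ?_
  rintro _ ⟨_, ⟨F, f, hf, hF, rfl⟩, rfl⟩
  have h2 := (TemperedDistribution.besselPotential_neg_apply_eq_iff r
    (f : 𝓢'(Space d, ℂ)) F).2 hf
  rw [← Real.norm_eq_abs, ← Complex.norm_real, ← hF φ, ← h2, besselPotential_apply,
    Lp.toTemperedDistribution_apply]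
  exact norm_integral_mul_le_toLp _ _

/-- A linear functional on test functions that is bounded for the `H^{-r}`-norm is an element of
`H^r(Ω)`: by the Hahn-Banach and the Riesz theorem, applied in the real space `L^2`, because the
Bessel potentials of real functions are real. -/
theorem exists_sobolev_of_bound (D : 𝓓(Ω, ℝ) →ₗ[ℝ] ℝ) {M : ℝ} (hM : 0 ≤ M)
    (hD : ∀ φ, |D φ| ≤ M * sobNorm (-r) (testToSchwartz φ)) :
    ∃ w : SobolevSpace Ω r, (∀ φ, w.toDist φ = D φ) ∧ ‖w‖ ≤ M := by
  let v : 𝓓(Ω, ℝ) →ₗ[ℝ] Lp ℝ 2 (volume : Measure (Space d)) :=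
    ((SchwartzMap.toLpCLM ℝ ℝ 2 (volume : Measure (Space d))) ∘L
      (SchwartzMap.postcompCLM (𝕜 := ℝ) Complex.reCLM) ∘L
      ((bessel (d := d) (-r)).restrictScalars ℝ) ∘L (testCLM Ω)).toLinearMap
  have vae : ∀ φ, v φ =ᵐ[volume] fun x => (bessel (-r) (testToSchwartz φ) x).re := fun φ =>
    SchwartzMap.coeFn_toLp (SchwartzMap.postcompCLM (𝕜 := ℝ) Complex.reCLM
      (bessel (-r) (testToSchwartz φ))) 2 volume
  have vre : ∀ (φ : 𝓓(Ω, ℝ)) (x : Space d), (((bessel (-r) (testToSchwartz φ) x).re : ℝ) : ℂ) =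
      bessel (-r) (testToSchwartz φ) x := fun φ x =>
    Complex.ext rfl (bessel_im _ _ (testToSchwartz_im φ) x).symm
  have vnorm : ∀ φ, ‖v φ‖ = sobNorm (-r) (testToSchwartz φ) := by
    intro φ
    rw [sobNorm, SchwartzMap.norm_toLp, Lp.norm_def]
    congr 1
    refine eLpNorm_congr_norm_ae ?_
    filter_upwards [vae φ] with x hx
    rw [hx, ← Complex.norm_real, vre]
  have hker : LinearMap.ker v ≤ LinearMap.ker D := by
    intro φ hφ
    rw [LinearMap.mem_ker] at hφ ⊢
    have h := hD φ
    rw [← vnorm, hφ, norm_zero, mul_zero] at h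
    exact abs_eq_zero.1 (le_antisymm h (abs_nonneg _))
  let ℓ : LinearMap.range v →ₗ[ℝ] ℝ :=
    (LinearMap.ker v).liftQ D hker ∘ₗ v.quotKerEquivRange.symm.toLinearMap
  have hℓ : ∀ φ, ℓ ⟨v φ, LinearMap.mem_range_self v φ⟩ = D φ := by
    intro φ
    have h : v.quotKerEquivRange ((LinearMap.ker v).mkQ φ) = ⟨v φ, LinearMap.mem_range_self v φ⟩ :=
      rfl
    change (LinearMap.ker v).liftQ D hker (v.quotKerEquivRange.symm _) = _
    rw [← h, LinearEquiv.symm_apply_apply]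
    rfl
  obtain ⟨g, hg, hgM⟩ := Module.Dual.exists_continuous_extension_of_le_seminorm
    (LinearMap.range v) ℓ (p := M.toNNReal • normSeminorm ℝ _)
    (continuous_norm.const_smul M.toNNReal) (by
      rintro ⟨_, φ, rfl⟩
      rw [hℓ, Real.norm_eq_abs]
      refine (hD φ).trans (le_of_eq ?_)
      change _ = (M.toNNReal : ℝ) * ‖v φ‖
      rw [Real.coe_toNNReal _ hM, vnorm])
  let f : Lp ℝ 2 (volume : Measure (Space d)) := (InnerProductSpace.toDual ℝ _).symm g
  have hfg : ∀ y, inner ℝ f y = g y := fun y => InnerProductSpace.toDual_symm_apply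
  have hfM : ‖f‖ ≤ M := by
    rw [LinearIsometryEquiv.norm_map]
    refine g.opNorm_le_bound hM fun x => (hgM x).trans (le_of_eq ?_)
    change (M.toNNReal : ℝ) * ‖x‖ = _
    rw [Real.coe_toNNReal _ hM]
  let fC : Lp ℂ 2 (volume : Measure (Space d)) := ((Lp.memLp f).ofReal (K := ℂ)).toLp
  have hfC : fC =ᵐ[volume] fun x => ((f x : ℝ) : ℂ) := MemLp.coeFn_toLp _
  have hfCM : ‖fC‖ = ‖f‖ := by
    rw [Lp.norm_def, Lp.norm_def]
    congr 1
    refine eLpNorm_congr_norm_ae ?_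
    filter_upwards [hfC] with x hx
    rw [hx, Complex.norm_real]
  let F : 𝓢'(Space d, ℂ) := TemperedDistribution.besselPotential (Space d) ℂ (-r) fC
  have hF : ∀ φ : 𝓓(Ω, ℝ), F (testToSchwartz φ) = ((D φ : ℝ) : ℂ) := by
    intro φ
    rw [besselPotential_apply, Lp.toTemperedDistribution_apply, ← hℓ φ, ← hg, ← hfg,
      MeasureTheory.L2.inner_def, ← integral_complex_ofReal]
    refine integral_congr_ae ?_
    filter_upwards [hfC, vae φ] with x hx hx'
    rw [hx, hx', ← vre, smul_eq_mul, ← Complex.ofReal_mul]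
    rfl
  have hfF : TemperedDistribution.besselPotential (Space d) ℂ r F = fC :=
    (TemperedDistribution.besselPotential_neg_apply_eq_iff r _ F).1 rfl
  have hres : RestrictsTo F (restrictRe Ω F) := by
    intro φ
    change F _ = (((F (testToSchwartz φ)).re : ℝ) : ℂ)
    rw [hF, Complex.ofReal_re]
  let w : SobolevSpace Ω r := ⟨restrictRe Ω F, F, ⟨fC, hfF⟩, hres⟩
  refine ⟨w, fun φ => ?_, ?_⟩
  · change (F (testToSchwartz φ)).re = _
    rw [hF, Complex.ofReal_re]
  · rw [norm_def w]
    refine (csInf_le (extensionNorms_bddBelow _) ⟨F, fC, hfF, hres, rfl⟩).trans ?_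
    rw [hfCM]
    exact hfM

theorem sobolev_ext {D D' : SobolevSpace Ω r} (h : ∀ φ, D.toDist φ = D'.toDist φ) : D = D' :=
  toDist_injective (by ext φ; exact h φ)

theorem norm_le_of_bound (D : SobolevSpace Ω r) {M : ℝ} (hM : 0 ≤ M)
    (hD : ∀ φ, |D.toDist φ| ≤ M * sobNorm (-r) (testToSchwartz φ)) : ‖D‖ ≤ M := by
  obtain ⟨w, hw, hwM⟩ := exists_sobolev_of_bound D.toDist.toLinearMap hM hD
  rwa [← sobolev_ext (D := w) (D' := D) hw]

instance : CompleteSpace (SobolevSpace Ω r) := by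
  refine Metric.complete_of_cauchySeq_tendsto fun u hu => ?_
  have hφ : ∀ φ : 𝓓(Ω, ℝ), ∃ y, Tendsto (fun n => (u n).toDist φ) atTop (𝓝 y) := by
    intro φ
    refine cauchySeq_tendsto_of_complete ?_
    rw [Metric.cauchySeq_iff'] at hu ⊢
    intro ε hε
    have hS := sobNorm_nonneg (-r) (testToSchwartz φ)
    obtain ⟨N, hN⟩ := hu (ε / (sobNorm (-r) (testToSchwartz φ) + 1)) (by positivity)
    refine ⟨N, fun n hn => ?_⟩
    have h := abs_toDist_le (u n - u N) φ
    rw [map_sub] at h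
    have h2 := hN n hn
    rw [dist_eq_norm, lt_div_iff₀ (by positivity)] at h2
    calc dist ((u n).toDist φ) ((u N).toDist φ) = |(u n).toDist φ - (u N).toDist φ| :=
          Real.dist_eq _ _
      _ ≤ _ := h
      _ < ε := by nlinarith [norm_nonneg (u n - u N)]
  choose D hD using hφ
  let L : 𝓓(Ω, ℝ) →ₗ[ℝ] ℝ :=
    { toFun := D
      map_add' := fun φ ψ => tendsto_nhds_unique (hD (φ + ψ))
        (((hD φ).add (hD ψ)).congr fun n => (map_add (u n).toDist φ ψ).symm)
      map_smul' := fun c φ => tendsto_nhds_unique (hD (c • φ))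
        (((hD φ).const_smul c).congr fun n => (map_smul (u n).toDist c φ).symm) }
  have key : ∀ ε, 0 < ε → ∃ N, ∀ n ≥ N, ∀ φ,
      |(L - (u n).toDist.toLinearMap) φ| ≤ ε * sobNorm (-r) (testToSchwartz φ) := by
    intro ε hε
    obtain ⟨N, hN⟩ := Metric.cauchySeq_iff.1 hu ε hε
    refine ⟨N, fun n hn φ => ?_⟩
    refine le_of_tendsto (((hD φ).sub_const ((u n).toDist φ)).abs) ?_
    filter_upwards [eventually_ge_atTop N] with m hm
    have h := abs_toDist_le (u m - u n) φ
    rw [map_sub] at h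
    refine h.trans (mul_le_mul_of_nonneg_right ?_ (sobNorm_nonneg _ _))
    rw [← dist_eq_norm]
    exact (hN m hm n hn).le
  obtain ⟨N, hN⟩ := key 1 one_pos
  obtain ⟨w, hw, -⟩ := exists_sobolev_of_bound _ zero_le_one (hN N le_rfl)
  refine ⟨w + u N, ?_⟩
  have hwL : ∀ φ, (w + u N).toDist φ = L φ := by
    intro φ
    rw [map_add]
    change w.toDist φ + (u N).toDist φ = _
    rw [hw]
    exact sub_add_cancel _ _
  rw [Metric.tendsto_atTop]
  intro ε hε
  obtain ⟨N', hN'⟩ := key (ε / 2) (by positivity)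
  refine ⟨N', fun n hn => ?_⟩
  rw [dist_comm, dist_eq_norm]
  refine (norm_le_of_bound _ (by positivity) fun φ => ?_).trans_lt (half_lt_self hε)
  have h := hN' n hn φ
  rw [map_sub]
  change |(w + u N).toDist φ - (u n).toDist φ| ≤ _
  rw [hwL]
  exact h

theorem toDist_eq_integral (D : SobolevSpace Ω r) {F : 𝓢'(Space d, ℂ)}
    {f : Lp ℂ 2 (volume : Measure (Space d))}
    (hf : TemperedDistribution.besselPotential (Space d) ℂ r F = f) (hF : RestrictsTo F D.toDist)
    (φ : 𝓓(Ω, ℝ)) : D.toDist φ = (∫ x, bessel (-r) (testToSchwartz φ) x * f x).re := by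
  have h2 := (TemperedDistribution.besselPotential_neg_apply_eq_iff r
    (f : 𝓢'(Space d, ℂ)) F).2 hf
  rw [← Complex.ofReal_re (D.toDist φ), ← hF φ, ← h2, besselPotential_apply,
    Lp.toTemperedDistribution_apply]
  rfl

/-- The real Schwartz function `Re (1 - Δ)^{r/2} g`. -/
def besselRe (r : ℝ) (g : 𝓢(Space d, ℂ)) : 𝓢(Space d, ℝ) :=
  SchwartzMap.postcompCLM (𝕜 := ℝ) Complex.reCLM (bessel r g)

theorem toDist_restrictSchwartz_besselRe (g : 𝓢(Space d, ℂ)) (φ : 𝓓(Ω, ℝ)) :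
    (restrictSchwartz Ω s (besselRe (-r) g)).toDist φ =
      (∫ x, bessel (-r) (testToSchwartz φ) x * (g.toLp 2 volume : Lp ℂ 2 _) x).re := by
  have e : ∫ x, bessel (-r) (testToSchwartz φ) x * (g.toLp 2 volume : Lp ℂ 2 _) x =
      ∫ x, testToSchwartz φ x * bessel (-r) g x := by
    rw [← integral_bessel_mul]
    refine integral_congr_ae ?_
    filter_upwards [g.coeFn_toLp 2 volume] with x hx
    rw [hx]
  have e2 : Integrable fun x => testToSchwartz φ x * bessel (-r) g x :=
    (SchwartzMap.pairing (ContinuousLinearMap.mul ℂ ℂ) (testToSchwartz φ)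
      (bessel (-r) g)).integrable
  refine (schwartzDist_apply _ φ).trans ?_
  rw [e]
  refine Eq.trans ?_ (integral_re (𝕜 := ℂ) e2)
  refine integral_congr_ae (Eventually.of_forall fun x => ?_)
  change φ x * (bessel (-r) g x).re = (((φ x : ℝ) : ℂ) * bessel (-r) g x).re
  rw [Complex.re_ofReal_mul]

theorem integrable_schwartz_mul (u : 𝓢(Space d, ℂ)) (h : Lp ℂ 2 (volume : Measure (Space d))) :
    Integrable fun x => u x * h x :=
  memLp_one_iff_integrable.1 ((Lp.memLp h).mul' (u.memLp 2 volume))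

theorem integral_schwartz_mul_sub (u : 𝓢(Space d, ℂ))
    (f g : Lp ℂ 2 (volume : Measure (Space d))) :
    ∫ x, u x * (f - g : Lp ℂ 2 (volume : Measure (Space d))) x =
      (∫ x, u x * f x) - ∫ x, u x * g x := by
  rw [← integral_sub (integrable_schwartz_mul u f) (integrable_schwartz_mul u g)]
  refine integral_congr_ae ?_
  filter_upwards [Lp.coeFn_sub f g] with x hx
  rw [hx, Pi.sub_apply, mul_sub]

/-- The restrictions of Schwartz functions are dense in `H^s(Ω)`. -/
theorem denseRange_restrictSchwartz : DenseRange (restrictSchwartz Ω s) := by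
  rw [Metric.denseRange_iff]
  intro D ε hε
  obtain ⟨_, F, f, hf, hF, -⟩ := extensionNorms_nonempty D
  obtain ⟨g, hg⟩ := Metric.denseRange_iff.1 (SchwartzMap.denseRange_toLpCLM (F := ℂ)
    (μ := (volume : Measure (Space d))) (p := 2) (by norm_num)) f ε hε
  rw [SchwartzMap.toLpCLM_apply, dist_eq_norm] at hg
  refine ⟨besselRe (-s) g, ?_⟩
  rw [dist_eq_norm]
  refine (norm_le_of_bound _ (norm_nonneg _) fun φ => ?_).trans_lt hg
  have h3 : (D - restrictSchwartz Ω s (besselRe (-s) g)).toDist φ =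
      (∫ x, bessel (-s) (testToSchwartz φ) x * (f - g.toLp 2 volume : Lp ℂ 2 _) x).re := by
    rw [integral_schwartz_mul_sub, Complex.sub_re, ← toDist_restrictSchwartz_besselRe,
      ← toDist_eq_integral D hf hF, map_sub]
    rfl
  rw [h3, mul_comm]
  exact (Complex.abs_re_le_norm _).trans (norm_integral_mul_le_toLp _ _)

end Dual

/-! ### Multiplication by elements of `H^s(Ω)` -/

section Product

variable {d : ℕ} {Ω : Opens (Space d)} {r s : ℝ}

/-- The orders for which `H^r(Ω)` is a module over `H^s(Ω)`: `|r| ≤ s` and `s > d/2`. -/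
class Admissible (d : ℕ) (r s : ℝ) : Prop where
  abs_le : |r| ≤ s
  lt : (d : ℝ) / 2 < s

instance Admissible.self [h : Admissible d (s - 1) s] : Admissible d s s where
  abs_le := (abs_of_nonneg ((by positivity : (0 : ℝ) ≤ (d : ℝ) / 2).trans h.lt.le)).le
  lt := h.lt

theorem mulTest_apply (G : 𝓢(Space d, ℝ)) (φ : 𝓓(Ω, ℝ)) (x : Space d) :
    mulTest G φ x = G x * φ x := rfl

theorem mulTest_add_left (G G' : 𝓢(Space d, ℝ)) (φ : 𝓓(Ω, ℝ)) :
    mulTest (G + G') φ = mulTest G φ + mulTest G' φ := by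
  ext x; exact add_mul _ _ _

theorem mulTest_smul_left (c : ℝ) (G : 𝓢(Space d, ℝ)) (φ : 𝓓(Ω, ℝ)) :
    mulTest (c • G) φ = c • mulTest G φ := by
  ext x; exact mul_assoc _ _ _

theorem mulTest_add_right (G : 𝓢(Space d, ℝ)) (φ φ' : 𝓓(Ω, ℝ)) :
    mulTest G (φ + φ') = mulTest G φ + mulTest G φ' := by
  ext x; exact mul_add _ _ _

theorem mulTest_smul_right (c : ℝ) (G : 𝓢(Space d, ℝ)) (φ : 𝓓(Ω, ℝ)) :
    mulTest G (c • φ) = c • mulTest G φ := by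
  ext x; exact mul_left_comm _ _ _

theorem toDist_restrictSchwartz (G : 𝓢(Space d, ℝ)) (φ : 𝓓(Ω, ℝ)) :
    (restrictSchwartz Ω s G).toDist φ = ∫ x, φ x * G x := schwartzDist_apply G φ

/-- Multiplication by a Schwartz function is bounded on the dual side: with `u = G φ` and
`ψ = (1 - Δ)^{-r} u`, one has `‖u‖²_{H^{-r}} = ∫ G φ ψ`, and the `H^{-s}`-norm of `φ ψ` is
controlled by the norms of `φ` in `H^{-r}` and of `ψ` in `H^r`. -/
theorem exists_sobNorm_mulTest_le (d : ℕ) (r s : ℝ) [h : Admissible d r s] :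
    ∃ C, 0 ≤ C ∧ ∀ (Ω : Opens (Space d)) (G : 𝓢(Space d, ℝ)) (φ : 𝓓(Ω, ℝ)),
      sobNorm (-r) (testToSchwartz (mulTest G φ)) ≤
        C * ‖restrictSchwartz Ω s G‖ * sobNorm (-r) (testToSchwartz φ) := by
  obtain ⟨C, hC, hmul⟩ := exists_sobNorm_mul_le (d := d) h.abs_le h.lt
  refine ⟨C, hC, fun Ω G φ => ?_⟩
  set u := testToSchwartz (mulTest G φ) with hu
  set X := sobNorm (-r) u with hX
  have hXnn : 0 ≤ X := sobNorm_nonneg _ _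
  have h1 := integral_mul_bessel_self (-r) u (testToSchwartz_im _)
  set ψ := bessel (2 * -r) u with hψ
  have hψim : ∀ x, (ψ x).im = 0 := bessel_im _ _ (testToSchwartz_im _)
  let ψR : 𝓢(Space d, ℝ) := SchwartzMap.postcompCLM (𝕜 := ℝ) Complex.reCLM ψ
  have hψR : ∀ x, ((ψR x : ℝ) : ℂ) = ψ x := fun x => Complex.ext rfl (hψim x).symm
  have h2 : (restrictSchwartz Ω s G).toDist (mulTest ψR φ) = X ^ 2 := by
    rw [toDist_restrictSchwartz]
    apply Complex.ofReal_injective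
    rw [← h1, ← integral_complex_ofReal]
    refine integral_congr_ae (Eventually.of_forall fun x => ?_)
    change ((ψR x * φ x * G x : ℝ) : ℂ) = ((G x * φ x : ℝ) : ℂ) * ψ x
    rw [← hψR]
    push_cast
    ring
  have h3 := abs_toDist_le (restrictSchwartz Ω s G) (mulTest ψR φ)
  have h4 : sobNorm (-s) (testToSchwartz (mulTest ψR φ)) ≤
      C * (sobNorm (-r) (testToSchwartz φ) * sobNorm r ψ) := by
    refine hmul _ _ _ fun x => ?_
    change ((ψR x * φ x : ℝ) : ℂ) = ((φ x : ℝ) : ℂ) * ψ x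
    rw [← hψR]
    push_cast
    ring
  have h5 : sobNorm r ψ = X := by
    rw [hψ, sobNorm_bessel, hX]
    congr 1
    ring
  rw [h2, abs_of_nonneg (by positivity)] at h3
  rw [h5] at h4
  have h6 : X * X ≤ C * ‖restrictSchwartz Ω s G‖ * sobNorm (-r) (testToSchwartz φ) * X := by
    calc X * X = X ^ 2 := by ring
      _ ≤ ‖restrictSchwartz Ω s G‖ * (C * (sobNorm (-r) (testToSchwartz φ) * X)) :=
          h3.trans (by gcongr)
      _ = _ := by ring
  rcases hXnn.eq_or_lt with h0 | h0
  · rw [← h0]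
    have := sobNorm_nonneg (-r) (testToSchwartz φ)
    positivity
  · exact le_of_mul_le_mul_right h6 h0

variable (Ω s) in
/-- `restrictSchwartz` as a linear map. -/
def restrictSchwartzₗ : 𝓢(Space d, ℝ) →ₗ[ℝ] SobolevSpace Ω s where
  toFun := restrictSchwartz Ω s
  map_add' G G' := sobolev_ext fun φ => by
    rw [map_add]
    refine (toDist_restrictSchwartz _ _).trans ?_
    change _ = (restrictSchwartz Ω s G).toDist φ + (restrictSchwartz Ω s G').toDist φ
    rw [toDist_restrictSchwartz, toDist_restrictSchwartz, ← integral_add]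
    · exact integral_congr_ae (Eventually.of_forall fun x => mul_add _ _ _)
    · exact (φ.continuous.mul G.continuous).integrable_of_hasCompactSupport
        φ.hasCompactSupport.mul_right
    · exact (φ.continuous.mul G'.continuous).integrable_of_hasCompactSupport
        φ.hasCompactSupport.mul_right
  map_smul' c G := sobolev_ext fun φ => by
    rw [map_smul]
    refine (toDist_restrictSchwartz _ _).trans ?_
    change _ = c * (restrictSchwartz Ω s G).toDist φ
    rw [toDist_restrictSchwartz, ← integral_const_mul]
    exact integral_congr_ae (Eventually.of_forall fun x => mul_left_comm _ _ _)

/-- The product of the distribution `D` and the Schwartz function `G`. -/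
def distMul (D : 𝓓'(Ω, ℝ)) (G : 𝓢(Space d, ℝ)) : 𝓓(Ω, ℝ) →ₗ[ℝ] ℝ where
  toFun φ := D (mulTest G φ)
  map_add' φ ψ := by rw [mulTest_add_right, map_add]
  map_smul' c φ := by rw [mulTest_smul_right, map_smul]; rfl

theorem exists_schwartzMul (Ω : Opens (Space d)) (r s : ℝ) [Admissible d r s] :
    ∃ C, 0 ≤ C ∧ ∀ (f : SobolevSpace Ω r) (G : 𝓢(Space d, ℝ)), ∃ w : SobolevSpace Ω r,
      (∀ φ, w.toDist φ = f.toDist (mulTest G φ)) ∧ ‖w‖ ≤ C * ‖restrictSchwartz Ω s G‖ * ‖f‖ := by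
  obtain ⟨C, hC, h⟩ := exists_sobNorm_mulTest_le d r s
  refine ⟨C, hC, fun f G => ?_⟩
  refine exists_sobolev_of_bound (distMul f.toDist G) (by positivity) fun φ => ?_
  refine (abs_toDist_le f (mulTest G φ)).trans ?_
  calc ‖f‖ * sobNorm (-r) (testToSchwartz (mulTest G φ))
      ≤ ‖f‖ * (C * ‖restrictSchwartz Ω s G‖ * sobNorm (-r) (testToSchwartz φ)) := by
        gcongr; exact h Ω G φ
    _ = _ := by ring

theorem comap_restrictSchwartz_neBot (g : SobolevSpace Ω s) :
    (comap (restrictSchwartz Ω s) (𝓝 g)).NeBot :=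
  comap_neBot_iff_frequently.2 ((mem_closure_iff_frequently.1 (denseRange_restrictSchwartz g)))

/-- Evaluation of a distribution in `H^r(Ω)` at a test function. -/
def pairCLM (r : ℝ) (φ : 𝓓(Ω, ℝ)) : SobolevSpace Ω r →L[ℝ] ℝ :=
  LinearMap.mkContinuous
    { toFun := fun v : SobolevSpace Ω r => v.toDist φ
      map_add' := fun v v' => by rw [map_add]; rfl
      map_smul' := fun c v => by rw [map_smul]; rfl } (sobNorm (-r) (testToSchwartz φ))
    (fun v => by rw [mul_comm]; exact abs_toDist_le v φ)

theorem pairCLM_apply (φ : 𝓓(Ω, ℝ)) (v : SobolevSpace Ω r) : pairCLM r φ v = v.toDist φ := rfl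

/-- The multiplication exists as a continuous bilinear map. -/
theorem exists_mulCLM (Ω : Opens (Space d)) (r s : ℝ) [Admissible d r s] :
    ∃ m : SobolevSpace Ω s →L[ℝ] SobolevSpace Ω r →L[ℝ] SobolevSpace Ω r,
      (∀ f G φ, (m (restrictSchwartz Ω s G) f).toDist φ = f.toDist (mulTest G φ)) ∧
      ∀ f g, IsProduct f.toDist g (m g f).toDist := by
  obtain ⟨C, hC, h⟩ := exists_schwartzMul Ω r s
  choose w hw hwn using h
  let T₁ (G : 𝓢(Space d, ℝ)) : SobolevSpace Ω r →L[ℝ] SobolevSpace Ω r :=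
    LinearMap.mkContinuous
      { toFun := fun f => w f G
        map_add' := fun f f' => sobolev_ext fun φ => by
          rw [map_add, hw]
          change f.toDist _ + f'.toDist _ = _
          rw [← hw, ← hw]; rfl
        map_smul' := fun c f => sobolev_ext fun φ => by
          rw [map_smul, hw]
          change c • f.toDist _ = _
          rw [← hw]; rfl }
      (C * ‖restrictSchwartz Ω s G‖) (fun f => hwn f G)
  let T : 𝓢(Space d, ℝ) →ₗ[ℝ] SobolevSpace Ω r →L[ℝ] SobolevSpace Ω r :=
    { toFun := T₁
      map_add' := fun G G' => by
        ext1 f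
        refine sobolev_ext fun φ => ?_
        change (w f (G + G')).toDist φ = (w f G + w f G').toDist φ
        rw [map_add, hw, mulTest_add_left, map_add, ← hw, ← hw]; rfl
      map_smul' := fun c G => by
        ext1 f
        refine sobolev_ext fun φ => ?_
        change (w f (c • G)).toDist φ = (c • w f G).toDist φ
        rw [map_smul, hw, mulTest_smul_left, map_smul, ← hw]; rfl }
  have hT : ∃ C, ∀ G, ‖T G‖ ≤ C * ‖restrictSchwartzₗ Ω s G‖ :=
    ⟨C, fun G => LinearMap.mkContinuous_norm_le _ (by positivity) fun f => hwn f G⟩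
  let m := T.extendOfNorm (restrictSchwartzₗ Ω s)
  have hm : ∀ G, m (restrictSchwartz Ω s G) = T G := fun G =>
    LinearMap.extendOfNorm_eq denseRange_restrictSchwartz hT G
  have hm2 : ∀ f G φ, (m (restrictSchwartz Ω s G) f).toDist φ = f.toDist (mulTest G φ) := by
    intro f G φ
    rw [hm]
    exact hw f G φ
  refine ⟨m, hm2, fun f g φ => ?_⟩
  have h1 : Continuous fun g' => (m g' f).toDist φ :=
    (pairCLM r φ).continuous.comp (by fun_prop)
  exact ((h1.tendsto g).comp tendsto_comap).congr fun G => hm2 f G φ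

/-- The multiplication `g ↦ f ↦ f g` as a continuous bilinear map. -/
def mulCLM (Ω : Opens (Space d)) (r s : ℝ) [Admissible d r s] :
    SobolevSpace Ω s →L[ℝ] SobolevSpace Ω r →L[ℝ] SobolevSpace Ω r :=
  (exists_mulCLM Ω r s).choose

variable [Admissible d r s]

theorem mulCLM_restrictSchwartz (f : SobolevSpace Ω r) (G : 𝓢(Space d, ℝ)) (φ : 𝓓(Ω, ℝ)) :
    (mulCLM Ω r s (restrictSchwartz Ω s G) f).toDist φ = f.toDist (mulTest G φ) :=
  (exists_mulCLM Ω r s).choose_spec.1 f G φ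

theorem isProduct_mulCLM (f : SobolevSpace Ω r) (g : SobolevSpace Ω s) :
    IsProduct f.toDist g (mulCLM Ω r s g f).toDist :=
  (exists_mulCLM Ω r s).choose_spec.2 f g

theorem sobolevMul_eq (f : SobolevSpace Ω r) (g : SobolevSpace Ω s) :
    sobolevMul f g = mulCLM Ω r s g f := by
  have h : ∃ w : SobolevSpace Ω r, IsProduct f.toDist g w.toDist := ⟨_, isProduct_mulCLM f g⟩
  have := comap_restrictSchwartz_neBot g
  rw [sobolevMul, dif_pos h]
  exact sobolev_ext fun φ => tendsto_nhds_unique (h.choose_spec φ) (isProduct_mulCLM f g φ)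

/-- The product depends on its first factor only through the underlying distribution, not on the
Sobolev space in which that factor is regarded. -/
theorem mulCLM_congr {r' : ℝ} [Admissible d r' s] {f : SobolevSpace Ω r} {f' : SobolevSpace Ω r'}
    (h : f.toDist = f'.toDist) (g : SobolevSpace Ω s) :
    (mulCLM Ω r s g f).toDist = (mulCLM Ω r' s g f').toDist := by
  have := comap_restrictSchwartz_neBot g
  ext φ
  have h1 := isProduct_mulCLM f g φ
  rw [h] at h1
  exact tendsto_nhds_unique h1 (isProduct_mulCLM f' g φ)

end Product

/-! ### Pointwise values of elements of `H^s(Ω)` for `s > d/2` -/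

section Embedding

variable {d : ℕ} {Ω : Opens (Space d)} {r s : ℝ}

theorem exists_sobNorm_le_integral {s : ℝ} (hs : (d : ℝ) / 2 < s) :
    ∃ C, 0 ≤ C ∧ ∀ u : 𝓢(Space d, ℂ), sobNorm (-s) u ≤ C * ∫ x, ‖u x‖ := by
  set B := ∫⁻ ξ : Space d, ‖weight (-s) ξ‖ₑ ^ 2 with hB
  have hBt : B ≠ ⊤ := (lintegral_weight_sq_lt_top hs).ne
  refine ⟨Real.sqrt B.toReal, Real.sqrt_nonneg _, fun u => ?_⟩
  set I := ∫ x, ‖u x‖ with hI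
  have hI0 : 0 ≤ I := integral_nonneg fun _ => norm_nonneg _
  have h1 : ∀ ξ, ‖𝓕⁻ u ξ‖ₑ ≤ ENNReal.ofReal I := by
    intro ξ
    rw [← ofReal_norm]
    apply ENNReal.ofReal_le_ofReal
    rw [SchwartzMap.fourierInv_coe, Real.fourierInv_eq_fourier_neg]
    exact VectorFourier.norm_fourierIntegral_le_integral_norm _ _ _ _ _
  have h2 : ENNReal.ofReal (sobNorm (-s) u) ^ 2 ≤ B * ENNReal.ofReal I ^ 2 := by
    rw [sobNorm_sq, hB, ← lintegral_mul_const' _ _ (by simp)]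
    refine lintegral_mono fun ξ => ?_
    rw [mul_pow]
    gcongr
    exact h1 ξ
  rw [← ENNReal.ofReal_toReal hBt, ← ENNReal.ofReal_pow (sobNorm_nonneg _ _),
    ← ENNReal.ofReal_pow hI0, ← ENNReal.ofReal_mul ENNReal.toReal_nonneg,
    ENNReal.ofReal_le_ofReal_iff (by positivity)] at h2
  refine abs_le_of_sq_le_sq' (h2.trans (le_of_eq ?_)) (by positivity) |>.2
  rw [mul_pow, Real.sq_sqrt ENNReal.toReal_nonneg]

/-- The Sobolev inequality for the quotient norm, by duality: `∫ φ G ≤ C ‖G‖ ∫ |φ|` for all test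
functions `φ` on `Ω`, and these concentrate at a given point of `Ω`. -/
theorem exists_abs_le_restrictSchwartz {s : ℝ} (hs : (d : ℝ) / 2 < s) :
    ∃ C, 0 ≤ C ∧ ∀ (Ω : Opens (Space d)) (G : 𝓢(Space d, ℝ)), ∀ x ∈ Ω,
      |G x| ≤ C * ‖restrictSchwartz Ω s G‖ := by
  obtain ⟨C, hC, h⟩ := exists_sobNorm_le_integral hs
  refine ⟨C, hC, fun Ω G x hx => ?_⟩
  refine le_of_forall_pos_le_add fun ε hε => ?_
  obtain ⟨δ, hδ, hball⟩ := Metric.isOpen_iff.1 Ω.isOpen x hx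
  obtain ⟨δ', hδ', hG⟩ := Metric.continuousAt_iff.1 G.continuous.continuousAt ε hε
  set ρ := min δ δ' / 2 with hρ
  have hρ0 : 0 < ρ := by positivity
  have hρδ : ρ < δ := by have := min_le_left δ δ'; linarith
  have hρδ' : ρ < δ' := by have := min_le_right δ δ'; linarith
  let b : ContDiffBump x := ⟨ρ / 2, ρ, by positivity, by linarith⟩
  let φ : 𝓓(Ω, ℝ) := ⟨b.normed volume, b.contDiff_normed, b.hasCompactSupport_normed, by
    rw [b.tsupport_normed_eq]
    exact (Metric.closedBall_subset_ball hρδ).trans hball⟩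
  have h0 : ∀ y, 0 ≤ φ y := fun y => b.nonneg_normed y
  have h1 : ∫ y, φ y = 1 := b.integral_normed
  have hint : Integrable fun y => φ y := b.integrable_normed
  have hintG : Integrable fun y => φ y * G y :=
    (φ.continuous.mul G.continuous).integrable_of_hasCompactSupport
      φ.hasCompactSupport.mul_right
  have h2 : |(restrictSchwartz Ω s G).toDist φ| ≤ C * ‖restrictSchwartz Ω s G‖ := by
    refine (abs_toDist_le _ φ).trans ?_
    have h3 := h (testToSchwartz φ)
    have h4 : ∫ y, ‖testToSchwartz φ y‖ = 1 := by
      rw [← h1]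
      refine integral_congr_ae (Eventually.of_forall fun y => ?_)
      change ‖((φ y : ℝ) : ℂ)‖ = φ y
      rw [Complex.norm_real, Real.norm_of_nonneg (h0 y)]
    rw [h4, mul_one] at h3
    rw [mul_comm]
    gcongr
  have h5 : |(restrictSchwartz Ω s G).toDist φ - G x| ≤ ε := by
    have h6 : (restrictSchwartz Ω s G).toDist φ - G x = ∫ y, φ y * (G y - G x) := by
      rw [toDist_restrictSchwartz]
      calc (∫ y, φ y * G y) - G x = (∫ y, φ y * G y) - ∫ y, φ y * G x := by
            rw [integral_mul_const, h1, one_mul]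
        _ = ∫ y, φ y * (G y - G x) := by
            rw [← integral_sub hintG (hint.mul_const _)]
            exact integral_congr_ae (Eventually.of_forall fun y => (mul_sub _ _ _).symm)
    rw [h6, ← Real.norm_eq_abs]
    calc ‖∫ y, φ y * (G y - G x)‖ ≤ ∫ y, φ y * ε := by
          refine norm_integral_le_of_norm_le (hint.mul_const _) (Eventually.of_forall fun y => ?_)
          rw [norm_mul, Real.norm_of_nonneg (h0 y)]
          by_cases hy : y ∈ Metric.ball x ρ
          · gcongr
            · exact h0 y
            · rw [← dist_eq_norm]
              exact (hG ((Metric.mem_ball.1 hy).trans hρδ')).le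
          · have : φ y = 0 := by
              rw [← Function.notMem_support]
              intro h
              have : y ∈ Function.support (b.normed volume) := h
              rw [b.support_normed_eq] at this
              exact hy this
            rw [this, zero_mul, zero_mul]
      _ = ε := by rw [integral_mul_const, h1, one_mul]
  have := abs_sub_abs_le_abs_sub (G x) ((restrictSchwartz Ω s G).toDist φ)
  rw [abs_sub_comm] at this
  linarith

/-- The value at a point `x ∈ Ω` of elements of `H^s(Ω)`, `s > d/2`, the extension by continuity
of the evaluation of Schwartz functions (junk if `x ∉ Ω`). -/
def ev (s : ℝ) (x : Space d) : SobolevSpace Ω s →L[ℝ] ℝ :=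
  LinearMap.extendOfNorm
    ({ toFun := fun G => G x, map_add' := fun _ _ => rfl, map_smul' := fun _ _ => rfl } :
      𝓢(Space d, ℝ) →ₗ[ℝ] ℝ) (restrictSchwartzₗ Ω s)

variable [hs : Admissible d s s]

theorem ev_restrictSchwartz (G : 𝓢(Space d, ℝ)) {x : Space d} (hx : x ∈ Ω) :
    ev s x (restrictSchwartz Ω s G) = G x := by
  obtain ⟨C, -, h⟩ := exists_abs_le_restrictSchwartz hs.lt
  exact LinearMap.extendOfNorm_eq denseRange_restrictSchwartz ⟨C, fun G => h Ω G x hx⟩ G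

variable (Ω s) in
theorem exists_abs_ev_le : ∃ C, 0 ≤ C ∧ ∀ (w : SobolevSpace Ω s), ∀ x ∈ Ω,
    |ev s x w| ≤ C * ‖w‖ := by
  obtain ⟨C, hC, h⟩ := exists_abs_le_restrictSchwartz hs.lt
  refine ⟨C, hC, fun w x hx => ?_⟩
  rw [← Real.norm_eq_abs, ev]
  exact LinearMap.norm_extendOfNorm_apply_le denseRange_restrictSchwartz C
    (fun G => h Ω G x hx) w

theorem continuousOn_ev (w : SobolevSpace Ω s) : ContinuousOn (fun x => ev s x w) Ω := by
  obtain ⟨C, hC, h⟩ := exists_abs_ev_le Ω s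
  have h1 : TendstoUniformlyOn (fun (w' : SobolevSpace Ω s) x => ev s x w') (fun x => ev s x w)
      (𝓝 w) Ω := by
    rw [Metric.tendstoUniformlyOn_iff]
    intro ε hε
    filter_upwards [Metric.ball_mem_nhds w (show 0 < ε / (C + 1) by positivity)] with w' hw' x hx
    rw [Real.dist_eq, ← map_sub]
    rw [Metric.mem_ball, dist_comm, dist_eq_norm, lt_div_iff₀ (by positivity)] at hw'
    have := h (w - w') x hx
    nlinarith [norm_nonneg (w - w')]
  refine h1.continuousOn ?_
  rw [frequently_iff]
  intro U hU
  obtain ⟨G, hG⟩ := denseRange_restrictSchwartz.exists_mem_open isOpen_interior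
    ⟨w, mem_interior_iff_mem_nhds.2 hU⟩
  refine ⟨_, interior_subset hG, G.continuous.continuousOn.congr fun x hx => ?_⟩
  exact ev_restrictSchwartz G hx

/-- Integration of elements of `H^s(Ω)` against an integrable function. -/
theorem exists_integral_ev (s : ℝ) [hs : Admissible d s s] {h : Space d → ℝ}
    (hh : IntegrableOn h (Ω : Set (Space d))) :
    ∃ L : SobolevSpace Ω s →L[ℝ] ℝ, ∀ w, L w = ∫ x in (Ω : Set (Space d)), ev s x w * h x := by
  obtain ⟨C, hC, hb⟩ := exists_abs_ev_le Ω s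
  have hint : ∀ w : SobolevSpace Ω s, IntegrableOn (fun x => ev s x w * h x)
      (Ω : Set (Space d)) := by
    intro w
    refine Integrable.bdd_mul (c := C * ‖w‖) hh
      ((continuousOn_ev w).aestronglyMeasurable Ω.isOpen.measurableSet) ?_
    filter_upwards [ae_restrict_mem Ω.isOpen.measurableSet] with x hx
    exact hb w x hx
  let L : SobolevSpace Ω s →ₗ[ℝ] ℝ :=
    { toFun := fun w => ∫ x in (Ω : Set (Space d)), ev s x w * h x
      map_add' := fun w w' => by
        rw [← integral_add (hint w) (hint w')]
        refine integral_congr_ae (Eventually.of_forall fun x => ?_)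
        change ev s x (w + w') * h x = _
        rw [map_add, add_mul]
      map_smul' := fun c w => by
        rw [RingHom.id_apply, smul_eq_mul, ← integral_const_mul]
        refine integral_congr_ae (Eventually.of_forall fun x => ?_)
        change ev s x (c • w) * h x = _
        rw [map_smul, smul_eq_mul, mul_assoc] }
  refine ⟨L.mkContinuous (C * ∫ x in (Ω : Set (Space d)), ‖h x‖) fun w => ?_, fun w => rfl⟩
  calc ‖∫ x in (Ω : Set (Space d)), ev s x w * h x‖
      ≤ ∫ x in (Ω : Set (Space d)), (C * ‖w‖) * ‖h x‖ := by
        refine norm_integral_le_of_norm_le (hh.norm.const_mul _) ?_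
        filter_upwards [ae_restrict_mem Ω.isOpen.measurableSet] with x hx
        rw [norm_mul]
        gcongr
        exact hb w x hx
    _ = _ := by rw [integral_const_mul]; ring

omit hs in
theorem integrable_mul_test {F : Space d → ℝ}
    (hF : LocallyIntegrableOn F (Ω : Set (Space d)) volume) (φ : 𝓓(Ω, ℝ)) :
    Integrable fun x => F x * φ x := by
  have h1 : IntegrableOn F (tsupport φ) :=
    hF.integrableOn_compact_subset φ.tsupport_subset φ.hasCompactSupport
  have h2 : IntegrableOn (fun x => F x * φ x) (tsupport φ) :=
    h1.mul_continuousOn φ.continuous.continuousOn φ.hasCompactSupport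
  rwa [integrableOn_iff_integrable_of_support_subset] at h2
  exact (Function.support_mul_subset_right _ _).trans (subset_tsupport φ)

omit hs in
theorem test_eq_zero (φ : 𝓓(Ω, ℝ)) {x : Space d} (hx : x ∉ Ω) : φ x = 0 :=
  image_eq_zero_of_notMem_tsupport fun h => hx (φ.tsupport_subset h)

/-- If `f` is a function, then the product `f g` is the pointwise product. -/
theorem represents_mulCLM [Admissible d r s] {f : SobolevSpace Ω r} {F : Space d → ℝ}
    (hF : Represents f.toDist F) (g : SobolevSpace Ω s) :
    Represents (mulCLM Ω r s g f).toDist fun x => ev s x g * F x := by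
  refine ⟨?_, fun φ => ?_⟩
  · have := hF.1.continuousOn_smul Ω.isOpen.isLocallyClosed (continuousOn_ev g)
    exact this
  · have hi := integrable_mul_test hF.1 φ
    obtain ⟨L, hL⟩ := exists_integral_ev s hi.integrableOn
    have hL' : ∀ w, L w = ∫ x, ev s x w * F x * φ x := by
      intro w
      rw [hL, setIntegral_eq_integral_of_forall_compl_eq_zero]
      · simp_rw [mul_assoc]
      · intro x hx
        rw [test_eq_zero φ hx, mul_zero, mul_zero]
    rw [← hL', ← pairCLM_apply]
    have hd : DenseRange (restrictSchwartz Ω s) := denseRange_restrictSchwartz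
    refine hd.induction_on (p := fun g => pairCLM r φ (mulCLM Ω r s g f) = L g) g
      (isClosed_eq (by fun_prop) (by fun_prop)) fun G => ?_
    rw [pairCLM_apply, mulCLM_restrictSchwartz, hF.2, hL']
    refine integral_congr_ae (Eventually.of_forall fun x => ?_)
    change F x * (G x * φ x) = ev s x (restrictSchwartz Ω s G) * F x * φ x
    by_cases hx : x ∈ Ω
    · rw [ev_restrictSchwartz G hx]; ring
    · rw [test_eq_zero φ hx, mul_zero, mul_zero, mul_zero]

/-- Elements of `H^s(Ω)` are continuous functions on `Ω`. -/
theorem represents_ev (w : SobolevSpace Ω s) : Represents w.toDist fun x => ev s x w := by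
  refine ⟨(continuousOn_ev w).locallyIntegrableOn Ω.isOpen.measurableSet, fun φ => ?_⟩
  have hi : Integrable fun x => φ x :=
    φ.continuous.integrable_of_hasCompactSupport φ.hasCompactSupport
  obtain ⟨L, hL⟩ := exists_integral_ev s hi.integrableOn
  have hL' : ∀ w, L w = ∫ x, ev s x w * φ x := by
    intro w
    rw [hL, setIntegral_eq_integral_of_forall_compl_eq_zero]
    intro x hx
    rw [test_eq_zero φ hx, mul_zero]
  rw [← hL', ← pairCLM_apply]
  have hd : DenseRange (restrictSchwartz Ω s) := denseRange_restrictSchwartz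
  refine hd.induction_on (p := fun w => pairCLM s φ w = L w) w
    (isClosed_eq (by fun_prop) (by fun_prop)) fun G => ?_
  rw [pairCLM_apply, toDist_restrictSchwartz, hL']
  refine integral_congr_ae (Eventually.of_forall fun x => ?_)
  change φ x * G x = ev s x (restrictSchwartz Ω s G) * φ x
  by_cases hx : x ∈ Ω
  · rw [ev_restrictSchwartz G hx]; ring
  · rw [test_eq_zero φ hx, mul_zero, zero_mul]

omit hs in
theorem Represents.ae_eq {D : 𝓓'(Ω, ℝ)} {F F' : Space d → ℝ} (h : Represents D F)
    (h' : Represents D F') : F =ᵐ[volume.restrict (Ω : Set (Space d))] F' := by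
  rw [EventuallyEq, ae_restrict_iff' Ω.isOpen.measurableSet]
  have := Ω.isOpen.ae_eq_zero_of_integral_contDiff_smul_eq_zero (h.1.sub h'.1)
    fun g hg hg2 hg3 => by
      let φ : 𝓓(Ω, ℝ) := ⟨g, hg, hg2, hg3⟩
      calc ∫ x, g x • (F - F') x = ∫ x, (F x * φ x - F' x * φ x) :=
            integral_congr_ae (Eventually.of_forall fun x => by
              change g x * (F x - F' x) = F x * g x - F' x * g x
              ring)
        _ = 0 := by
            rw [integral_sub (integrable_mul_test h.1 φ) (integrable_mul_test h'.1 φ), ← h.2,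
              ← h'.2, sub_self]
  filter_upwards [this] with x hx hxΩ
  exact sub_eq_zero.1 (hx hxΩ)

omit hs in
theorem Represents.congr {D : 𝓓'(Ω, ℝ)} {F F' : Space d → ℝ} (h : Represents D F)
    (h' : F =ᵐ[volume.restrict (Ω : Set (Space d))] F') : Represents D F' := by
  refine ⟨h.1.congr h', fun φ => ?_⟩
  rw [h.2]
  refine integral_congr_ae ?_
  rw [EventuallyEq, ae_restrict_iff' Ω.isOpen.measurableSet] at h'
  filter_upwards [h'] with x hx
  by_cases hxΩ : x ∈ Ω
  · rw [hx hxΩ]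
  · rw [test_eq_zero φ hxΩ, mul_zero, mul_zero]

omit hs in
theorem Represents.add {D D' : 𝓓'(Ω, ℝ)} {F F' : Space d → ℝ} (h : Represents D F)
    (h' : Represents D' F') : Represents (D + D') fun x => F x + F' x := by
  refine ⟨h.1.add h'.1, fun φ => ?_⟩
  change D φ + D' φ = _
  rw [h.2, h'.2, ← integral_add (integrable_mul_test h.1 φ) (integrable_mul_test h'.1 φ)]
  simp_rw [add_mul]

omit hs in
theorem represents_zero : Represents (0 : 𝓓'(Ω, ℝ)) fun _ => 0 :=
  ⟨locallyIntegrableOn_zero, fun φ => by simp⟩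

omit hs in
theorem represents_sum {ι : Type*} (S : Finset ι) {D : ι → SobolevSpace Ω r}
    {F : ι → Space d → ℝ} (h : ∀ i ∈ S, Represents (D i).toDist (F i)) :
    Represents (∑ i ∈ S, D i).toDist fun x => ∑ i ∈ S, F i x := by
  classical
  induction S using Finset.induction_on with
  | empty => simpa using represents_zero
  | insert i S hi ih =>
    simp only [Finset.sum_insert hi, map_add]
    exact (h i (Finset.mem_insert_self i S)).add
      (ih fun j hj => h j (Finset.mem_insert_of_mem hj))

omit hs in
/-- A distribution is determined by a function representing it. -/
theorem Represents.unique {D D' : SobolevSpace Ω r} {F : Space d → ℝ}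
    (h : Represents D.toDist F) (h' : Represents D'.toDist F) : D = D' :=
  sobolev_ext fun φ => (h.2 φ).trans (h'.2 φ).symm

theorem toFun_ae_eq_ev (w : SobolevSpace Ω s) :
    w.toFun =ᵐ[volume.restrict (Ω : Set (Space d))] fun x => ev s x w := by
  have h : ∃ F, Represents w.toDist F := ⟨_, represents_ev w⟩
  rw [SobolevSpace.toFun, dif_pos h]
  exact h.choose_spec.ae_eq (represents_ev w)

theorem eq_of_ev_eq {w w' : SobolevSpace Ω s} (h : ∀ x ∈ Ω, ev s x w = ev s x w') : w = w' := by
  refine (represents_ev w).unique ((represents_ev w').congr ?_)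
  filter_upwards [ae_restrict_mem Ω.isOpen.measurableSet] with x hx
  exact (h x hx).symm

theorem ev_mulCLM (f g : SobolevSpace Ω s) {x : Space d} (hx : x ∈ Ω) :
    ev s x (mulCLM Ω s s g f) = ev s x g * ev s x f := by
  have h := (represents_mulCLM (represents_ev f) g).ae_eq (represents_ev (mulCLM Ω s s g f))
  have h2 := Measure.eqOn_open_of_ae_eq h Ω.isOpen
    ((continuousOn_ev g).mul (continuousOn_ev f)) (continuousOn_ev _)
  exact (h2 hx).symm

/-- `H^r(Ω)` is a module over the algebra `H^s(Ω)`. -/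
theorem mulCLM_mulCLM [Admissible d r s] (g g' : SobolevSpace Ω s) (f : SobolevSpace Ω r) :
    mulCLM Ω r s g (mulCLM Ω r s g' f) = mulCLM Ω r s (mulCLM Ω s s g g') f := by
  have hd : DenseRange (restrictSchwartz Ω s) := denseRange_restrictSchwartz
  refine hd.induction_on₂ (p := fun g g' =>
    mulCLM Ω r s g (mulCLM Ω r s g' f) = mulCLM Ω r s (mulCLM Ω s s g g') f)
    (isClosed_eq (by fun_prop) (by fun_prop)) (fun G G' => ?_) g g'
  let GG : 𝓢(Space d, ℝ) := SchwartzMap.pairing (ContinuousLinearMap.mul ℝ ℝ) G G'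
  have h : mulCLM Ω s s (restrictSchwartz Ω s G) (restrictSchwartz Ω s G') =
      restrictSchwartz Ω s GG := by
    refine eq_of_ev_eq fun x hx => ?_
    rw [ev_mulCLM _ _ hx, ev_restrictSchwartz _ hx, ev_restrictSchwartz _ hx,
      ev_restrictSchwartz _ hx]
    rfl
  rw [h]
  refine sobolev_ext fun φ => ?_
  rw [mulCLM_restrictSchwartz, mulCLM_restrictSchwartz, mulCLM_restrictSchwartz]
  congr 1
  ext x
  change G' x * (G x * φ x) = G x * G' x * φ x
  ring

theorem mulCLM_comm (f g : SobolevSpace Ω s) : mulCLM Ω s s g f = mulCLM Ω s s f g :=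
  eq_of_ev_eq fun x hx => by rw [ev_mulCLM _ _ hx, ev_mulCLM _ _ hx, mul_comm]

omit hs in
theorem exists_cutoff (hΩ : Bornology.IsBounded (Ω : Set (Space d))) :
    ∃ χ : 𝓢(Space d, ℝ), ∀ x ∈ Ω, χ x = 1 := by
  obtain ⟨R, hR, hR2⟩ := hΩ.subset_ball_lt 0 0
  let b : ContDiffBump (0 : Space d) := ⟨R, R + 1, hR, by linarith⟩
  exact ⟨b.hasCompactSupport.toSchwartzMap b.contDiff, fun x hx =>
    b.one_of_mem_closedBall (Metric.ball_subset_closedBall (hR2 hx))⟩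

end Embedding

/-! ### Inclusion, partial derivatives and the product rule -/

section Derivatives

variable {d : ℕ} {Ω : Opens (Space d)} {r s : ℝ}

/-- The `k`-th coordinate vector. -/
abbrev basisVec (k : Fin d) : Space d := EuclideanSpace.single k (1 : ℝ)

theorem sobNorm_le_of_fourierInv_le {r r' : ℝ} {u v : 𝓢(Space d, ℂ)} {C : ℝ} (hC : 0 ≤ C)
    (h : ∀ ξ, weight r ξ * ‖𝓕⁻ u ξ‖ ≤ C * (weight r' ξ * ‖𝓕⁻ v ξ‖)) :
    sobNorm r u ≤ C * sobNorm r' v := by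
  have h1 : ENNReal.ofReal (sobNorm r u) ^ 2 ≤
      ENNReal.ofReal C ^ 2 * ENNReal.ofReal (sobNorm r' v) ^ 2 := by
    rw [sobNorm_sq, sobNorm_sq, ← lintegral_const_mul' _ _ (by simp)]
    refine lintegral_mono fun ξ => ?_
    rw [← mul_pow]
    refine pow_le_pow_left' ?_ 2
    have := ENNReal.ofReal_le_ofReal (h ξ)
    rw [ENNReal.ofReal_mul (weight_pos _ _).le, ENNReal.ofReal_mul hC,
      ENNReal.ofReal_mul (weight_pos _ _).le, ofReal_norm, ofReal_norm] at this
    rwa [Real.enorm_of_nonneg (weight_pos _ _).le, Real.enorm_of_nonneg (weight_pos _ _).le]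
  rw [← mul_pow, ← ENNReal.ofReal_mul hC, ← ENNReal.ofReal_pow (sobNorm_nonneg _ _),
    ← ENNReal.ofReal_pow (mul_nonneg hC (sobNorm_nonneg _ _)),
    ENNReal.ofReal_le_ofReal_iff (by positivity)] at h1
  exact (abs_le_of_sq_le_sq' h1 (mul_nonneg hC (sobNorm_nonneg _ _))).2

theorem weight_mono {r r' : ℝ} (h : r ≤ r') (ξ : Space d) : weight r ξ ≤ weight r' ξ := by
  unfold weight
  exact Real.rpow_le_rpow_of_exponent_le (by nlinarith [norm_nonneg ξ]) (by linarith)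

theorem norm_le_weight_one (ξ : Space d) : ‖ξ‖ ≤ weight 1 ξ := by
  unfold weight
  rw [← Real.sqrt_eq_rpow]
  exact Real.le_sqrt_of_sq_le (by linarith)

theorem toDist_incl (f : SobolevSpace Ω s) : (incl f).toDist = f.toDist := by
  have h : ∀ c : SobolevSpace Ω s, c.toDist ∈ sobolevSubmodule Ω (s - 1) := by
    rintro ⟨D, F, hF, r⟩
    exact ⟨F, hF.mono (by linarith), r⟩
  exact LinearMap.codRestrict_apply (sobolevSubmodule Ω (s - 1)) SobolevSpace.toDist (h := h) f

variable (Ω s) in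
/-- `incl` as a continuous linear map. -/
def inclCLM : SobolevSpace Ω s →L[ℝ] SobolevSpace Ω (s - 1) :=
  incl.mkContinuous 1 fun f => by
    rw [one_mul]
    refine norm_le_of_bound _ (norm_nonneg _) fun φ => ?_
    rw [toDist_incl]
    refine (abs_toDist_le f φ).trans (mul_le_mul_of_nonneg_left ?_ (norm_nonneg _))
    rw [← one_mul (sobNorm (-(s - 1)) (testToSchwartz φ))]
    refine sobNorm_le_of_fourierInv_le zero_le_one fun ξ => ?_
    rw [one_mul]
    exact mul_le_mul_of_nonneg_right (weight_mono (by linarith) ξ) (norm_nonneg _)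

theorem testToSchwartz_neg_lineDeriv (φ : 𝓓(Ω, ℝ)) (k : Fin d) :
    testToSchwartz (-(∂_{basisVec k} φ)) = -(∂_{basisVec k} (testToSchwartz φ)) := by
  ext x
  have h2 : HasFDerivAt (φ : Space d → ℝ) (fderiv ℝ φ x) x :=
    (φ.contDiff.differentiable (by simp) x).hasFDerivAt
  have h3 := (Complex.ofRealCLM.hasFDerivAt.comp x h2).fderiv
  have h4 : (∂_{basisVec k} φ) x = fderiv ℝ φ x (basisVec k) := by
    rw [← (φ.contDiff.differentiable (by simp) x).lineDeriv_eq_fderiv]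
    exact TestFunction.lineDerivCLM_apply_of_le (𝕜 := ℝ) (by simp)
  change ((-((∂_{basisVec k} φ) x) : ℝ) : ℂ) =
    -(fderiv ℝ (Complex.ofRealCLM ∘ φ) x (basisVec k))
  rw [h3, h4, Complex.ofReal_neg]
  rfl

theorem lineDeriv_test_apply (φ : 𝓓(Ω, ℝ)) (k : Fin d) (x : Space d) :
    (∂_{basisVec k} φ) x = fderiv ℝ φ x (basisVec k) := by
  rw [← (φ.contDiff.differentiable (by simp) x).lineDeriv_eq_fderiv]
  exact TestFunction.lineDerivCLM_apply_of_le (𝕜 := ℝ) (by simp)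

theorem toDist_pderiv (k : Fin d) (f : SobolevSpace Ω s) (φ : 𝓓(Ω, ℝ)) :
    (pderiv k f).toDist φ = f.toDist (-(∂_{basisVec k} φ)) :=
  Distribution.lineDerivOp_apply_apply f.toDist φ _

theorem sobNorm_lineDeriv_le (k : Fin d) (u : 𝓢(Space d, ℂ)) :
    sobNorm r (-(∂_{basisVec k} u)) ≤ (2 * Real.pi) * sobNorm (r + 1) u := by
  refine sobNorm_le_of_fourierInv_le (by positivity) fun ξ => ?_
  have h1 : 𝓕⁻ (-(∂_{basisVec k} u)) ξ = (2 * Real.pi * Complex.I) * (ξ k * 𝓕⁻ u ξ) := by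
    have h : (inner ℝ · (basisVec k) : Space d → ℝ).HasTemperateGrowth := by fun_prop
    have e : 𝓕⁻ (-(∂_{basisVec k} u)) = -𝓕⁻ (∂_{basisVec k} u) :=
      map_neg (fourierInvCLM ℂ 𝓢(Space d, ℂ)) _
    rw [e, SchwartzMap.fourierInv_lineDerivOp_eq, neg_apply, smul_apply,
      SchwartzMap.smulLeftCLM_apply_apply h]
    simp [EuclideanSpace.inner_single_right]
  rw [h1, norm_mul, norm_mul, norm_mul (2 : ℂ), Complex.norm_real Real.pi, Complex.norm_I,
    norm_mul, Complex.norm_real, Real.norm_of_nonneg Real.pi_pos.le, Complex.norm_ofNat, mul_one,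
    ← weight_mul]
  have h2 : ‖ξ k‖ ≤ weight 1 ξ := (PiLp.norm_apply_le ξ k).trans (norm_le_weight_one ξ)
  have := (weight_pos r ξ).le
  calc weight r ξ * (2 * Real.pi * (‖ξ k‖ * ‖𝓕⁻ u ξ‖))
      ≤ weight r ξ * (2 * Real.pi * (weight 1 ξ * ‖𝓕⁻ u ξ‖)) := by gcongr
    _ = _ := by ring

variable (Ω s) in
/-- `pderiv` as a continuous linear map. -/
def pderivCLM (k : Fin d) : SobolevSpace Ω s →L[ℝ] SobolevSpace Ω (s - 1) :=
  (pderiv k).mkContinuous (2 * Real.pi) fun f => by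
    refine norm_le_of_bound _ (by positivity) fun φ => ?_
    rw [toDist_pderiv]
    refine (abs_toDist_le f _).trans ?_
    rw [testToSchwartz_neg_lineDeriv]
    have h := sobNorm_lineDeriv_le (r := -s) k (testToSchwartz φ)
    rw [show -s + 1 = -(s - 1) by ring] at h
    calc _ ≤ ‖f‖ * (2 * Real.pi * sobNorm (-(s - 1)) (testToSchwartz φ)) := by gcongr
      _ = _ := by ring

theorem pderivCLM_apply (k : Fin d) (f : SobolevSpace Ω s) : pderivCLM Ω s k f = pderiv k f := rfl

theorem pderiv_restrictSchwartz (k : Fin d) (G : 𝓢(Space d, ℝ)) :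
    pderiv k (restrictSchwartz Ω s G) = restrictSchwartz Ω (s - 1) (∂_{basisVec k} G) := by
  refine sobolev_ext fun φ => ?_
  rw [toDist_pderiv, toDist_restrictSchwartz, toDist_restrictSchwartz]
  let φS : 𝓢(Space d, ℝ) := φ.hasCompactSupport.toSchwartzMap φ.contDiff
  have h := SchwartzMap.integral_mul_lineDerivOp_right_eq_neg_left (μ := volume) φS G (basisVec k)
  refine Eq.trans ?_ h.symm
  rw [← integral_neg]
  refine integral_congr_ae (Eventually.of_forall fun x => ?_)
  change -((∂_{basisVec k} φ) x) * G x = -(fderiv ℝ φ x (basisVec k) * G x)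
  rw [lineDeriv_test_apply, neg_mul]

/-- The product of two Schwartz functions. -/
def schwartzMul (F G : 𝓢(Space d, ℝ)) : 𝓢(Space d, ℝ) :=
  SchwartzMap.pairing (ContinuousLinearMap.mul ℝ ℝ) F G

theorem schwartzMul_apply (F G : 𝓢(Space d, ℝ)) (x : Space d) :
    schwartzMul F G x = F x * G x := rfl

theorem lineDeriv_schwartzMul (k : Fin d) (F G : 𝓢(Space d, ℝ)) :
    ∂_{basisVec k} (schwartzMul F G) =
      schwartzMul F (∂_{basisVec k} G) + schwartzMul G (∂_{basisVec k} F) := by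
  ext x
  have h := (F.hasFDerivAt (x := x)).mul (G.hasFDerivAt (x := x))
  rw [SchwartzMap.lineDerivOp_apply_eq_fderiv, add_apply, schwartzMul_apply,
    schwartzMul_apply, SchwartzMap.lineDerivOp_apply_eq_fderiv,
    SchwartzMap.lineDerivOp_apply_eq_fderiv]
  have e : ⇑(schwartzMul F G) = ⇑F * ⇑G := rfl
  rw [e, h.fderiv]
  rfl

theorem mulCLM_restrictSchwartz_restrictSchwartz [Admissible d r s] (F G : 𝓢(Space d, ℝ)) :
    mulCLM Ω r s (restrictSchwartz Ω s G) (restrictSchwartz Ω r F) =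
      restrictSchwartz Ω r (schwartzMul G F) := by
  refine sobolev_ext fun φ => ?_
  rw [mulCLM_restrictSchwartz, toDist_restrictSchwartz, toDist_restrictSchwartz]
  refine integral_congr_ae (Eventually.of_forall fun x => ?_)
  change G x * φ x * F x = φ x * (G x * F x)
  ring

/-- The product rule. -/
theorem pderiv_mulCLM [Admissible d (s - 1) s] (k : Fin d) (f g : SobolevSpace Ω s) :
    pderiv k (mulCLM Ω s s g f) =
      mulCLM Ω (s - 1) s g (pderiv k f) + mulCLM Ω (s - 1) s f (pderiv k g) := by
  have hd : DenseRange (restrictSchwartz Ω s) := denseRange_restrictSchwartz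
  simp_rw [← pderivCLM_apply]
  refine hd.induction_on₂ (p := fun f g => pderivCLM Ω s k (mulCLM Ω s s g f) =
    mulCLM Ω (s - 1) s g (pderivCLM Ω s k f) + mulCLM Ω (s - 1) s f (pderivCLM Ω s k g))
    (isClosed_eq (by fun_prop) (by fun_prop)) (fun F G => ?_) f g
  rw [mulCLM_restrictSchwartz_restrictSchwartz, pderivCLM_apply, pderivCLM_apply, pderivCLM_apply,
    pderiv_restrictSchwartz, pderiv_restrictSchwartz, pderiv_restrictSchwartz,
    mulCLM_restrictSchwartz_restrictSchwartz, mulCLM_restrictSchwartz_restrictSchwartz,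
    lineDeriv_schwartzMul]
  exact map_add (restrictSchwartzₗ Ω (s - 1)) _ _

theorem incl_mulCLM [Admissible d (s - 1) s] (f g : SobolevSpace Ω s) :
    incl (mulCLM Ω s s g f) = mulCLM Ω (s - 1) s g (incl f) :=
  toDist_injective ((toDist_incl _).trans (mulCLM_congr (toDist_incl f).symm g))

end Derivatives

/-! ### The functions `(e^c - 1) / c` and `c / (e^c - 1)` in a Banach algebra -/

section BanachAlgebra

open NormedSpace Nat

variable {A : Type*} [NormedRing A] [NormedAlgebra ℝ A] [CompleteSpace A]

/-- The entire function `(e^c - 1) / c = ∫_0^1 e^{θ c} dθ`. -/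
def expQuot (c : A) : A := ∫ θ in (0 : ℝ)..1, exp (θ • c)

theorem continuous_exp_real : Continuous (exp : A → A) :=
  let _ := NormedAlgebra.restrictScalars ℚ ℝ A
  NormedSpace.exp_continuous

theorem continuous_exp_smul (c : A) : Continuous fun θ : ℝ => exp (θ • c) :=
  continuous_exp_real.comp (by fun_prop)

theorem continuous_expQuot : Continuous (expQuot (A := A)) := by
  refine intervalIntegral.continuous_parametric_intervalIntegral_of_continuous' ?_ 0 1
  exact continuous_exp_real.comp (by fun_prop)

theorem expQuot_mul_self (c : A) : expQuot c * c = exp c - 1 := by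
  have h : ∀ θ ∈ uIcc (0 : ℝ) 1, HasDerivAt (fun u : ℝ => exp (u • c)) (exp (θ • c) * c) θ :=
    fun θ _ => hasDerivAt_exp_smul_const c θ
  have h2 := intervalIntegral.integral_eq_sub_of_hasDerivAt h
    (((continuous_exp_smul c).mul continuous_const).intervalIntegrable 0 1)
  rw [one_smul, zero_smul, exp_zero] at h2
  rw [← h2]
  exact (((ContinuousLinearMap.mul ℝ A).flip c).intervalIntegral_comp_comm
    ((continuous_exp_smul c).intervalIntegrable 0 1)).symm

theorem hasSum_expQuot (c : A) :
    HasSum (fun n : ℕ => ((n + 1)! : ℝ)⁻¹ • c ^ n) (expQuot c) := by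
  have h := intervalIntegral.hasSum_intervalIntegral_of_summable_norm (a := 0) (b := 1)
    (f := fun n : ℕ => (⟨fun θ : ℝ => (n ! : ℝ)⁻¹ • (θ • c) ^ n, by fun_prop⟩ : C(ℝ, A))) ?_
  · have e : ∀ θ : ℝ, ∑' n : ℕ, (n ! : ℝ)⁻¹ • (θ • c) ^ n = exp (θ • c) := fun θ =>
      (exp_series_hasSum_exp' (𝕂 := ℝ) (θ • c)).tsum_eq
    have key : ∀ n : ℕ, ∫ θ in (0 : ℝ)..1, (n ! : ℝ)⁻¹ • (θ • c) ^ n =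
        ((n + 1)! : ℝ)⁻¹ • c ^ n := by
      intro n
      have e2 : ∀ θ : ℝ, (n ! : ℝ)⁻¹ • (θ • c) ^ n = θ ^ n • ((n ! : ℝ)⁻¹ • c ^ n) := fun θ => by
        rw [smul_pow, smul_comm]
      simp_rw [e2]
      rw [intervalIntegral.integral_smul_const, integral_pow, smul_smul]
      congr 1
      rw [Nat.factorial_succ]
      push_cast
      field_simp
      simp
    simp only [ContinuousMap.coe_mk, e, key] at h
    exact h
  · refine Summable.of_nonneg_of_le (fun _ => norm_nonneg _) (fun n => ?_)
      ((Real.summable_pow_div_factorial ‖c‖).mul_left ‖(1 : A)‖ |>.add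
        (Real.summable_pow_div_factorial ‖c‖))
    rw [ContinuousMap.norm_le _ (by positivity)]
    rintro ⟨θ, hθ⟩
    have hθ' : θ ∈ Icc (0 : ℝ) 1 := by simpa using hθ
    change ‖(n ! : ℝ)⁻¹ • (θ • c) ^ n‖ ≤ _
    rw [smul_pow, norm_smul, norm_smul, norm_inv, norm_pow, Real.norm_of_nonneg hθ'.1,
      Real.norm_of_nonneg (by positivity : (0 : ℝ) ≤ n !)]
    have h1 : ‖c ^ n‖ ≤ ‖(1 : A)‖ * ‖c‖ ^ n + ‖c‖ ^ n := by
      rcases Nat.eq_zero_or_pos n with rfl | hn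
      · simp
      · have := norm_pow_le' c hn
        have h0 : 0 ≤ ‖(1 : A)‖ * ‖c‖ ^ n := by positivity
        linarith
    calc (n ! : ℝ)⁻¹ * (θ ^ n * ‖c ^ n‖) ≤ (n ! : ℝ)⁻¹ * (1 * (‖(1 : A)‖ * ‖c‖ ^ n + ‖c‖ ^ n)) := by
          gcongr
          exact pow_le_one₀ hθ'.1 hθ'.2
      _ = _ := by field_simp

omit [CompleteSpace A] in
theorem summable_expQuot (c : A) : Summable fun n : ℕ => ‖((n + 1)! : ℝ)⁻¹ • c ^ n‖ := by
  refine Summable.of_nonneg_of_le (fun _ => norm_nonneg _) (fun n => ?_)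
    (norm_expSeries_summable' (𝕂 := ℝ) c)
  rw [norm_smul, norm_smul, norm_inv, norm_inv]
  gcongr
  · simp only [RCLike.norm_natCast]; positivity
  · simp only [RCLike.norm_natCast]
    exact_mod_cast Nat.factorial_le (Nat.le_succ n)

/-- The coefficients of `(e^x - 1)/x` and of `x/(e^x - 1)` convolve to those of `1`. -/
theorem sum_bernoulli_antidiagonal (n : ℕ) :
    ∑ p ∈ Finset.HasAntidiagonal.antidiagonal n, ((p.1 + 1)! : ℝ)⁻¹ * ((bernoulli p.2 : ℝ) / (p.2 ! : ℝ)) =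
      if n = 0 then 1 else 0 := by
  have h := congrArg (PowerSeries.coeff (n + 1)) (bernoulliPowerSeries_mul_exp_sub_one ℝ)
  rw [PowerSeries.coeff_X, PowerSeries.coeff_mul, Finset.Nat.antidiagonal_succ',
    Finset.sum_cons] at h
  have h0 : PowerSeries.coeff 0 (PowerSeries.exp ℝ - 1) = 0 := by simp
  rw [h0, mul_zero, zero_add, Finset.sum_map] at h
  rw [← Finset.Nat.sum_antidiagonal_swap]
  simp only [Nat.add_eq_right] at h
  rw [← h]
  refine Finset.sum_congr rfl fun p _ => ?_
  simp only [Prod.fst_swap, Prod.snd_swap, Function.Embedding.prodMap, Function.Embedding.coeFn_mk,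
    Prod.map_fst, Prod.map_snd, bernoulliPowerSeries, PowerSeries.coeff_mk, map_sub,
    PowerSeries.coeff_exp, PowerSeries.coeff_one, Function.Embedding.refl_apply]
  simp
  ring

/-- The growth of the Bernoulli numbers, from Euler's formula for `ζ(2k)`: the series of
`x/(e^x - 1)` has radius of convergence at least `2π`. -/
theorem abs_bernoulli_div_le : ∃ C : ℝ, 0 ≤ C ∧
    ∀ n : ℕ, |(bernoulli n : ℝ) / (n ! : ℝ)| ≤ C / (2 * Real.pi) ^ n := by
  set Z := ∑' n : ℕ, 1 / (n : ℝ) ^ 2 with hZ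
  have hsum : Summable fun n : ℕ => 1 / (n : ℝ) ^ 2 := Real.summable_one_div_nat_pow.2 (by norm_num)
  have hZ0 : 0 ≤ Z := tsum_nonneg fun n => by positivity
  have hpi := Real.pi_pos
  refine ⟨2 * Z + Real.pi + 1, by positivity, fun n => ?_⟩
  rcases Nat.even_or_odd' n with ⟨k, rfl | rfl⟩
  · rcases Nat.eq_zero_or_pos k with rfl | hk
    · simp; positivity
    · have h := hasSum_zeta_nat hk.ne'
      have hle : (-1 : ℝ) ^ (k + 1) * 2 ^ (2 * k - 1) * Real.pi ^ (2 * k) * bernoulli (2 * k) /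
          (2 * k)! ≤ Z := by
        rw [← h.tsum_eq]
        refine h.summable.tsum_le_tsum (fun m => ?_) hsum
        rcases Nat.eq_zero_or_pos m with rfl | hm
        · simp [hk.ne']
        · have : (1 : ℝ) ≤ m := by exact_mod_cast hm
          gcongr
          omega
      have hnn : 0 ≤ (-1 : ℝ) ^ (k + 1) * 2 ^ (2 * k - 1) * Real.pi ^ (2 * k) *
          bernoulli (2 * k) / (2 * k)! := by
        rw [← h.tsum_eq]
        exact tsum_nonneg fun m => by positivity
      have e : (-1 : ℝ) ^ (k + 1) * 2 ^ (2 * k - 1) * Real.pi ^ (2 * k) *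
          bernoulli (2 * k) / (2 * k)! =
          (-1 : ℝ) ^ (k + 1) * (2 ^ (2 * k - 1) * Real.pi ^ (2 * k)) *
            (bernoulli (2 * k) / (2 * k)!) := by ring
      rw [e] at hle hnn
      have h2 : |(bernoulli (2 * k) : ℝ) / (2 * k)!| * (2 ^ (2 * k - 1) * Real.pi ^ (2 * k)) ≤ Z := by
        refine le_trans (le_of_eq ?_) hle
        rw [← abs_of_nonneg hnn, abs_mul, abs_mul, abs_pow, abs_neg, abs_one, one_pow, one_mul,
          abs_of_nonneg (by positivity : (0 : ℝ) ≤ 2 ^ (2 * k - 1) * Real.pi ^ (2 * k)), mul_comm]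
      rw [le_div_iff₀ (by positivity), mul_pow]
      have e2 : (2 : ℝ) ^ (2 * k) = 2 * 2 ^ (2 * k - 1) :=
        (mul_pow_sub_one (by omega) _).symm
      rw [e2]
      nlinarith
  · rcases Nat.eq_zero_or_pos k with rfl | hk
    · have : (|(bernoulli (2 * 0 + 1) : ℝ) / (2 * 0 + 1)!|) = 1 / 2 := by
        simp [bernoulli_one]
        norm_num
      rw [this, le_div_iff₀ (by positivity)]
      norm_num
      nlinarith
    · have : bernoulli (2 * k + 1) = 0 :=
        bernoulli_eq_zero_of_odd (by exact ⟨k, rfl⟩) (by omega)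
      rw [this]
      simp
      positivity

/-- If the powers of `c` grow more slowly than `(2 π)^n`, then the Bernoulli series inverts
`(e^c - 1) / c`. The even part of the series is `c / (e^c - 1) + c / 2`. -/
theorem bernoulli_series {c : A} {K ρ : ℝ} (hρ0 : 0 ≤ ρ) (hρ : ρ < 2 * Real.pi)
    (hc : ∀ n : ℕ, ‖c ^ n‖ ≤ K * ρ ^ n) :
    ∃ E : A, HasSum (fun n : ℕ => ((bernoulli (2 * n) : ℝ) / ((2 * n)! : ℝ)) • c ^ (2 * n)) E ∧
      expQuot c * ((2 : ℝ) • E) = exp c + 1 := by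
  obtain ⟨C, hC, hB⟩ := abs_bernoulli_div_le
  set f : ℕ → A := fun n => ((bernoulli n : ℝ) / (n ! : ℝ)) • c ^ n with hf
  have hpi := Real.pi_pos
  have hsum : Summable fun n => ‖f n‖ := by
    refine Summable.of_nonneg_of_le (fun _ => norm_nonneg _) (fun n => ?_)
      ((summable_geometric_of_lt_one (by positivity : 0 ≤ ρ / (2 * Real.pi))
        ((div_lt_one (by positivity)).2 hρ)).mul_left (C * K))
    rw [hf]
    beta_reduce
    rw [norm_smul, Real.norm_eq_abs]
    calc _ ≤ C / (2 * Real.pi) ^ n * (K * ρ ^ n) := by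
          gcongr
          · exact hB n
          · exact hc n
      _ = _ := by rw [div_pow]; ring
  have hprod : expQuot c * ∑' n, f n = 1 := by
    rw [← (hasSum_expQuot c).tsum_eq,
      tsum_mul_tsum_eq_tsum_sum_antidiagonal_of_summable_norm (summable_expQuot c) hsum]
    have e : ∀ n : ℕ, ∑ p ∈ Finset.HasAntidiagonal.antidiagonal n, (((p.1 + 1)! : ℝ)⁻¹ • c ^ p.1) * f p.2 =
        if n = 0 then 1 else 0 := by
      intro n
      have : ∀ p ∈ Finset.HasAntidiagonal.antidiagonal n, (((p.1 + 1)! : ℝ)⁻¹ • c ^ p.1) * f p.2 =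
          (((p.1 + 1)! : ℝ)⁻¹ * ((bernoulli p.2 : ℝ) / (p.2 ! : ℝ))) • c ^ n := by
        intro p hp
        rw [hf, smul_mul_smul_comm, ← pow_add, Finset.HasAntidiagonal.mem_antidiagonal.1 hp]
      rw [Finset.sum_congr rfl this, ← Finset.sum_smul, sum_bernoulli_antidiagonal]
      split_ifs with h
      · rw [h, pow_zero, one_smul]
      · rw [zero_smul]
    simp_rw [e]
    rw [tsum_ite_eq]
  have hs := hsum.of_norm
  have he : Summable fun n => f (2 * n) :=
    hs.comp_injective (fun a b h => by simpa using h)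
  have ho : HasSum (fun n => f (2 * n + 1)) (-((1 / 2 : ℝ) • c)) := by
    have h1 : f (2 * 0 + 1) = -((1 / 2 : ℝ) • c) := by
      rw [hf]
      simp [bernoulli_one]
      rw [neg_div, neg_smul]
      norm_num
    rw [← h1]
    refine hasSum_single 0 fun n hn => ?_
    rw [hf]
    beta_reduce
    rw [bernoulli_eq_zero_of_odd (by exact ⟨n, rfl⟩) (by omega)]
    simp
  refine ⟨∑' n, f (2 * n), he.hasSum, ?_⟩
  have h3 := (he.hasSum.even_add_odd ho).tsum_eq
  have h4 : (2 : ℝ) • ∑' n, f (2 * n) = (2 : ℝ) • (∑' n, f n) + c := by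
    rw [h3, smul_add, smul_neg, smul_smul]
    norm_num
  rw [h4, mul_add, mul_smul_comm, hprod, expQuot_mul_self, two_smul]
  abel

end BanachAlgebra

/-! ### Matrices over `H^s(Ω)` and their exponential -/

section Matrices

open NormedSpace

variable {d : ℕ} {Ω : Opens (Space d)} {r s : ℝ}

/-- Matrices over `H^r(Ω)`, written as functions in order to carry the supremum norm. -/
abbrev SobolevMatrix {d : ℕ} (Ω : Opens (Space d)) (r : ℝ) : Type :=
  Fin d → Fin d → SobolevSpace Ω r

theorem norm_entry_le (X : SobolevMatrix Ω r) (i j : Fin d) : ‖X i j‖ ≤ ‖X‖ :=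
  (norm_le_pi_norm (X i) j).trans (norm_le_pi_norm X i)

theorem norm_le_of_entry_le {X : SobolevMatrix Ω r} {C : ℝ} (hC : 0 ≤ C)
    (h : ∀ i j, ‖X i j‖ ≤ C) : ‖X‖ ≤ C :=
  (pi_norm_le_iff_of_nonneg hC).2 fun i => (pi_norm_le_iff_of_nonneg hC).2 fun j => h i j

variable (r) in
/-- `X ↦ Y ↦ X Y` as a continuous bilinear map. -/
def leftL [Admissible d r s] :
    SobolevMatrix Ω s →L[ℝ] SobolevMatrix Ω r →L[ℝ] SobolevMatrix Ω r :=
  LinearMap.mkContinuous₂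
    (LinearMap.mk₂ ℝ (fun X Y i j => ∑ k, mulCLM Ω r s (X i k) (Y k j))
      (fun X X' Y => by funext i j; simp [Finset.sum_add_distrib])
      (fun c X Y => by funext i j; simp [Finset.smul_sum])
      (fun X Y Y' => by funext i j; simp [Finset.sum_add_distrib])
      (fun c X Y => by funext i j; simp [Finset.smul_sum]))
    (d * ‖mulCLM Ω r s‖) fun X Y => by
      refine norm_le_of_entry_le (by positivity) fun i j => ?_
      rw [LinearMap.mk₂_apply]
      have h : ∀ k ∈ Finset.univ, ‖mulCLM Ω r s (X i k) (Y k j)‖ ≤ ‖mulCLM Ω r s‖ * ‖X‖ * ‖Y‖ := by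
        intro k _
        refine ((mulCLM Ω r s).le_opNorm₂ _ _).trans ?_
        gcongr
        · exact norm_entry_le X _ _
        · exact norm_entry_le Y _ _
      refine (norm_sum_le_of_le _ h).trans (le_of_eq ?_)
      rw [Finset.sum_const, Finset.card_univ, Fintype.card_fin, nsmul_eq_mul]
      ring

theorem leftL_apply [Admissible d r s] (X : SobolevMatrix Ω s) (Y : SobolevMatrix Ω r)
    (i j : Fin d) : leftL r X Y i j = ∑ k, mulCLM Ω r s (X i k) (Y k j) := rfl

variable (r) in
/-- `X ↦ Y ↦ Y X` as a continuous bilinear map. -/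
def rightL [Admissible d r s] :
    SobolevMatrix Ω s →L[ℝ] SobolevMatrix Ω r →L[ℝ] SobolevMatrix Ω r :=
  LinearMap.mkContinuous₂
    (LinearMap.mk₂ ℝ (fun X Y i j => ∑ k, mulCLM Ω r s (X k j) (Y i k))
      (fun X X' Y => by funext i j; simp [Finset.sum_add_distrib])
      (fun c X Y => by funext i j; simp [Finset.smul_sum])
      (fun X Y Y' => by funext i j; simp [Finset.sum_add_distrib])
      (fun c X Y => by funext i j; simp [Finset.smul_sum]))
    (d * ‖mulCLM Ω r s‖) fun X Y => by
      refine norm_le_of_entry_le (by positivity) fun i j => ?_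
      rw [LinearMap.mk₂_apply]
      have h : ∀ k ∈ Finset.univ, ‖mulCLM Ω r s (X k j) (Y i k)‖ ≤ ‖mulCLM Ω r s‖ * ‖X‖ * ‖Y‖ := by
        intro k _
        refine ((mulCLM Ω r s).le_opNorm₂ _ _).trans ?_
        gcongr
        · exact norm_entry_le X _ _
        · exact norm_entry_le Y _ _
      refine (norm_sum_le_of_le _ h).trans (le_of_eq ?_)
      rw [Finset.sum_const, Finset.card_univ, Fintype.card_fin, nsmul_eq_mul]
      ring

theorem rightL_apply [Admissible d r s] (X : SobolevMatrix Ω s) (Y : SobolevMatrix Ω r)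
    (i j : Fin d) : rightL r X Y i j = ∑ k, mulCLM Ω r s (X k j) (Y i k) := rfl

theorem leftMul_eq [Admissible d r s] (X : Matrix (Fin d) (Fin d) (SobolevSpace Ω s))
    (Y : Matrix (Fin d) (Fin d) (SobolevSpace Ω r)) : leftMul X Y = leftL r X Y := by
  ext1 i j
  simp only [leftMul, Matrix.of_apply, sobolevMul_eq]
  rfl

theorem rightMul_eq [Admissible d r s] (X : Matrix (Fin d) (Fin d) (SobolevSpace Ω s))
    (Y : Matrix (Fin d) (Fin d) (SobolevSpace Ω r)) : rightMul Y X = rightL r X Y := by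
  ext1 i j
  simp only [rightMul, Matrix.of_apply, sobolevMul_eq]
  rfl

theorem comm_eq [Admissible d r s] (X : Matrix (Fin d) (Fin d) (SobolevSpace Ω s))
    (Y : Matrix (Fin d) (Fin d) (SobolevSpace Ω r)) :
    comm X Y = (leftL r X - rightL r X) Y := by
  rw [comm, leftMul_eq, rightMul_eq]
  rfl

theorem iterComm_eq [Admissible d r s] (X : Matrix (Fin d) (Fin d) (SobolevSpace Ω s))
    (Y : Matrix (Fin d) (Fin d) (SobolevSpace Ω r)) (n : ℕ) :
    iterComm X Y n = ((leftL r X - rightL r X) ^ n) Y := by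
  induction n with
  | zero => rfl
  | succ n ih =>
    rw [pow_succ']
    exact (comm_eq X (iterComm X Y n)).trans (congrArg _ ih)

variable [Admissible d s s]

theorem leftL_leftL [Admissible d r s] (X Y : SobolevMatrix Ω s) :
    leftL r (leftL s X Y) = leftL r X * leftL r Y := by
  refine ContinuousLinearMap.ext fun Z => funext fun i => funext fun j => ?_
  simp only [mul_apply_eq_comp, leftL_apply, map_sum, sum_apply, mulCLM_mulCLM]
  exact Finset.sum_comm

theorem rightL_leftL [Admissible d r s] (X Y : SobolevMatrix Ω s) :
    rightL r (leftL s X Y) = rightL r Y * rightL r X := by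
  refine ContinuousLinearMap.ext fun Z => funext fun i => funext fun j => ?_
  simp only [mul_apply_eq_comp, leftL_apply, rightL_apply, map_sum, sum_apply,
    mulCLM_mulCLM]
  rw [Finset.sum_comm]
  refine Finset.sum_congr rfl fun l _ => Finset.sum_congr rfl fun k _ => ?_
  rw [mulCLM_comm]

theorem commute_leftL_rightL [Admissible d r s] (X Y : SobolevMatrix Ω s) :
    Commute (leftL r X) (rightL r Y) := by
  refine ContinuousLinearMap.ext fun Z => funext fun i => funext fun j => ?_
  simp only [mul_apply_eq_comp, leftL_apply, rightL_apply, map_sum, mulCLM_mulCLM]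
  rw [Finset.sum_comm]
  refine Finset.sum_congr rfl fun l _ => Finset.sum_congr rfl fun k _ => ?_
  rw [mulCLM_comm]

theorem leftL_comm (X Y : SobolevMatrix Ω s) : leftL s X Y = rightL s Y X := by
  refine funext fun i => funext fun j => ?_
  rw [leftL_apply, rightL_apply]
  exact Finset.sum_congr rfl fun k _ => mulCLM_comm _ _

variable [hΩ : Fact (Bornology.IsBounded (Ω : Set (Space d)))]

variable (Ω s) in
/-- The constant function `1`. -/
def unitFun : SobolevSpace Ω s := restrictSchwartz Ω s (exists_cutoff hΩ.out).choose

omit [Admissible d s s] in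
theorem mulCLM_unitFun [Admissible d r s] (f : SobolevSpace Ω r) :
    mulCLM Ω r s (unitFun Ω s) f = f := by
  refine sobolev_ext fun φ => ?_
  rw [unitFun, mulCLM_restrictSchwartz]
  congr 1
  ext x
  rw [mulTest_apply]
  by_cases hx : x ∈ Ω
  · rw [(exists_cutoff hΩ.out).choose_spec x hx, one_mul]
  · rw [test_eq_zero φ hx, mul_zero]

theorem ev_unitFun {x : Space d} (hx : x ∈ Ω) : ev s x (unitFun Ω s) = 1 := by
  rw [unitFun, ev_restrictSchwartz _ hx, (exists_cutoff hΩ.out).choose_spec x hx]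

variable (Ω s) in
/-- The identity matrix. -/
def oneM : SobolevMatrix Ω s := (Matrix.diagonal fun _ => unitFun Ω s :
  Matrix (Fin d) (Fin d) (SobolevSpace Ω s))

omit [Admissible d s s] in
theorem leftL_oneM [Admissible d r s] : leftL r (oneM Ω s) = 1 := by
  refine ContinuousLinearMap.ext fun Y => funext fun i => funext fun j => ?_
  rw [leftL_apply, Finset.sum_eq_single i]
  · rw [oneM, Matrix.diagonal_apply_eq, mulCLM_unitFun]; rfl
  · intro k _ hk
    rw [oneM, Matrix.diagonal_apply_ne _ hk.symm, map_zero]; rfl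
  · simp

omit [Admissible d s s] in
theorem rightL_oneM [Admissible d r s] : rightL r (oneM Ω s) = 1 := by
  refine ContinuousLinearMap.ext fun Y => funext fun i => funext fun j => ?_
  rw [rightL_apply, Finset.sum_eq_single j]
  · rw [oneM, Matrix.diagonal_apply_eq, mulCLM_unitFun]; rfl
  · intro k _ hk
    rw [oneM, Matrix.diagonal_apply_ne _ hk, map_zero]; rfl
  · simp

/-- The exponential of a matrix over `H^s(Ω)`, as the exponential of the operator of left
multiplication, applied to the identity matrix. -/
def expM (X : SobolevMatrix Ω s) : SobolevMatrix Ω s := exp (leftL s X) (oneM Ω s)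

theorem continuous_expM : Continuous (expM (Ω := Ω) (s := s)) :=
  (ContinuousLinearMap.apply ℝ _ (oneM Ω s)).continuous.comp
    (continuous_exp_real.comp (leftL s).continuous)

theorem hasSum_expM (X : SobolevMatrix Ω s) :
    HasSum (fun n : ℕ => (n.factorial : ℝ)⁻¹ • (leftL s X ^ n) (oneM Ω s)) (expM X) := by
  have h := (ContinuousLinearMap.apply ℝ (SobolevMatrix Ω s) (oneM Ω s)).hasSum
    (exp_series_hasSum_exp' (𝕂 := ℝ) (leftL s X))
  simp only [map_smul] at h
  exact h

theorem leftL_pow [Admissible d r s] (X : SobolevMatrix Ω s) (n : ℕ) :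
    leftL r ((leftL s X ^ n) (oneM Ω s)) = leftL r X ^ n := by
  induction n with
  | zero => exact leftL_oneM
  | succ n ih =>
    rw [pow_succ' (leftL r X), ← ih, ← leftL_leftL, pow_succ']
    rfl

theorem rightL_pow [Admissible d r s] (X : SobolevMatrix Ω s) (n : ℕ) :
    rightL r ((leftL s X ^ n) (oneM Ω s)) = rightL r X ^ n := by
  induction n with
  | zero => exact rightL_oneM
  | succ n ih =>
    rw [pow_succ (rightL r X), ← ih, ← rightL_leftL, pow_succ']
    rfl

theorem leftL_expM [Admissible d r s] (X : SobolevMatrix Ω s) :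
    leftL r (expM X) = exp (leftL r X) := by
  have h := (leftL (Ω := Ω) (s := s) r).hasSum (hasSum_expM X)
  refine h.unique ?_
  simp only [map_smul, leftL_pow]
  exact exp_series_hasSum_exp' (𝕂 := ℝ) (leftL r X)

theorem rightL_expM [Admissible d r s] (X : SobolevMatrix Ω s) :
    rightL r (expM X) = exp (rightL r X) := by
  have h := (rightL (Ω := Ω) (s := s) r).hasSum (hasSum_expM X)
  refine h.unique ?_
  simp only [map_smul, rightL_pow]
  exact exp_series_hasSum_exp' (𝕂 := ℝ) (rightL r X)

/-- The value of a matrix over `H^s(Ω)` at a point of `Ω`. -/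
def evM (x : Space d) (X : SobolevMatrix Ω s) : Matrix (Fin d) (Fin d) ℝ :=
  Matrix.of fun i j => ev s x (X i j)

omit hΩ in
theorem evM_leftL (X Y : SobolevMatrix Ω s) {x : Space d} (hx : x ∈ Ω) :
    evM x (leftL s X Y) = evM x X * evM x Y := by
  ext i j
  rw [evM, Matrix.of_apply, leftL_apply, map_sum, Matrix.mul_apply]
  exact Finset.sum_congr rfl fun k _ => ev_mulCLM _ _ hx

theorem evM_oneM {x : Space d} (hx : x ∈ Ω) : evM x (oneM Ω s) = 1 := by
  ext i j
  rw [evM, Matrix.of_apply]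
  rcases eq_or_ne i j with rfl | h
  · rw [oneM, Matrix.diagonal_apply_eq, ev_unitFun hx, Matrix.one_apply_eq]
  · rw [oneM, Matrix.diagonal_apply_ne _ h, map_zero, Matrix.one_apply_ne h]

theorem evM_pow (X : SobolevMatrix Ω s) {x : Space d} (hx : x ∈ Ω) (n : ℕ) :
    evM x ((leftL s X ^ n) (oneM Ω s)) = evM x X ^ n := by
  induction n with
  | zero => exact evM_oneM hx
  | succ n ih =>
    rw [pow_succ' (evM x X), ← ih, ← evM_leftL _ _ hx, pow_succ']
    rfl

theorem evM_expM (X : SobolevMatrix Ω s) {x : Space d} (hx : x ∈ Ω) :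
    evM x (expM X) = exp (evM x X) := by
  have h : HasSum (fun n : ℕ => (n.factorial : ℝ)⁻¹ • evM x X ^ n) (evM x (expM X)) := by
    refine Pi.hasSum.2 fun i => Pi.hasSum.2 fun j => ?_
    have h1 := (ev s x).hasSum (Pi.hasSum.1 (Pi.hasSum.1 (hasSum_expM X) i) j)
    refine h1.congr_fun fun n => ?_
    rw [← evM_pow X hx]
    exact (map_smul (ev s x) _ _).symm
  rw [exp_eq_tsum ℝ]
  exact h.tsum_eq.symm

section Commuting

variable {A : Type*} [NormedRing A] [NormedAlgebra ℝ A] [CompleteSpace A]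

theorem exp_add_real {a b : A} (h : Commute a b) : exp (a + b) = exp a * exp b :=
  let _ := NormedAlgebra.restrictScalars ℚ ℝ A
  exp_add_of_commute h

theorem exp_mul_exp_sub {a b : A} (h : Commute a b) : exp a * exp (b - a) = exp b := by
  rw [← exp_add_real (h.sub_right (Commute.refl a)), add_sub_cancel]

theorem exp_mul_expQuot_mul_sub {a b : A} (h : Commute a b) :
    exp a * expQuot (b - a) * (a - b) = exp a - exp b := by
  rw [mul_assoc, ← neg_sub b a, mul_neg, expQuot_mul_self, mul_neg, mul_sub, mul_one,
    exp_mul_exp_sub h, neg_sub]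

omit [CompleteSpace A] in
theorem norm_sub_pow_le {a b : A} (h : Commute b a) {K ν : ℝ} (ha : ∀ n : ℕ, ‖a ^ n‖ ≤ K * ν ^ n)
    (hb : ∀ n : ℕ, ‖b ^ n‖ ≤ K * ν ^ n) (n : ℕ) :
    ‖(b - a) ^ n‖ ≤ K ^ 2 * (2 * ν) ^ n := by
  rw [sub_eq_add_neg, h.neg_right.add_pow]
  calc _ ≤ ∑ k ∈ Finset.range (n + 1), (K * ν ^ k) * (K * ν ^ (n - k)) * (n.choose k : ℝ) := by
        refine norm_sum_le_of_le _ fun k _ => ?_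
        rw [← nsmul_eq_mul', ← Nat.cast_smul_eq_nsmul ℝ, norm_smul, mul_comm, RCLike.norm_natCast]
        gcongr
        refine (norm_mul_le _ _).trans ?_
        have h2 : ‖(-a) ^ (n - k)‖ = ‖a ^ (n - k)‖ := by
          rcases (n - k).even_or_odd with h | h
          · rw [h.neg_pow]
          · rw [h.neg_pow, norm_neg]
        rw [h2]
        exact mul_le_mul (hb k) (ha _) (norm_nonneg _) ((norm_nonneg _).trans (hb k))
    _ = K ^ 2 * ∑ k ∈ Finset.range (n + 1), ν ^ k * ν ^ (n - k) * (n.choose k : ℝ) := by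
        rw [Finset.mul_sum]
        exact Finset.sum_congr rfl fun k _ => by ring
    _ = _ := by rw [← add_pow]; ring

end Commuting

end Matrices

/-! ### Derivatives of the matrix exponential -/

section ExpDerivative

open NormedSpace

variable {d : ℕ} {Ω : Opens (Space d)} {r s : ℝ}

theorem sub_pow_two_mul {A : Type*} [Ring A] (a b : A) (n : ℕ) :
    (a - b) ^ (2 * n) = (b - a) ^ (2 * n) := by
  rw [← neg_sub, (even_two_mul n).neg_pow]

/-- The operator `∫_0^1 e^{(1 - θ) L_X} e^{θ R_Y} dθ`, with `L_X` the left multiplication by `X` and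
`R_Y` the right multiplication by `Y`; for `X = Y` it is the differential of the exponential. -/
def dexp (r : ℝ) [Admissible d r s] (X Y : SobolevMatrix Ω s) :
    SobolevMatrix Ω r →L[ℝ] SobolevMatrix Ω r :=
  exp (leftL r X) * expQuot (rightL r Y - leftL r X)

theorem continuous_dexp [Admissible d r s] :
    Continuous fun p : SobolevMatrix Ω s × SobolevMatrix Ω s => dexp r p.1 p.2 :=
  (continuous_exp_real.comp ((leftL r).continuous.comp continuous_fst)).mul
    (continuous_expQuot.comp (((rightL r).continuous.comp continuous_snd).sub
      ((leftL r).continuous.comp continuous_fst)))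

variable [Admissible d s s]

theorem dexp_mul_sub [Admissible d r s] (X Y : SobolevMatrix Ω s) :
    dexp r X Y * (leftL r X - rightL r Y) = exp (leftL r X) - exp (rightL r Y) :=
  exp_mul_expQuot_mul_sub (commute_leftL_rightL X Y)

/-- The Bernoulli series of the commutator with `X` inverts the differential of the exponential up
to the factor `(e^{L_X} + e^{R_X}) / 2`. -/
theorem dexp_bernoulli [Admissible d r s] {X : SobolevMatrix Ω s} {K ν : ℝ} (hν0 : 0 ≤ ν)
    (hν : ν < Real.pi) (hL : ∀ n : ℕ, ‖leftL r X ^ n‖ ≤ K * ν ^ n)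
    (hR : ∀ n : ℕ, ‖rightL r X ^ n‖ ≤ K * ν ^ n) :
    ∃ E : SobolevMatrix Ω r →L[ℝ] SobolevMatrix Ω r,
      HasSum (fun n : ℕ => ((bernoulli (2 * n) : ℝ) / ((2 * n).factorial : ℝ)) •
        (leftL r X - rightL r X) ^ (2 * n)) E ∧
      dexp r X X * ((2 : ℝ) • E) = exp (leftL r X) + exp (rightL r X) := by
  have hc := commute_leftL_rightL (r := r) X X
  obtain ⟨E, hE, h⟩ := bernoulli_series (c := rightL r X - leftL r X) (K := K ^ 2)
    (ρ := 2 * ν) (by positivity) (by linarith) (norm_sub_pow_le hc.symm hL hR)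
  refine ⟨E, ?_, ?_⟩
  · have e : ∀ n : ℕ, (leftL r X - rightL r X) ^ (2 * n) = (rightL r X - leftL r X) ^ (2 * n) :=
      fun n => sub_pow_two_mul _ _ n
    simpa only [e] using hE
  · rw [dexp, mul_assoc, h, mul_add, mul_one, exp_mul_exp_sub hc, add_comm]

variable [hΩ : Fact (Bornology.IsBounded (Ω : Set (Space d)))]

omit hΩ [Admissible d s s] in
theorem leftL_smul [Admissible d r s] (c : ℝ) (X : SobolevMatrix Ω s) :
    leftL r (c • X) = c • leftL r X := map_smul _ _ _

/-- A derivation over left and right multiplication maps `e^X` to `dexp X X (D X)`. With `θ`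
as time, `e^{-θ L_X} D (e^{θ X})` has the derivative `e^{θ (R_X - L_X)} D X`. -/
theorem derivation_expM [Admissible d r s] (D : SobolevMatrix Ω s →L[ℝ] SobolevMatrix Ω r)
    (hD : ∀ X Y, D (leftL s X Y) = leftL r X (D Y) + rightL r Y (D X)) (X : SobolevMatrix Ω s) :
    D (expM X) = dexp r X X (D X) := by
  set a := leftL r X with ha
  set b := rightL r X with hb
  have hab : Commute a b := commute_leftL_rightL X X
  have hE : ∀ θ : ℝ, HasDerivAt (fun θ : ℝ => expM (θ • X)) (leftL s X (expM (θ • X))) θ := by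
    intro θ
    have h := hasDerivAt_exp_smul_const' (leftL s X) θ
    have h2 := (ContinuousLinearMap.apply ℝ (SobolevMatrix Ω s)
      (oneM Ω s)).hasFDerivAt.comp_hasDerivAt θ h
    have e : ∀ θ : ℝ, expM (θ • X) = exp (θ • leftL s X) (oneM Ω s) := fun θ => by
      rw [expM, leftL_smul]
    simp only [e]
    exact h2
  have hg : ∀ θ ∈ uIcc (0 : ℝ) 1, HasDerivAt (fun θ : ℝ => exp (θ • (-a)) (D (expM (θ • X))))
      (exp (θ • (b - a)) (D X)) θ := by
    intro θ _
    have h1 := hasDerivAt_exp_smul_const (-a) θ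
    have h2 := D.hasFDerivAt.comp_hasDerivAt θ (hE θ)
    have h3 := h1.clm_apply h2
    have e1 : rightL r (expM (θ • X)) = exp (θ • b) := by
      rw [rightL_expM, map_smul]
    have e2 : exp (θ • (b - a)) = exp (θ • (-a)) * exp (θ • b) := by
      rw [← exp_add_real ((hab.neg_left.smul_left θ).smul_right θ), ← smul_add]
      congr 2
      abel
    have e3 : (exp (θ • -a) * -a) (D (expM (θ • X))) +
        exp (θ • -a) (D (leftL s X (expM (θ • X)))) = exp (θ • (b - a)) (D X) := by
      rw [hD, e1, e2, map_add]
      simp only [mul_apply_eq_comp, neg_apply, map_neg]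
      abel
    rw [← e3]
    exact h3
  have hint := intervalIntegral.integral_eq_sub_of_hasDerivAt hg
    (Continuous.intervalIntegrable (by
      exact (ContinuousLinearMap.apply ℝ (SobolevMatrix Ω r) (D X)).continuous.comp
        (continuous_exp_smul (b - a))) 0 1)
  have hone : D (oneM Ω s) = 0 := by
    have h := hD (oneM Ω s) (oneM Ω s)
    have e : leftL s (oneM Ω s) (oneM Ω s) = oneM Ω s := by rw [leftL_oneM]; rfl
    rw [e, leftL_oneM, rightL_oneM] at h
    exact left_eq_add.1 h
  have hzero : expM (0 : SobolevMatrix Ω s) = oneM Ω s := by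
    rw [expM, map_zero, exp_zero]; rfl
  rw [one_smul, zero_smul, one_smul, zero_smul, hzero, hone, map_zero, sub_zero] at hint
  have h4 : expQuot (b - a) (D X) = exp (-a) (D (expM X)) := by
    rw [← hint]
    exact ((ContinuousLinearMap.apply ℝ (SobolevMatrix Ω r) (D X)).intervalIntegral_comp_comm
      ((continuous_exp_smul (b - a)).intervalIntegrable 0 1)).symm
  have h5 : exp a * exp (-a) = 1 := by
    rw [← exp_add_real (Commute.refl a).neg_right, add_neg_cancel, exp_zero]
  rw [dexp, mul_apply_eq_comp, h4, ← mul_apply_eq_comp, h5]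
  rfl

section Inclusion

variable (Ω s) in
/-- The inclusion, entry by entry. -/
def inclM : SobolevMatrix Ω s →L[ℝ] SobolevMatrix Ω (s - 1) :=
  ContinuousLinearMap.pi fun i => ContinuousLinearMap.pi fun j =>
    inclCLM Ω s ∘L ContinuousLinearMap.proj j ∘L ContinuousLinearMap.proj i

omit hΩ [Admissible d s s] in
theorem inclM_apply (X : SobolevMatrix Ω s) (i j : Fin d) : inclM Ω s X i j = incl (X i j) := rfl

omit hΩ in
theorem leftL_inclM [Admissible d (s - 1) s] (X Y : SobolevMatrix Ω s) :
    leftL (s - 1) X (inclM Ω s Y) = inclM Ω s (leftL s X Y) := by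
  refine funext fun i => funext fun j => ?_
  rw [leftL_apply, inclM_apply, leftL_apply, map_sum]
  exact Finset.sum_congr rfl fun k _ => (incl_mulCLM _ _).symm

omit hΩ in
theorem rightL_inclM [Admissible d (s - 1) s] (X Y : SobolevMatrix Ω s) :
    rightL (s - 1) X (inclM Ω s Y) = inclM Ω s (rightL s X Y) := by
  refine funext fun i => funext fun j => ?_
  rw [rightL_apply, inclM_apply, rightL_apply, map_sum]
  exact Finset.sum_congr rfl fun k _ => (incl_mulCLM _ _).symm

/-- The difference of two exponentials as a linear operator, depending on both arguments, applied
to `X - Y`. -/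
theorem inclM_expM_sub [Admissible d (s - 1) s] (X Y : SobolevMatrix Ω s) :
    inclM Ω s (expM X) - inclM Ω s (expM Y) =
      dexp (s - 1) X Y (inclM Ω s X - inclM Ω s Y) := by
  have hl : ∀ Z : SobolevMatrix Ω s, inclM Ω s Z = leftL (s - 1) Z (inclM Ω s (oneM Ω s)) := by
    intro Z
    rw [leftL_inclM, leftL_comm, rightL_oneM]; rfl
  have hr : ∀ Z : SobolevMatrix Ω s, inclM Ω s Z = rightL (s - 1) Z (inclM Ω s (oneM Ω s)) := by
    intro Z
    rw [rightL_inclM, ← leftL_comm, leftL_oneM]; rfl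
  rw [hl (expM X), hr (expM Y), hl X, hr Y, leftL_expM, rightL_expM, ← sub_apply, ← sub_apply,
    ← mul_apply_eq_comp, dexp_mul_sub]

end Inclusion

section Convection

variable [Admissible d (s - 1) s]

/-- The operator `v · ∇`, entry by entry. -/
def convL (v : Fin d → SobolevSpace Ω s) : SobolevMatrix Ω s →L[ℝ] SobolevMatrix Ω (s - 1) :=
  ContinuousLinearMap.pi fun i => ContinuousLinearMap.pi fun j =>
    (∑ k, mulCLM Ω (s - 1) s (v k) ∘L pderivCLM Ω s k) ∘L
      ContinuousLinearMap.proj j ∘L ContinuousLinearMap.proj i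

omit hΩ [Admissible d s s] in
theorem convL_apply (v : Fin d → SobolevSpace Ω s) (X : SobolevMatrix Ω s) (i j : Fin d) :
    convL v X i j = ∑ k, mulCLM Ω (s - 1) s (v k) (pderiv k (X i j)) := by
  change (∑ k, mulCLM Ω (s - 1) s (v k) ∘L pderivCLM Ω s k) (X i j) = _
  rw [sum_apply]
  rfl

omit hΩ in
/-- The product rule for `v · ∇`. -/
theorem convL_leftL (v : Fin d → SobolevSpace Ω s) (X Y : SobolevMatrix Ω s) :
    convL v (leftL s X Y) = leftL (s - 1) X (convL v Y) + rightL (s - 1) Y (convL v X) := by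
  refine funext fun i => funext fun j => ?_
  rw [Pi.add_apply, Pi.add_apply, leftL_apply, rightL_apply, convL_apply]
  simp only [convL_apply, leftL_apply, map_sum, mulCLM_mulCLM]
  simp only [← pderivCLM_apply]
  simp only [pderivCLM_apply, pderiv_mulCLM, map_add, Finset.sum_add_distrib, mulCLM_mulCLM]
  congr 1
  · rw [Finset.sum_comm]
    refine Finset.sum_congr rfl fun l _ => Finset.sum_congr rfl fun k _ => ?_
    rw [mulCLM_comm]
  · rw [Finset.sum_comm]
    refine Finset.sum_congr rfl fun l _ => Finset.sum_congr rfl fun k _ => ?_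
    rw [mulCLM_comm]

end Convection

section Representation

omit hΩ in
theorem represents_leftL [Admissible d r s] (X : SobolevMatrix Ω s) {Y : SobolevMatrix Ω r}
    {F : Space d → Matrix (Fin d) (Fin d) ℝ}
    (hF : ∀ i j, Represents (Y i j).toDist fun x => F x i j) (i j : Fin d) :
    Represents (leftL r X Y i j).toDist fun x => (evM x X * F x) i j := by
  simp only [Matrix.mul_apply]
  rw [leftL_apply]
  exact represents_sum _ fun k _ => represents_mulCLM (hF k j) (X i k)

omit hΩ in
theorem represents_rightL [Admissible d r s] (X : SobolevMatrix Ω s) {Y : SobolevMatrix Ω r}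
    {F : Space d → Matrix (Fin d) (Fin d) ℝ}
    (hF : ∀ i j, Represents (Y i j).toDist fun x => F x i j) (i j : Fin d) :
    Represents (rightL r X Y i j).toDist fun x => (F x * evM x X) i j := by
  simp only [Matrix.mul_apply, mul_comm (F _ _ _)]
  rw [rightL_apply]
  exact represents_sum _ fun k _ => represents_mulCLM (hF i k) (X k j)

theorem expM_symm {X : SobolevMatrix Ω s} (hX : ∀ i j, X i j = X j i) (i j : Fin d) :
    expM X i j = expM X j i := by
  refine eq_of_ev_eq fun x hx => ?_
  have h1 : (evM x X)ᵀ = evM x X := by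
    ext i j
    exact congrArg (ev s x) (hX j i)
  have h2 : (evM x (expM X))ᵀ = evM x (expM X) := by
    rw [evM_expM X hx, ← Matrix.exp_transpose, h1]
  exact congrFun (congrFun h2 j) i

end Representation

end ExpDerivative

/-! ### Time-dependent matrices -/

section Time

variable {d : ℕ} {Ω : Opens (Space d)} {r s T : ℝ}

theorem EvolutionSpace.hasTimeDeriv (f : EvolutionSpace Ω s T) :
    HasTimeDeriv f.toCont f.timeDeriv := f.2.choose_spec

theorem neBot_nhdsNE_Icc (hT : 0 < T) (t : Icc (0 : ℝ) T) : (𝓝[≠] t).NeBot := by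
  have h1 : ConnectedSpace (Icc (0 : ℝ) T) :=
    isConnected_iff_connectedSpace.1 (isConnected_Icc hT.le)
  have h2 : Nontrivial (Icc (0 : ℝ) T) :=
    ⟨⟨0, left_mem_Icc.2 hT.le⟩, ⟨T, right_mem_Icc.2 hT.le⟩, fun h =>
      hT.ne (congrArg Subtype.val h)⟩
  infer_instance

theorem HasTimeDeriv.unique (hT : 0 < T) {f : C(Icc (0 : ℝ) T, SobolevSpace Ω s)}
    {g g' : C(Icc (0 : ℝ) T, SobolevSpace Ω (s - 1))} (h : HasTimeDeriv f g)
    (h' : HasTimeDeriv f g') : g = g' := by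
  ext1 t
  have := neBot_nhdsNE_Icc hT t
  exact tendsto_nhds_unique (h t) (h' t)

theorem toCont_sum {ι : Type*} (S : Finset ι) (f : ι → EvolutionSpace Ω s T)
    (t : Icc (0 : ℝ) T) : (∑ i ∈ S, f i).toCont t = ∑ i ∈ S, (f i).toCont t := by
  let L : EvolutionSpace Ω s T →+ SobolevSpace Ω s :=
    { toFun := fun f => f.toCont t, map_zero' := rfl, map_add' := fun _ _ => rfl }
  exact map_sum L f S

theorem tendsto_clm_apply {α E F : Type*} [NormedAddCommGroup E] [NormedSpace ℝ E]
    [NormedAddCommGroup F] [NormedSpace ℝ F] {l : Filter α} {A : α → E →L[ℝ] F} {v : α → E}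
    {A₀ : E →L[ℝ] F} {v₀ : E} (hA : Tendsto A l (𝓝 A₀)) (hv : Tendsto v l (𝓝 v₀)) :
    Tendsto (fun x => A x (v x)) l (𝓝 (A₀ v₀)) :=
  (isBoundedBilinearMap_apply.continuous.tendsto (A₀, v₀)).comp (hA.prodMk_nhds hv)

/-- The matrix at time `t`. -/
def valueM (X : TensorField Ω s T) (t : Icc (0 : ℝ) T) : SobolevMatrix Ω s :=
  fun i j => (X i j).toCont t

theorem continuous_valueM (X : TensorField Ω s T) : Continuous (valueM X) :=
  continuous_pi fun i => continuous_pi fun j => (X i j).toCont.continuous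

theorem norm_toCont_le_stdNorm (X : TensorField Ω s T) (i j : Fin d) :
    ‖(X i j).toCont‖ ≤ stdNorm X := by
  have h1 : ∀ i j, 0 ≤ ‖(X i j).toCont‖ + ‖(X i j).timeDeriv‖ := fun i j => by positivity
  calc ‖(X i j).toCont‖ ≤ ‖(X i j).toCont‖ + ‖(X i j).timeDeriv‖ := by
        have := norm_nonneg (X i j).timeDeriv
        linarith
    _ ≤ ∑ j, (‖(X i j).toCont‖ + ‖(X i j).timeDeriv‖) :=
        Finset.single_le_sum (f := fun j => ‖(X i j).toCont‖ + ‖(X i j).timeDeriv‖)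
          (fun j _ => h1 i j) (Finset.mem_univ j)
    _ ≤ stdNorm X :=
        Finset.single_le_sum (f := fun i => ∑ j, (‖(X i j).toCont‖ + ‖(X i j).timeDeriv‖))
          (fun i _ => Finset.sum_nonneg fun j _ => h1 i j) (Finset.mem_univ i)

theorem norm_valueM_le (X : TensorField Ω s T) (t : Icc (0 : ℝ) T) :
    ‖valueM X t‖ ≤ stdNorm X :=
  norm_le_of_entry_le (Finset.sum_nonneg fun i _ => Finset.sum_nonneg fun j _ => by positivity)
    fun i j => ((X i j).toCont.norm_coe_le_norm t).trans (norm_toCont_le_stdNorm X i j)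

variable [Admissible d (s - 1) s]

/-- The product rule in time. -/
theorem exists_evolution_mul (f g : EvolutionSpace Ω s T) :
    ∃ w : EvolutionSpace Ω s T, ∀ t, w.toCont t = sobolevMul (f.toCont t) (g.toCont t) := by
  let w : C(Icc (0 : ℝ) T, SobolevSpace Ω s) :=
    ⟨fun t => mulCLM Ω s s (g.toCont t) (f.toCont t),
      ((mulCLM Ω s s).continuous.comp g.toCont.continuous).clm_apply f.toCont.continuous⟩
  let w' : C(Icc (0 : ℝ) T, SobolevSpace Ω (s - 1)) :=
    ⟨fun t => mulCLM Ω (s - 1) s (g.toCont t) (f.timeDeriv t) +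
        mulCLM Ω (s - 1) s (f.toCont t) (g.timeDeriv t),
      (((mulCLM Ω (s - 1) s).continuous.comp g.toCont.continuous).clm_apply
        f.timeDeriv.continuous).add
      (((mulCLM Ω (s - 1) s).continuous.comp f.toCont.continuous).clm_apply
        g.timeDeriv.continuous)⟩
  have hw : HasTimeDeriv w w' := by
    intro t
    have h1 : Tendsto (fun τ => mulCLM Ω (s - 1) s (g.toCont τ)) (𝓝[≠] t)
        (𝓝 (mulCLM Ω (s - 1) s (g.toCont t))) :=
      (((mulCLM Ω (s - 1) s).continuous.comp g.toCont.continuous).tendsto t).mono_left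
        nhdsWithin_le_nhds
    have h2 := (tendsto_clm_apply h1 (f.hasTimeDeriv t)).add
      (((mulCLM Ω (s - 1) s (f.toCont t)).continuous.tendsto _).comp (g.hasTimeDeriv t))
    refine h2.congr fun τ => ?_
    change _ = ((τ : ℝ) - t)⁻¹ • (incl (mulCLM Ω s s (g.toCont τ) (f.toCont τ)) -
      incl (mulCLM Ω s s (g.toCont t) (f.toCont t)))
    rw [Function.comp_apply, map_smul, map_smul, ← smul_add, map_sub, map_sub,
      ← incl_mulCLM, ← incl_mulCLM, ← incl_mulCLM, ← incl_mulCLM,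
      mulCLM_comm (g.toCont τ) (f.toCont t), mulCLM_comm (g.toCont t) (f.toCont t)]
    congr 1
    abel
  let W : EvolutionSpace Ω s T := ⟨w, w', hw⟩
  exact ⟨W, fun t => (sobolevMul_eq _ _).symm⟩

theorem toCont_mul (f g : EvolutionSpace Ω s T) (t : Icc (0 : ℝ) T) :
    (f * g).toCont t = mulCLM Ω s s (f.toCont t) (g.toCont t) := by
  have h := exists_evolution_mul f g
  have e : f * g = h.choose := dif_pos h
  rw [e, h.choose_spec t, sobolevMul_eq, mulCLM_comm]

theorem valueM_mul (X Y : TensorField Ω s T) (t : Icc (0 : ℝ) T) :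
    valueM (X * Y) t = leftL s (valueM X t) (valueM Y t) := by
  refine funext fun i => funext fun j => ?_
  rw [leftL_apply, valueM, Matrix.mul_apply, toCont_sum]
  exact Finset.sum_congr rfl fun k _ => toCont_mul _ _ t

variable [hΩ : Fact (Bornology.IsBounded (Ω : Set (Space d)))]

/-- The operators of multiplication by the value of `Ψ` at some time have powers that grow at most
as fast as those of the norm of `Ψ` in the algebra `H`. -/
theorem exists_norm_pow_le {N : Seminorm ℝ (TensorField Ω s T)} (hN : IsBanachAlgebraNorm N)
    (r : ℝ) [Admissible d r s] (Ψ : TensorField Ω s T) (t : Icc (0 : ℝ) T) :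
    ∃ K : ℝ, (∀ n : ℕ, ‖leftL r (valueM Ψ t) ^ n‖ ≤ K * N Ψ ^ n) ∧
      ∀ n : ℕ, ‖rightL r (valueM Ψ t) ^ n‖ ≤ K * N Ψ ^ n := by
  obtain ⟨c, C, hc, hcN⟩ := hN.equiv
  let Z : ℕ → SobolevMatrix Ω s := fun n => (leftL s (valueM Ψ t) ^ n) (oneM Ω s)
  have hpow : ∀ n : ℕ, ∃ Y : TensorField Ω s T, valueM Y t = Z (n + 1) ∧
      N Y ≤ N Ψ ^ (n + 1) := by
    intro n
    induction n with
    | zero =>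
      refine ⟨Ψ, ?_, by rw [zero_add, pow_one]⟩
      have h : Z (0 + 1) = leftL s (valueM Ψ t) (oneM Ω s) := by
        simp only [Z, zero_add, pow_one]
      rw [h, leftL_comm, rightL_oneM]
      rfl
    | succ n ih =>
      obtain ⟨Y, hY, hYN⟩ := ih
      refine ⟨Ψ * Y, ?_, ?_⟩
      · rw [valueM_mul, hY]
        simp only [Z]
        rw [pow_succ' _ (n + 1)]
        rfl
      · refine (hN.mul_le Ψ Y).trans ?_
        rw [pow_succ' _ (n + 1)]
        exact mul_le_mul_of_nonneg_left hYN (apply_nonneg N Ψ)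
  have hZ : ∀ n : ℕ, ‖Z (n + 1)‖ ≤ c⁻¹ * N Ψ ^ (n + 1) := by
    intro n
    obtain ⟨Y, hY, hYN⟩ := hpow n
    rw [← hY, inv_mul_eq_div, le_div_iff₀' hc]
    exact (mul_le_mul_of_nonneg_left (norm_valueM_le Y t) hc.le).trans ((hcN Y).1.trans hYN)
  have hν := apply_nonneg N Ψ
  obtain ⟨lL, hlL⟩ : ∃ l, l = ‖leftL (Ω := Ω) (s := s) r‖ := ⟨_, rfl⟩
  obtain ⟨lR, hlR⟩ : ∃ l, l = ‖rightL (Ω := Ω) (s := s) r‖ := ⟨_, rfl⟩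
  obtain ⟨I, hI⟩ : ∃ I, I = ‖(1 : SobolevMatrix Ω r →L[ℝ] SobolevMatrix Ω r)‖ := ⟨_, rfl⟩
  have hlL0 : 0 ≤ lL := hlL ▸ ContinuousLinearMap.opNorm_nonneg _
  have hlR0 : 0 ≤ lR := hlR ▸ ContinuousLinearMap.opNorm_nonneg _
  have hI0 : 0 ≤ I := hI ▸ ContinuousLinearMap.opNorm_nonneg _
  refine ⟨I + lL * c⁻¹ + lR * c⁻¹, fun n => ?_, fun n => ?_⟩
  · rcases n with _ | n
    · rw [pow_zero, pow_zero, mul_one, add_assoc, ← hI]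
      exact le_add_of_nonneg_right (by positivity)
    · rw [← leftL_pow]
      refine ((leftL r).le_opNorm _).trans ?_
      rw [← hlL]
      calc lL * ‖Z (n + 1)‖ ≤ lL * (c⁻¹ * N Ψ ^ (n + 1)) := by gcongr; exact hZ n
        _ = (lL * c⁻¹) * N Ψ ^ (n + 1) := by ring
        _ ≤ _ := by
          gcongr
          have : 0 ≤ lR * c⁻¹ := by positivity
          linarith
  · rcases n with _ | n
    · rw [pow_zero, pow_zero, mul_one, add_assoc, ← hI]
      exact le_add_of_nonneg_right (by positivity)
    · rw [← rightL_pow]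
      refine ((rightL r).le_opNorm _).trans ?_
      rw [← hlR]
      calc lR * ‖Z (n + 1)‖ ≤ lR * (c⁻¹ * N Ψ ^ (n + 1)) := by gcongr; exact hZ n
        _ = (lR * c⁻¹) * N Ψ ^ (n + 1) := by ring
        _ ≤ _ := by
          gcongr
          have : 0 ≤ lL * c⁻¹ := by positivity
          linarith

/-- The time derivatives of the entries. -/
def timeDerivM (X : TensorField Ω s T) (t : Icc (0 : ℝ) T) : SobolevMatrix Ω (s - 1) :=
  fun i j => (X i j).timeDeriv t

omit [Admissible d (s - 1) s] hΩ in
theorem continuous_timeDerivM (X : TensorField Ω s T) : Continuous (timeDerivM X) :=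
  continuous_pi fun i => continuous_pi fun j => (X i j).timeDeriv.continuous

/-- The exponential of a time-dependent matrix is again continuously differentiable in time. -/
theorem exists_exp_tensorField (hT : 0 < T) (Ψ : TensorField Ω s T) :
    ∃ σ : TensorField Ω s T, (∀ t, valueM σ t = expM (valueM Ψ t)) ∧
      ∀ t, timeDerivM σ t = dexp (s - 1) (valueM Ψ t) (valueM Ψ t) (timeDerivM Ψ t) := by
  let g : Icc (0 : ℝ) T → SobolevMatrix Ω (s - 1) :=
    fun t => dexp (s - 1) (valueM Ψ t) (valueM Ψ t) (timeDerivM Ψ t)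
  have hg : Continuous g :=
    (continuous_dexp.comp ((continuous_valueM Ψ).prodMk (continuous_valueM Ψ))).clm_apply
      (continuous_timeDerivM Ψ)
  have hf : Continuous fun t => expM (valueM Ψ t) := continuous_expM.comp (continuous_valueM Ψ)
  have hderiv : ∀ t : Icc (0 : ℝ) T, Tendsto (fun τ : Icc (0 : ℝ) T => ((τ : ℝ) - t)⁻¹ •
      (inclM Ω s (expM (valueM Ψ τ)) - inclM Ω s (expM (valueM Ψ t)))) (𝓝[≠] t) (𝓝 (g t)) := by
    intro t
    have h1 : Tendsto (fun τ : Icc (0 : ℝ) T => ((τ : ℝ) - t)⁻¹ •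
        (inclM Ω s (valueM Ψ τ) - inclM Ω s (valueM Ψ t))) (𝓝[≠] t) (𝓝 (timeDerivM Ψ t)) :=
      tendsto_pi_nhds.2 fun i => tendsto_pi_nhds.2 fun j => (Ψ i j).hasTimeDeriv t
    have h2 : Tendsto (fun τ => dexp (s - 1) (valueM Ψ τ) (valueM Ψ t)) (𝓝[≠] t)
        (𝓝 (dexp (s - 1) (valueM Ψ t) (valueM Ψ t))) :=
      ((continuous_dexp.comp ((continuous_valueM Ψ).prodMk continuous_const)).tendsto t).mono_left
        nhdsWithin_le_nhds
    refine (tendsto_clm_apply h2 h1).congr fun τ => ?_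
    rw [map_smul, inclM_expM_sub]
  let F : Fin d → Fin d → C(Icc (0 : ℝ) T, SobolevSpace Ω s) := fun i j =>
    ⟨fun t => expM (valueM Ψ t) i j, continuous_pi_iff.1 (continuous_pi_iff.1 hf i) j⟩
  let G : Fin d → Fin d → C(Icc (0 : ℝ) T, SobolevSpace Ω (s - 1)) := fun i j =>
    ⟨fun t => g t i j, continuous_pi_iff.1 (continuous_pi_iff.1 hg i) j⟩
  have hFG : ∀ i j, HasTimeDeriv (F i j) (G i j) := fun i j t =>
    tendsto_pi_nhds.1 (tendsto_pi_nhds.1 (hderiv t) i) j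
  let σ : TensorField Ω s T := fun i j => ⟨F i j, G i j, hFG i j⟩
  refine ⟨σ, fun t => rfl, fun t => funext fun i => funext fun j => ?_⟩
  have h := (σ i j).hasTimeDeriv.unique hT (hFG i j)
  exact congrArg (fun G => G t) h

end Time

/-! ### The two equations -/

section Equivalence

open NormedSpace

variable {d : ℕ}

/-- The pointwise right hand side of the first equation, whose product with `e^M` is a multiple of
`P(e^M)`, commutes with `M`. -/
theorem commute_source (M : Matrix (Fin d) (Fin d) ℝ) (P : ℝ → ℝ) (c : ℝ) :
    Commute M (c • (cfc P (exp M) * exp (-M))) ∧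
      exp M * (c • (cfc P (exp M) * exp (-M))) = c • cfc P (exp M) := by
  have h : ∀ B : Matrix (Fin d) (Fin d) ℝ, Commute (exp M) B → Commute (cfc P (exp M)) B := by
    intro B hB
    by_cases hM : IsSelfAdjoint (exp M)
    · exact Commute.cfc hB (by rwa [hM.star_eq]) P
    · rw [cfc_apply_of_not_predicate _ hM]
      exact Commute.zero_left B
  have h1 : Commute (cfc P (exp M)) M := h M ((Commute.refl M).exp_right).symm
  have h2 : Commute M (exp (-M)) := (Commute.refl M).neg_right.exp_right
  refine ⟨(h1.symm.mul_right h2).smul_right c, ?_⟩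
  rw [mul_smul_comm, ← mul_assoc, ← (h _ (Commute.refl (exp M))).eq, mul_assoc,
    ← Matrix.exp_add_of_commute _ _ (Commute.refl M).neg_right, add_neg_cancel, exp_zero, mul_one]

variable {Ω : Opens (Space d)} {s T : ℝ} [Admissible d (s - 1) s]

theorem field_ae_eq (X : TensorField Ω s T) (t : Icc (0 : ℝ) T) :
    ∀ᵐ x ∂(volume.restrict (Ω : Set (Space d))), field X t x = evM x (valueM X t) := by
  have h : ∀ᵐ x ∂(volume.restrict (Ω : Set (Space d))), ∀ i j,
      ((X i j).toCont t).toFun x = ev s x ((X i j).toCont t) :=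
    ae_all_iff.2 fun i => ae_all_iff.2 fun j => toFun_ae_eq_ev _
  filter_upwards [h] with x hx
  ext i j
  exact hx i j

theorem materialDeriv_eq (v : Fin d → SobolevSpace Ω s) (X : TensorField Ω s T)
    (t : Icc (0 : ℝ) T) : materialDeriv v X t = timeDerivM X t + convL v (valueM X t) := by
  ext1 i j
  rw [Pi.add_apply, Pi.add_apply, convL_apply]
  simp only [materialDeriv, Matrix.of_apply, sobolevMul_eq]
  rfl

variable [hΩ : Fact (Bornology.IsBounded (Ω : Set (Space d)))]

/-- If `L` commutes with `X`, then the differential of the exponential at `X` acts on `L` as the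
multiplication by `e^X`. -/
theorem dexp_apply_of_commute {r : ℝ} [Admissible d r s] {X : SobolevMatrix Ω s}
    {L : SobolevMatrix Ω r} (h : leftL r X L = rightL r X L) :
    dexp r X X L = leftL r (expM X) L := by
  have h0 : (rightL r X - leftL r X) L = 0 := by rw [sub_apply, h, sub_self]
  have h1 : expQuot (rightL r X - leftL r X) L = L := by
    have h2 := (ContinuousLinearMap.apply ℝ (SobolevMatrix Ω r) L).hasSum
      (hasSum_expQuot (rightL r X - leftL r X))
    refine h2.unique ?_
    have h3 : ∀ n : ℕ, n ≠ 0 → ContinuousLinearMap.apply ℝ (SobolevMatrix Ω r) L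
        (((n + 1).factorial : ℝ)⁻¹ • (rightL r X - leftL r X) ^ n) = 0 := by
      intro n hn
      obtain ⟨m, rfl⟩ := Nat.exists_eq_succ_of_ne_zero hn
      rw [map_smul, Nat.succ_eq_add_one, pow_succ, ContinuousLinearMap.apply_apply,
        mul_apply_eq_comp, h0, map_zero, smul_zero]
    have h4 := hasSum_single 0 h3
    rw [zero_add, Nat.factorial_one, Nat.cast_one, inv_one, one_smul, pow_zero] at h4
    exact h4
  rw [dexp, mul_apply_eq_comp, h1, leftL_expM]

/-- The left hand sides of the two equations differ by the factor `σ = e^Ψ`. -/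
theorem constitutiveLHS_eq {N : Seminorm ℝ (TensorField Ω s T)} (hN : IsBanachAlgebraNorm N)
    {u : C(Icc (0 : ℝ) T, Fin d → SobolevSpace Ω s)} {Ψ σ : TensorField Ω s T}
    (hΨ : N Ψ < Real.pi) (t : Icc (0 : ℝ) T)
    (hσ : valueM σ t = expM (valueM Ψ t))
    (hσ' : timeDerivM σ t = dexp (s - 1) (valueM Ψ t) (valueM Ψ t) (timeDerivM Ψ t))
    (hL : leftL (s - 1) (valueM Ψ t) (logConfLHS u Ψ t) =
      rightL (s - 1) (valueM Ψ t) (logConfLHS u Ψ t)) :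
    constitutiveLHS u σ t = leftL (s - 1) (expM (valueM Ψ t)) (logConfLHS u Ψ t) := by
  obtain ⟨K, hKL, hKR⟩ := exists_norm_pow_le hN (s - 1) Ψ t
  obtain ⟨E, hE, hdE⟩ := dexp_bernoulli (apply_nonneg N Ψ) hΨ hKL hKR
  set X := valueM Ψ t with hX
  set ε : SobolevMatrix Ω (s - 1) := strain (u t) with hε
  set W : SobolevMatrix Ω (s - 1) := vorticity (u t) with hW
  set L : SobolevMatrix Ω (s - 1) := logConfLHS u Ψ t with hLdef
  set Y : SobolevMatrix Ω (s - 1) := timeDerivM Ψ t + convL (u t) X with hY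
  have hsum : ∑' n : ℕ, ((bernoulli (2 * n) : ℝ) / (Nat.factorial (2 * n) : ℝ)) •
      iterComm (valueAt Ψ t) (strain (u t)) (2 * n) = E ε := by
    refine HasSum.tsum_eq ?_
    have h := (ContinuousLinearMap.apply ℝ (SobolevMatrix Ω (s - 1)) ε).hasSum hE
    simp only [map_smul] at h
    refine h.congr_fun fun n => ?_
    rw [iterComm_eq]
    rfl
  have hLY : L = Y + (leftL (s - 1) X - rightL (s - 1) X) W - (2 : ℝ) • E ε := by
    rw [hLdef, logConfLHS, hsum, comm_eq, materialDeriv_eq]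
    rfl
  have hYL : Y = L - (leftL (s - 1) X - rightL (s - 1) X) W + ((2 : ℝ) • E) ε := by
    rw [hLY, smul_apply]
    abel
  have hconv : convL (u t) (expM X) = dexp (s - 1) X X (convL (u t) X) :=
    derivation_expM _ (convL_leftL (u t)) X
  have hmat : materialDeriv (u t) σ t = dexp (s - 1) X X Y := by
    rw [materialDeriv_eq, hσ, hσ', hconv, hY, map_add]
  have hdY : dexp (s - 1) X X Y = leftL (s - 1) (expM X) L -
      (leftL (s - 1) (expM X) W - rightL (s - 1) (expM X) W) +
      (leftL (s - 1) (expM X) ε + rightL (s - 1) (expM X) ε) := by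
    rw [hYL, map_add, map_sub, dexp_apply_of_commute hL, ← mul_apply_eq_comp, ← mul_apply_eq_comp,
      dexp_mul_sub, hdE, sub_apply, add_apply, leftL_expM, rightL_expM]
  have hval : valueAt σ t = expM X := hσ
  have h1 : constitutiveLHS u σ t = dexp (s - 1) X X Y - rightL (s - 1) (expM X) (ε + W) -
      leftL (s - 1) (expM X) (ε - W) := by
    rw [constitutiveLHS, hmat, rightMul_eq, leftMul_eq, hval]
    rfl
  rw [h1, hdY, map_add, map_sub]
  abel

end Equivalence

theorem solvesConstitutive_of_solvesLogConf {d : ℕ} {Ω : Opens (Space d)} {s T : ℝ}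
    [Admissible d (s - 1) s] [Fact (Bornology.IsBounded (Ω : Set (Space d)))] (hT : 0 < T)
    (lam : ℝ) (P : ℝ → ℝ) {N : Seminorm ℝ (TensorField Ω s T)} (hN : IsBanachAlgebraNorm N)
    (u : C(Icc (0 : ℝ) T, Fin d → SobolevSpace Ω s)) (Ψ : TensorField Ω s T) (hsymm : Ψ.IsSymm)
    (hΨ : N Ψ < Real.pi) (heq : SolvesLogConf lam P u Ψ) :
    ∃ σ : TensorField Ω s T, σ.IsSymm ∧ IsExp Ψ σ ∧ SolvesConstitutive lam P u σ := by
  obtain ⟨σ, hσ, hσ'⟩ := exists_exp_tensorField hT Ψ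
  have hexp : IsExp Ψ σ := by
    intro t
    filter_upwards [field_ae_eq σ t, field_ae_eq Ψ t,
      ae_restrict_mem Ω.isOpen.measurableSet] with x h1 h2 hx
    rw [h1, h2, hσ, evM_expM _ hx]
  refine ⟨σ, ?_, hexp, fun t => ?_⟩
  · refine Matrix.IsSymm.ext fun i j => Subtype.ext (ContinuousMap.ext fun t => ?_)
    have h := expM_symm (X := valueM Ψ t) (fun i j => by
      rw [valueM, valueM, hsymm.apply]) j i
    rw [← hσ] at h
    exact h
  · set R : Space d → Matrix (Fin d) (Fin d) ℝ := fun x =>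
      -(1 / lam) • (cfc P (NormedSpace.exp (field Ψ t x)) * NormedSpace.exp (-(field Ψ t x)))
    have hR : ∀ i j, Represents (logConfLHS u Ψ t i j).toDist fun x => R x i j :=
      fun i j => heq t i j
    have hcomm : leftL (s - 1) (valueM Ψ t) (logConfLHS u Ψ t) =
        rightL (s - 1) (valueM Ψ t) (logConfLHS u Ψ t) := by
      refine funext fun i => funext fun j => ?_
      refine (represents_leftL (valueM Ψ t) hR i j).unique
        ((represents_rightL (valueM Ψ t) hR i j).congr ?_)
      filter_upwards [field_ae_eq Ψ t] with x hx
      rw [← hx, (commute_source (field Ψ t x) P _).1.eq]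
    intro i j
    rw [constitutiveLHS_eq hN hΨ t (hσ t) (hσ' t) hcomm]
    refine (represents_leftL (expM (valueM Ψ t)) hR i j).congr ?_
    filter_upwards [field_ae_eq σ t, hexp t] with x h1 h2
    rw [← hσ, ← h1, h2, (commute_source (field Ψ t x) P _).2]

end

end LogConf

theorem theorem1 (d : ℕ) (Ω : Opens (LogConf.Space d))
    (hΩ : Bornology.IsBounded (Ω : Set (LogConf.Space d)))
    (s : ℝ) (hs : (d : ℝ) / 2 < s) (T : ℝ) (hT : 0 < T)
    (lam : ℝ) (hlam : lam ≠ 0) (P : ℝ → ℝ) (hP : AnalyticOnNhd ℝ P (Ioi 0))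
    (N : Seminorm ℝ (LogConf.TensorField Ω s T)) (hN : LogConf.IsBanachAlgebraNorm N)
    (u : C(Icc (0 : ℝ) T, Fin d → LogConf.SobolevSpace Ω s))
    (Ψ : LogConf.TensorField Ω s T) (hsymm : Ψ.IsSymm) (hΨ : N Ψ < Real.pi)
    (heq : LogConf.SolvesLogConf lam P u Ψ) :
    ∃ σ : LogConf.TensorField Ω s T,
      σ.IsSymm ∧ LogConf.IsExp Ψ σ ∧ LogConf.SolvesConstitutive lam P u σ := by
  rcases Nat.eq_zero_or_pos d with rfl | hd
  -- For `d = 0` all matrices are empty. Otherwise `s > 1/2`, and therefore `|s - 1| ≤ s`.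
  · exact ⟨Ψ, hsymm, fun t => Eventually.of_forall fun x => Subsingleton.elim _ _,
      fun t i => i.elim0⟩
  · have hd1 : (1 : ℝ) ≤ d := by exact_mod_cast hd
    have : LogConf.Admissible d (s - 1) s := ⟨abs_le.2 ⟨by linarith, by linarith⟩, hs⟩
    have : Fact (Bornology.IsBounded (Ω : Set (LogConf.Space d))) := ⟨hΩ⟩
    exact LogConf.solvesConstitutive_of_solvesLogConf hT lam P hN u Ψ hsymm hΨ heq
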